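/- Let $p\ge 4$ be an integer. For a simplex $s\subset\mathbb R^3$ let $\mathcal P_k(s)$ be the space of restrictions to $s$ of real polynomials of degree at most $k$ (so $\mathcal P_k(s)=0$ for $k<0$). For a tetrahedron $K$ let $\mathrm{RT}_{k}(K)=[\mathcal P_{k-1}(K)]^3+\boldsymbol x\,\mathcal P_{k-1}(K)$. For each edge $e$ fix two linearly independent unit vectors $\boldsymbol\nu_{e,1},\boldsymbol\nu_{e,2}$ normal to $e$. For each triangle $f$ fix a unit normal $\boldsymbol\nu_f$, let $\lambda_{f,1},\lambda_{f,2},\lambda_{f,3}$ be its barycentric coordinates, put $\operatorname{curl}_f\varphi=\nabla_f\varphi\times\boldsymbol\nu_f$ for a scalar function $\varphi$ on $f$, and let $\mathcal P_k(f)/\mathbb R=\{q\in\mathcal P_k(f):\int_f q=0\}$. For a tetrahedron $K$ and a vector field $\boldsymbol w\in[\mathcal P_p(K)]^3$ consider the following degrees of freedom: 1. $\boldsymbol w(\boldsymbol x)$ and $\partial_i\boldsymbol w(\boldsymbol x)$, $i=1,2,3$, at each vertex $\boldsymbol x$ of $K$; 2. $\int_e\boldsymbol w\cdot\boldsymbol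 q$ for $\boldsymbol q\in[\mathcal P_{p-4}(e)]^3$, on each edge $e$ of $K$; 3. $\int_e(\operatorname{curl}\boldsymbol w\cdot\boldsymbol\nu_{e,i})\,q$ for $q\in\mathcal P_{p-3}(e)$ and $i=1,2$, on each edge $e$ of $K$; 4. $\int_f(\boldsymbol w\times\boldsymbol\nu_f)\cdot\operatorname{curl}_f(\psi\,\lambda_{f,1}^2\lambda_{f,2}^2\lambda_{f,3}^2)$ for $\psi\in\mathcal P_{p-5}(f)$, on each face $f$ of $K$; 5. $\int_f(\operatorname{curl}\boldsymbol w\cdot\boldsymbol\nu_f)\,g$ for $g\in\mathcal P_{p-4}(f)/\mathbb R$, on each face $f$ of $K$; 6. $\int_K\boldsymbol w\cdot\boldsymbol z$ for $\boldsymbol z\in\mathrm{RT}_{p-2}(K)$. **(Unisolvence.)** On every nondegenerate tetrahedron $K$ these degrees of freedom are unisolvent for $[\mathcal P_p(K)]^3$: for arbitrary prescribed values (for each family of moments, an arbitrary linear functional on its test space) there is exactly one $\boldsymbol w\in[\mathcal P_p(K)]^3$ that attains them. **(The global space, $H(\operatorname{curl})$-conformity.)** Let $\mathcal T$ be a finite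 conforming tetrahedral mesh in $\mathbb R^3$ (a finite simplicial complex in which every simplex is a face of a tetrahedron), and let $\Omega$ be the interior of the union of its tetrahedra. Let $\mathcal W^1_p(\mathcal T)$ be the space of the fields $\boldsymbol u$ with $\boldsymbol u|_K\in[\mathcal P_p(K)]^3$ for each tetrahedron $K\in\mathcal T$ for which the degrees of freedom 1–5 at each vertex, edge and face of $\mathcal T$ are single-valued, that is, take the same value from all the tetrahedra containing that vertex, edge or face. Then $\mathcal W^1_p(\mathcal T)\subset H(\operatorname{curl};\Omega)$. Moreover $\mathcal W^1_p(\mathcal T)$ consists exactly of the piecewise polynomial fields $\boldsymbol u$ of degree at most $p$ such that $\boldsymbol u\in H(\operatorname{curl};\Omega)$, the values and first derivatives of $\boldsymbol u$ are single-valued at the vertices, and the values of $\boldsymbol u$ and of the components of $\operatorname{curl}\boldsymbol u$ normal to the edge are single-valued on each edge. For arbitrary prescribed values of all the degrees of freedom over the vertices, edges, faces and tetrahedra of $\mathcal T$ there is exactly one $\boldsymbol u\in\mathcal W^1_p(\mathcal T)$ that attains them. -/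

import Mathlib

open MeasureTheory
open scoped ContDiff

noncomputable section

namespace NodalCurl

/-- Euclidean three-space. -/
abbrev E3 : Type := EuclideanSpace ℝ (Fin 3)

/-! ### Polynomials and polynomial vector fields -/

/-- Real polynomials in the three Cartesian coordinates. -/
abbrev Poly : Type := MvPolynomial (Fin 3) ℝ

/-- Polynomial vector fields on three-space. -/
abbrev PolyField : Type := Fin 3 → Poly

/-- The polynomials of total degree at most `k`; this is the zero space when `k < 0`. -/
def polyDeg (k : ℤ) : Submodule ℝ Poly :=
  MvPolynomial.restrictSupport ℝ {m | (m.degree : ℤ) ≤ k}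

/-- The vector fields all of whose components have degree at most `k`. -/
def polyFieldDeg (k : ℤ) : Submodule ℝ PolyField :=
  Submodule.pi Set.univ fun _ => polyDeg k

/-- Multiplication of the position vector by a scalar polynomial, `b ↦ x b`. -/
def positionMul : Poly →ₗ[ℝ] PolyField :=
  LinearMap.pi fun i => LinearMap.mulLeft ℝ (MvPolynomial.X i)

/-- The Raviart-Thomas shape functions `[P_{k-1}]³ + x P_{k-1}`. -/
def raviartThomas (k : ℤ) : Submodule ℝ PolyField :=
  polyFieldDeg (k - 1) ⊔ (polyDeg (k - 1)).map positionMul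

/-- The function on three-space given by a polynomial. -/
def polyFun : Poly →ₗ[ℝ] (E3 → ℝ) :=
  LinearMap.pi fun x => (MvPolynomial.aeval fun i => x i).toLinearMap

/-- The vector field on three-space given by a triple of polynomials. -/
def fieldFun : PolyField →ₗ[ℝ] (E3 → E3) where
  toFun w x := WithLp.toLp 2 fun i => polyFun (w i) x
  map_add' w z := by ext x i; simp
  map_smul' c w := by ext x i; simp

/-- The partial derivative `∂ᵢ w` of a polynomial vector field. -/
def partialField (i : Fin 3) (w : PolyField) : PolyField :=
  fun j => MvPolynomial.pderiv i (w j)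

/-- The curl of a polynomial vector field. -/
def curlField (w : PolyField) : PolyField :=
  ![MvPolynomial.pderiv 1 (w 2) - MvPolynomial.pderiv 2 (w 1),
    MvPolynomial.pderiv 2 (w 0) - MvPolynomial.pderiv 0 (w 2),
    MvPolynomial.pderiv 0 (w 1) - MvPolynomial.pderiv 1 (w 0)]

/-- The gradient of a polynomial. -/
def gradField (P : Poly) : PolyField := fun i => MvPolynomial.pderiv i P

/-- The cross product on Euclidean three-space. -/
def cross (u v : E3) : E3 := WithLp.toLp 2 (crossProduct u.ofLp v.ofLp)

/-! ### Simplices and test spaces -/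

/-- The closed simplex with the given vertices. -/
def hull (s : Finset E3) : Set E3 := convexHull ℝ (s : Set E3)

/-- Restriction to `s`. A function on `s` is stored as its extension by zero. -/
def restrictTo (F : Type) [AddCommGroup F] [Module ℝ F] (s : Set E3) :
    (E3 → F) →ₗ[ℝ] (E3 → F) where
  toFun g := s.indicator g
  map_add' g h := Set.indicator_add s g h
  map_smul' c g := Set.indicator_const_smul s c g

/-- `P_k(s)`: the restrictions to the simplex `s` of the polynomials of degree at most `k`. -/
def polyOn (s : Finset E3) (k : ℤ) : Submodule ℝ (E3 → ℝ) :=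
  (polyDeg k).map (restrictTo ℝ (hull s) ∘ₗ polyFun)

/-- `[P_k(s)]³`. -/
def polyFieldOn (s : Finset E3) (k : ℤ) : Submodule ℝ (E3 → E3) :=
  (polyFieldDeg k).map (restrictTo E3 (hull s) ∘ₗ fieldFun)

/-- `RT_k(K)`. -/
def raviartThomasOn (K : Finset E3) (k : ℤ) : Submodule ℝ (E3 → E3) :=
  (raviartThomas k).map (restrictTo E3 (hull K) ∘ₗ fieldFun)

/-- `P_k(f)/ℝ`: the elements of `P_k(f)` with zero mean on the triangle `f`.
(For a triangle the set on the right is already a linear subspace.) -/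
def meanZeroOn (f : Finset E3) (k : ℤ) : Submodule ℝ (E3 → ℝ) :=
  Submodule.span ℝ {q | q ∈ polyOn f k ∧ ∫ x in hull f, q x ∂μHE[2] = 0}

/-- `L a`, for `a ∈ f`, are affine functions on space which restrict on the triangle `f` to its
barycentric coordinates. -/
def IsBarycentric (f : Finset E3) (L : E3 → Poly) : Prop :=
  ∀ a ∈ f, L a ∈ polyDeg 1 ∧ polyFun (L a) a = 1 ∧ ∀ b ∈ f, b ≠ a → polyFun (L a) b = 0

/-- The space of the fields `curl_f (ψ λ₁² λ₂² λ₃²)` on the triangle `f` with `ψ ∈ P_k(f)`.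
The surface curl with respect to the unit normal `ν` is `curl_f φ = ∇φ × ν`; on `f` this only
depends on the restriction of `φ` to `f`. In positively oriented orthonormal coordinates of the
plane it is `(∂₂ φ, -∂₁ φ)`.
(For a triangle the set on the right is already a linear subspace.) -/
def curlBubbleOn (f : Finset E3) (ν : E3) (k : ℤ) : Submodule ℝ (E3 → E3) :=
  Submodule.span ℝ {q | ∃ ψ ∈ polyDeg k, ∃ L : E3 → Poly, IsBarycentric f L ∧
    q = (hull f).indicator fun x => cross (fieldFun (gradField (ψ * ∏ a ∈ f, L a ^ 2)) x) ν}

/-- `ν 0` and `ν 1` are linearly independent unit normal vectors of the edge `e`. -/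
def IsEdgeNormals (e : Finset E3) (ν : Fin 2 → E3) : Prop :=
  (∀ i, ‖ν i‖ = 1) ∧ (∀ i, ∀ a ∈ e, ∀ b ∈ e, inner ℝ (a - b) (ν i) = 0) ∧
    LinearIndependent ℝ ν

/-- `ν` is a unit normal vector of the triangle `f`. -/
def IsFaceNormal (f : Finset E3) (ν : E3) : Prop :=
  ‖ν‖ = 1 ∧ ∀ a ∈ f, ∀ b ∈ f, inner ℝ (a - b) ν = 0

/-! ### Degrees of freedom -/

/-- A prescription of values for all the degrees of freedom of degree `p`. A family of moments
against all elements of a test space is a linear functional on that space. Vertices are points,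
and edges, faces and cells are given by their vertex sets; only the entries that belong to
simplices of the tetrahedron, or of the mesh, at hand are ever used. -/
structure DofValues (p : ℕ) (νf : Finset E3 → E3) where
  value : E3 → E3
  deriv : E3 → Fin 3 → E3
  edge : ∀ e : Finset E3, Module.Dual ℝ (polyFieldOn e ((p : ℤ) - 4))
  edgeCurl : ∀ e : Finset E3, Fin 2 → Module.Dual ℝ (polyOn e ((p : ℤ) - 3))
  face : ∀ f : Finset E3, Module.Dual ℝ (curlBubbleOn f (νf f) ((p : ℤ) - 5))
  faceCurl : ∀ f : Finset E3, Module.Dual ℝ (meanZeroOn f ((p : ℤ) - 4))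
  interior : ∀ K : Finset E3, Module.Dual ℝ (raviartThomasOn K ((p : ℤ) - 2))

/-- The degrees of freedom of `w` on the tetrahedron `K` take the values `d`. -/
structure HasDofs {p : ℕ} (νe : Finset E3 → Fin 2 → E3) (νf : Finset E3 → E3)
    (K : Finset E3) (w : PolyField) (d : DofValues p νf) : Prop where
  value : ∀ a ∈ K, fieldFun w a = d.value a
  deriv : ∀ a ∈ K, ∀ i, fieldFun (partialField i w) a = d.deriv a i
  edge : ∀ e ⊆ K, e.card = 2 → ∀ q : polyFieldOn e ((p : ℤ) - 4),
    ∫ x in hull e, inner ℝ (fieldFun w x) (q.1 x) ∂μHE[1] = d.edge e q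
  edgeCurl : ∀ e ⊆ K, e.card = 2 → ∀ i, ∀ q : polyOn e ((p : ℤ) - 3),
    ∫ x in hull e, inner ℝ (fieldFun (curlField w) x) (νe e i) * q.1 x ∂μHE[1]
      = d.edgeCurl e i q
  face : ∀ f ⊆ K, f.card = 3 → ∀ q : curlBubbleOn f (νf f) ((p : ℤ) - 5),
    ∫ x in hull f, inner ℝ (cross (fieldFun w x) (νf f)) (q.1 x) ∂μHE[2] = d.face f q
  faceCurl : ∀ f ⊆ K, f.card = 3 → ∀ g : meanZeroOn f ((p : ℤ) - 4),
    ∫ x in hull f, inner ℝ (fieldFun (curlField w) x) (νf f) * g.1 x ∂μHE[2]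
      = d.faceCurl f g
  interior : ∀ z : raviartThomasOn K ((p : ℤ) - 2),
    ∫ x in hull K, inner ℝ (fieldFun w x) (z.1 x) = d.interior K z

/-! ### The space `H(curl; Ω)` -/

/-- The curl of a differentiable vector field. -/
def vcurl (φ : E3 → E3) (x : E3) : E3 :=
  let D : Fin 3 → Fin 3 → ℝ := fun j i => fderiv ℝ φ x (EuclideanSpace.single j 1) i
  !₂[D 1 2 - D 2 1, D 2 0 - D 0 2, D 0 1 - D 1 0]

/-- `u ∈ H(curl; Ω)`: `u` is square integrable on `Ω` and has a square integrable weak curl. -/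
def MemHCurl (Ω : Set E3) (u : E3 → E3) : Prop :=
  MemLp u 2 (volume.restrict Ω) ∧ ∃ g : E3 → E3, MemLp g 2 (volume.restrict Ω) ∧
    ∀ φ : E3 → E3, ContDiff ℝ ∞ φ → HasCompactSupport φ → tsupport φ ⊆ Ω →
      ∫ x in Ω, inner ℝ (u x) (vcurl φ x) = ∫ x in Ω, inner ℝ (g x) (φ x)

/-! ### Meshes and global spaces -/

/-- A tetrahedral mesh: a finite simplicial complex in three-space in which each simplex is a face
of a tetrahedron of the complex. -/
def IsTetMesh (T : Geometry.SimplicialComplex ℝ E3) : Prop :=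
  T.faces.Finite ∧ ∀ s ∈ T.faces, ∃ K ∈ T.faces, K.card = 4 ∧ s ⊆ K

/-- The tetrahedra of a mesh. -/
def Cell (T : Geometry.SimplicialComplex ℝ E3) : Type :=
  {K : Finset E3 // K ∈ T.faces ∧ K.card = 4}

/-- The domain triangulated by a mesh. -/
def domain (T : Geometry.SimplicialComplex ℝ E3) : Set E3 := interior T.space

/-- A piecewise polynomial field assigns a polynomial field to each tetrahedron. -/
abbrev PiecewiseField (T : Geometry.SimplicialComplex ℝ E3) : Type := Cell T → PolyField

/-- The (almost everywhere defined) vector field given by a piecewise polynomial field; it is set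
to zero off the open tetrahedra. -/
def glue {T : Geometry.SimplicialComplex ℝ E3} (u : PiecewiseField T) (x : E3) : E3 :=
  ∑ᶠ K : Cell T, (interior (hull K.1)).indicator (fieldFun (u K)) x

/-- All pieces of `u` have degree at most `p`. -/
def PiecewiseDeg {T : Geometry.SimplicialComplex ℝ E3} (p : ℕ) (u : PiecewiseField T) : Prop :=
  ∀ K, u K ∈ polyFieldDeg p

/-- `u ∈ C¹(𝒱)`: values and first derivatives coincide at the vertices. -/
def C1Vertices {T : Geometry.SimplicialComplex ℝ E3} (u : PiecewiseField T) : Prop :=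
  ∀ K K' : Cell T, ∀ a ∈ K.1, a ∈ K'.1 → fieldFun (u K) a = fieldFun (u K') a ∧
    ∀ i, fieldFun (partialField i (u K)) a = fieldFun (partialField i (u K')) a

/-- `u ∈ C⁰(ℰ)`: values coincide on the edges. -/
def C0Edges {T : Geometry.SimplicialComplex ℝ E3} (u : PiecewiseField T) : Prop :=
  ∀ K K' : Cell T, ∀ e ⊆ K.1, e ⊆ K'.1 → e.card = 2 → ∀ x ∈ hull e,
    fieldFun (u K) x = fieldFun (u K') x

/-- `curl u · ν ∈ C⁰(ℰ)` for the vectors `ν` normal to the edge: the normal components of the curl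
coincide on the edges. -/
def CurlNormalC0Edges {T : Geometry.SimplicialComplex ℝ E3} (u : PiecewiseField T) : Prop :=
  ∀ K K' : Cell T, ∀ e ⊆ K.1, e ⊆ K'.1 → e.card = 2 → ∀ x ∈ hull e,
    ∀ ν : E3, (∀ a ∈ e, ∀ b ∈ e, inner ℝ (a - b) ν = 0) →
      inner ℝ (fieldFun (curlField (u K)) x) ν = inner ℝ (fieldFun (curlField (u K')) x) ν

/-- The finite element space assembled from the degrees of freedom: the piecewise polynomial fields
of degree at most `p` whose degrees of freedom at the vertices, edges and faces are single-valued,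
that is, do not depend on the tetrahedron from which they are computed. -/
def assembledSpace (p : ℕ) (T : Geometry.SimplicialComplex ℝ E3)
    (νe : Finset E3 → Fin 2 → E3) (νf : Finset E3 → E3) : Set (PiecewiseField T) :=
  {u | PiecewiseDeg p u ∧ ∃ d : DofValues p νf, ∀ K, HasDofs νe νf K.1 (u K) d}

/-- The space `𝒲¹_p(𝒯)` described by continuity: the `u ∈ H(curl; Ω)` that are piecewise
polynomial of degree at most `p`, with `u ∈ C¹(𝒱) ∩ C⁰(ℰ)` and with the normal components of
`curl u` in `C⁰(ℰ)`. -/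
def W1 (p : ℕ) (T : Geometry.SimplicialComplex ℝ E3) : Set (PiecewiseField T) :=
  {u | PiecewiseDeg p u ∧ MemHCurl (domain T) (glue u) ∧ C1Vertices u ∧ C0Edges u ∧
    CurlNormalC0Edges u}

end NodalCurl

end

open MeasureTheory
open scoped ContDiff

noncomputable section

namespace NodalCurl

open MvPolynomial

/-! ### Parametrised simplices -/

/-! Unisolvence is injectivity plus a dimension count. Suppose that all degrees of freedom of `w`
vanish. Each stage divides out the bubble forced by the previous ones and tests with the cofactor,
so that the integrand has a sign (`Enumerates.eq_zero_of_orthogonal`). On an edge, the vertex data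
give double zeros of `w` at both ends, and the moments of degree `p - 4` annihilate the quotient;
the curl has degree `p - 1` and simple zeros at the ends, and the moments of degree `p - 3`
annihilate its components normal to the edge. On a face, `curl w · ν` is then the cubic bubble times
a polynomial of degree `p - 4`. Its mean is zero by Stokes, because `w` vanishes on the edges, so
moments against mean-zero functions suffice to annihilate it (`curl_normal_eq_zero_on_face`). Hence
the tangential trace is a closed one-form on the face. Its potential vanishes to second order on the
boundary after subtracting a constant, so it is the squared bubble times some `ψ` of degree `(p + 1)
- 6 = p - 5`; therefore `w × ν` is itself an admissible test field and vanishes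
(`trace_eq_zero_on_face`).

Inside the tetrahedron, the component of `curl w` along the gradient of a barycentric coordinate
`λ_i` vanishes where `λ_i` does, and so equals `λ_i q_i`. Testing with `z = ∑ q_i ∇λ_i` gives `∑ ∫
λ_i q_i² = ∫ w · curl z = 0`, whence `curl w = 0` (`curl_eq_zero_of_traceZero`). Then `w = ∇φ` with
`φ` the quartic bubble times some `Q` of degree `p - 3`. Writing `Q = div (x R)` gives `∫ φ Q = -∫ w
· x R = 0`, so `w = 0` (`eq_zero_of_traceZero`). The space of values of the degrees of freedom has
dimension at most `3 * (p + 3).choose 3`, which is the dimension of the polynomial space, so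
injectivity gives bijectivity. Only upper bounds for the test spaces are needed.

For a mesh, everything up to the faces applies to the difference of the pieces on two tetrahedra
sharing a face, so single-valued degrees of freedom give tangential continuity. A piecewise
polynomial field lies in `H(curl)` exactly when its tangential components are continuous: the
divergence theorem on each tetrahedron leaves face integrals whose area vectors, seen from the two
sides, are opposite (`memHCurl_of_tangentialC0Faces`, `MemHCurl.tangentialC0Faces`). Conversely, the
tangential trace determines the normal component of the curl on a face, so the continuity conditions
make all the degrees of freedom single-valued. Global existence and uniqueness are then the local
statements applied to each tetrahedron with common data. -/

/-- The reference simplex `{t ≥ 0, ∑ t ≤ 1}`. -/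
def refSimplex (d : ℕ) : Set (Fin d → ℝ) := {t | (∀ i, 0 ≤ t i) ∧ ∑ i, t i ≤ 1}

/-- The affine parametrisation of the simplex with vertices `a` over the reference simplex. -/
def param {d : ℕ} (a : Fin (d + 1) → E3) (t : Fin d → ℝ) : E3 :=
  a 0 + ∑ j, t j • (a j.succ - a 0)

/-- `a` lists the vertices of the nondegenerate simplex `s`. -/
structure Enumerates {d : ℕ} (a : Fin (d + 1) → E3) (s : Finset E3) : Prop where
  indep : AffineIndependent ℝ a
  range_eq : Set.range a = s

lemma isClosed_refSimplex (d : ℕ) : IsClosed (refSimplex d) := by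
  have : refSimplex d = (⋂ i, {t | 0 ≤ t i}) ∩ {t | ∑ i, t i ≤ 1} := by
    ext t; simp [refSimplex]
  rw [this]
  refine (isClosed_iInter fun i => isClosed_le continuous_const (continuous_apply i)).inter
    (isClosed_le (by fun_prop) continuous_const)

lemma le_one_of_mem_refSimplex {d : ℕ} {t : Fin d → ℝ} (ht : t ∈ refSimplex d) (i : Fin d) :
    t i ≤ 1 :=
  (Finset.single_le_sum (fun j _ => ht.1 j) (Finset.mem_univ i)).trans ht.2

lemma isCompact_refSimplex (d : ℕ) : IsCompact (refSimplex d) := by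
  refine (isCompact_univ_pi fun _ => isCompact_Icc (a := (0 : ℝ)) (b := 1)).of_isClosed_subset
    (isClosed_refSimplex d) fun t ht i _ => ⟨ht.1 i, le_one_of_mem_refSimplex ht i⟩

lemma convex_refSimplex (d : ℕ) : Convex ℝ (refSimplex d) := by
  intro x hx y hy α β hα hβ hαβ
  refine ⟨fun i => ?_, ?_⟩
  · have := hx.1 i; have := hy.1 i
    simp only [Pi.add_apply, Pi.smul_apply, smul_eq_mul]; positivity
  · simp only [Pi.add_apply, Pi.smul_apply, smul_eq_mul, Finset.sum_add_distrib, ← Finset.mul_sum]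
    nlinarith [hx.2, hy.2]

/-- A box with infinite sides inside the simplex is what turns vanishing of a polynomial on the
simplex into vanishing of the polynomial. -/
lemma pi_Ioo_subset_refSimplex (d : ℕ) :
    (Set.pi Set.univ fun _ : Fin d => Set.Ioo (0 : ℝ) (1 / (d + 1))) ⊆ refSimplex d := by
  intro t ht
  refine ⟨fun i => (ht i trivial).1.le, ?_⟩
  calc ∑ i, t i ≤ ∑ _i : Fin d, (1 / (d + 1) : ℝ) :=
        Finset.sum_le_sum fun i _ => (ht i trivial).2.le
    _ ≤ 1 := by
        simp only [Finset.sum_const, Finset.card_univ, Fintype.card_fin, nsmul_eq_mul]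
        rw [mul_one_div, div_le_one (by positivity)]; linarith

lemma interior_refSimplex_nonempty (d : ℕ) : (interior (refSimplex d)).Nonempty := by
  have ho : IsOpen (Set.pi Set.univ fun _ : Fin d => Set.Ioo (0 : ℝ) (1 / (d + 1))) :=
    isOpen_set_pi Set.finite_univ fun _ _ => isOpen_Ioo
  have : (Set.pi Set.univ fun _ : Fin d => Set.Ioo (0 : ℝ) (1 / (d + 1))).Nonempty := by
    rw [Set.univ_pi_nonempty_iff]
    intro _
    exact Set.nonempty_Ioo.2 (by positivity)
  exact this.mono (interior_maximal (pi_Ioo_subset_refSimplex d) ho)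

lemma refSimplex_subset_closure_interior (d : ℕ) :
    refSimplex d ⊆ closure (interior (refSimplex d)) := by
  rw [(convex_refSimplex d).closure_interior_eq_closure_of_nonempty_interior
    (interior_refSimplex_nonempty d)]
  exact subset_closure

lemma volume_refSimplex_ne_zero (d : ℕ) : volume (refSimplex d) ≠ 0 :=
  (Measure.measure_pos_of_nonempty_interior _ (interior_refSimplex_nonempty d)).ne'

lemma volume_refSimplex_ne_top (d : ℕ) : volume (refSimplex d) ≠ ⊤ :=
  (isCompact_refSimplex d).measure_lt_top.ne

section Param

variable {d : ℕ} {a : Fin (d + 1) → E3} {s : Finset E3}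

@[fun_prop]
lemma continuous_param (a : Fin (d + 1) → E3) : Continuous (param a) := by
  unfold param; fun_prop

lemma param_image_refSimplex (a : Fin (d + 1) → E3) :
    param a '' refSimplex d = convexHull ℝ (Set.range a) := by
  rw [convexHull_range_eq_exists_affineCombination]
  ext x
  constructor
  · rintro ⟨t, ht, rfl⟩
    refine ⟨Finset.univ, Fin.cons (1 - ∑ i, t i) t, ?_, ?_, ?_⟩
    · intro i _
      refine Fin.cases ?_ (fun j => ?_) i
      · simpa using ht.2
      · simpa using ht.1 j
    · simp [Fin.sum_univ_succ]
    · rw [Finset.affineCombination_eq_linear_combination _ _ _ (by simp [Fin.sum_univ_succ])]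
      simp only [Fin.sum_univ_succ, Fin.cons_zero, Fin.cons_succ, param, smul_sub,
        Finset.sum_sub_distrib, ← Finset.sum_smul, sub_smul, one_smul]
      abel
  · rintro ⟨S, w, hw, hS, rfl⟩
    rw [Finset.affineCombination_indicator_subset _ _ (Finset.subset_univ S)]
    set v := Set.indicator (↑S) w with hv
    have hv0 : ∀ i, 0 ≤ v i := fun i => Set.indicator_nonneg (fun i hi => hw i hi) i
    have hv1 : ∑ i, v i = 1 := by
      rw [← hS, hv, Finset.sum_indicator_subset _ (Finset.subset_univ S)]
    have hsum := hv1
    rw [Fin.sum_univ_succ] at hv1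
    refine ⟨fun j => v j.succ, ⟨fun j => hv0 _, by have := hv0 0; linarith⟩, ?_⟩
    rw [Finset.affineCombination_eq_linear_combination _ _ _ hsum]
    have h0 : v 0 = 1 - ∑ i : Fin d, v i.succ := by linarith
    simp only [param, Fin.sum_univ_succ, h0, smul_sub,
        Finset.sum_sub_distrib, ← Finset.sum_smul, sub_smul, one_smul]
    abel

lemma Enumerates.image_eq (h : Enumerates a s) : param a '' refSimplex d = hull s := by
  rw [param_image_refSimplex, hull, h.range_eq]

lemma Enumerates.param_mem (h : Enumerates a s) {t : Fin d → ℝ} (ht : t ∈ refSimplex d) :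
    param a t ∈ hull s := h.image_eq ▸ Set.mem_image_of_mem _ ht

lemma Enumerates.mem (h : Enumerates a s) (i : Fin (d + 1)) : a i ∈ s := by
  rw [← Finset.mem_coe, ← h.range_eq]; exact Set.mem_range_self i

lemma Enumerates.exists_eq (h : Enumerates a s) {x : E3} (hx : x ∈ s) : ∃ i, a i = x := by
  rw [← Finset.mem_coe, ← h.range_eq] at hx; exact hx

lemma Enumerates.linearIndependent (h : Enumerates a s) :
    LinearIndependent ℝ fun j : Fin d => a j.succ - a 0 := by
  have := (affineIndependent_iff_linearIndependent_vsub ℝ a 0).1 h.indep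
  have h2 := this.comp (fun j : Fin d => ⟨j.succ, Fin.succ_ne_zero j⟩)
    fun i j hij => by simpa using hij
  exact h2

/-- The linear part of the parametrisation. -/
def paramLinear (a : Fin (d + 1) → E3) : EuclideanSpace ℝ (Fin d) →ₗ[ℝ] E3 :=
  (Fintype.linearCombination ℝ fun j : Fin d => a j.succ - a 0) ∘ₗ
    (WithLp.linearEquiv 2 ℝ (Fin d → ℝ)).toLinearMap

lemma paramLinear_apply (a : Fin (d + 1) → E3) (t : EuclideanSpace ℝ (Fin d)) :
    paramLinear a t = ∑ j, t j • (a j.succ - a 0) := rfl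

lemma Enumerates.paramLinear_injective (h : Enumerates a s) :
    Function.Injective (paramLinear a) := by
  have h2 := Fintype.linearIndependent_iff.1 h.linearIndependent
  rw [injective_iff_map_eq_zero]
  intro t ht
  ext j
  exact h2 t.ofLp (by rwa [paramLinear_apply] at ht) j

lemma param_eq (a : Fin (d + 1) → E3) (t : Fin d → ℝ) :
    param a t = a 0 + paramLinear a (WithLp.toLp 2 t) := rfl

lemma Enumerates.param_injective (h : Enumerates a s) : Function.Injective (param a) := by
  intro t t' htt
  rw [param_eq, param_eq, add_right_inj] at htt
  simpa using h.paramLinear_injective htt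

lemma Enumerates.measurableEmbedding (h : Enumerates a s) : MeasurableEmbedding (param a) :=
  (continuous_param a).measurableEmbedding h.param_injective

/-- The Euclidean Hausdorff measure on a simplex is a multiple of the image of Lebesgue measure. -/
lemma Enumerates.measure_image (h : Enumerates a s) :
    ∃ c : ℝ, 0 < c ∧ ∀ S : Set (Fin d → ℝ),
      (μHE[d] : Measure E3) (param a '' S) = ENNReal.ofReal c * volume S := by
  refine ⟨(paramLinear a).normDet, ?_, fun S => ?_⟩
  · refine lt_of_le_of_ne (LinearMap.normDet_nonneg _) (Ne.symm ?_)
    intro h0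
    rw [LinearMap.normDet_eq_zero_iff_ker_ne_bot] at h0
    exact h0 (LinearMap.ker_eq_bot.2 h.paramLinear_injective)
  · have h1 := (paramLinear a).euclideanHausdorffMeasure_image_eq_normDet_mul_volume
      (WithLp.toLp 2 '' S)
    rw [finrank_euclideanSpace_fin] at h1
    have h2 : param a '' S = (fun x => a 0 + x) '' (paramLinear a '' (WithLp.toLp 2 '' S)) := by
      simp only [Set.image_image]; rfl
    have h3 : volume ((WithLp.toLp 2 : (Fin d → ℝ) → EuclideanSpace ℝ (Fin d)) '' S)
        = volume S := by
      have hmp := PiLp.volume_preserving_toLp (Fin d)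
      have := hmp.measure_preimage_emb
        (MeasurableEquiv.toLp 2 (Fin d → ℝ)).measurableEmbedding (WithLp.toLp 2 '' S)
      rw [← this, Set.preimage_image_eq _ (WithLp.toLp_injective 2)]
    rw [h2, Isometry.euclideanHausdorffMeasure_image (isometry_add_left (a 0)), h1, h3]

/-- Integrals over the simplex thereby become integrals over the reference simplex; the value of the
factor never matters, only that it is positive. -/
lemma Enumerates.restrict_hull (h : Enumerates a s) :
    ∃ c : ℝ, 0 < c ∧ (μHE[d] : Measure E3).restrict (hull s)
      = ENNReal.ofReal c • (volume.restrict (refSimplex d)).map (param a) := by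
  obtain ⟨c, hc, hS⟩ := h.measure_image
  refine ⟨c, hc, Measure.ext fun B hB => ?_⟩
  rw [Measure.restrict_apply hB, Measure.smul_apply, h.measurableEmbedding.map_apply,
    Measure.restrict_apply (h.measurableEmbedding.measurable hB), smul_eq_mul, ← hS,
    ← h.image_eq, Set.image_preimage_inter]


end Param

/-! ### Enumerations of the vertices of a simplex and of its facets -/

section Enumerations

variable {d : ℕ} {a : Fin (d + 1) → E3} {s : Finset E3}

lemma Enumerates.injective (h : Enumerates a s) : Function.Injective a := h.indep.injective

lemma Enumerates.indep_coe (h : Enumerates a s) : AffineIndependent ℝ ((↑) : s → E3) := by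
  have := h.indep.range
  rw [h.range_eq] at this
  exact this

lemma Enumerates.card_eq (h : Enumerates a s) : s.card = d + 1 := by
  have : s = Finset.univ.image a := by
    rw [← Finset.coe_inj, ← h.range_eq]; simp
  rw [this, Finset.card_image_of_injective _ h.injective]; simp

lemma enumerates_of_range_eq (hs : AffineIndependent ℝ ((↑) : s → E3))
    (hinj : Function.Injective a) (hr : Set.range a = s) : Enumerates a s := by
  refine ⟨?_, hr⟩
  have hmem : ∀ i, a i ∈ s := fun i => by
    rw [← Finset.mem_coe, ← hr]; exact Set.mem_range_self i
  exact hs.comp_embedding ⟨fun i => (⟨a i, hmem i⟩ : s), fun i j hij => hinj (by simpa using hij)⟩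

lemma exists_enumerates (hs : AffineIndependent ℝ ((↑) : s → E3)) (hc : s.card = d + 1) :
    ∃ a : Fin (d + 1) → E3, Enumerates a s := by
  let e := s.equivFinOfCardEq hc
  refine ⟨fun i => e.symm i, enumerates_of_range_eq hs
    (Subtype.val_injective.comp e.symm.injective) ?_⟩
  ext x
  constructor
  · rintro ⟨i, rfl⟩; exact (e.symm i).2
  · intro hx; exact ⟨e ⟨x, hx⟩, by simp⟩

lemma affineIndependent_subset {t : Finset E3} (hs : AffineIndependent ℝ ((↑) : s → E3))
    (hts : t ⊆ s) : AffineIndependent ℝ ((↑) : t → E3) :=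
  hs.comp_embedding ⟨fun x : t => (⟨x.1, hts x.2⟩ : s), fun _ _ hxy =>
    Subtype.ext (congrArg (fun z : s => z.1) hxy)⟩

/-- An enumeration that begins with two given vertices, together with the induced enumerations of
the two opposite facets. -/
lemma exists_enumerates_cons_cons [DecidableEq E3]
    (hs : AffineIndependent ℝ ((↑) : s → E3)) (hc : s.card = d + 2)
    {x y : E3} (hx : x ∈ s) (hy : y ∈ s) (hxy : x ≠ y) :
    ∃ b : Fin d → E3, Enumerates (Fin.cons x (Fin.cons y b : Fin (d + 1) → E3)) s ∧
      Enumerates (Fin.cons y b : Fin (d + 1) → E3) (s.erase x) ∧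
      Enumerates (Fin.cons x b : Fin (d + 1) → E3) (s.erase y) := by
  have hc' : ((s.erase x).erase y).card = d := by
    rw [Finset.card_erase_of_mem (by simp [hxy.symm, hy]), Finset.card_erase_of_mem hx, hc]; rfl
  let e := ((s.erase x).erase y).equivFinOfCardEq hc'
  let b : Fin d → E3 := fun i => (e.symm i).1
  have hb : Function.Injective b := Subtype.val_injective.comp e.symm.injective
  have hr : Set.range b = ((s.erase x).erase y : Finset E3) := by
    ext z
    constructor
    · rintro ⟨i, rfl⟩; exact (e.symm i).2
    · intro hz; exact ⟨e ⟨z, hz⟩, by simp [b]⟩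
  have hxb : x ∉ Set.range b := by rw [hr]; simp
  have hyb : y ∉ Set.range b := by rw [hr]; simp
  have hyi : Function.Injective (Fin.cons y b : Fin (d + 1) → E3) :=
    Fin.cons_injective_iff.2 ⟨hyb, hb⟩
  have hxi : Function.Injective (Fin.cons x b : Fin (d + 1) → E3) :=
    Fin.cons_injective_iff.2 ⟨hxb, hb⟩
  refine ⟨b, enumerates_of_range_eq hs (Fin.cons_injective_iff.2 ⟨?_, hyi⟩) ?_,
    enumerates_of_range_eq (affineIndependent_subset hs (Finset.erase_subset _ _)) hyi ?_,
    enumerates_of_range_eq (affineIndependent_subset hs (Finset.erase_subset _ _)) hxi ?_⟩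
  · rw [Fin.range_cons, hr]; simp [hxy]
  · rw [Fin.range_cons, Fin.range_cons, hr, ← Finset.coe_insert, ← Finset.coe_insert,
      Finset.insert_erase (by simp [hxy.symm, hy]), Finset.insert_erase hx]
  · rw [Fin.range_cons, hr, ← Finset.coe_insert, Finset.insert_erase (by simp [hxy.symm, hy])]
  · rw [Fin.range_cons, hr, ← Finset.coe_insert, Finset.erase_right_comm,
      Finset.insert_erase (by simp [hxy, hx])]

end Enumerations

/-! ### Integration over simplices and Stokes' formula along an edge -/

section Integrals

variable {d : ℕ} {a : Fin (d + 1) → E3} {s : Finset E3}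

lemma isCompact_hull (s : Finset E3) : IsCompact (hull s) :=
  s.finite_toSet.isCompact_convexHull (𝕜 := ℝ)

lemma measurableSet_hull (s : Finset E3) : MeasurableSet (hull s) :=
  (isCompact_hull s).measurableSet

lemma Enumerates.integral_hull {F : Type*} [NormedAddCommGroup F] [NormedSpace ℝ F]
    (h : Enumerates a s) : ∃ c : ℝ, 0 < c ∧ ∀ g : E3 → F,
      ∫ x in hull s, g x ∂μHE[d] = c • ∫ t in refSimplex d, g (param a t) := by
  obtain ⟨c, hc, hm⟩ := h.restrict_hull
  refine ⟨c, hc, fun g => ?_⟩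
  rw [hm, integral_smul_measure, h.measurableEmbedding.integral_map, ENNReal.toReal_ofReal hc.le]

lemma Enumerates.measure_hull_ne_top (h : Enumerates a s) :
    (μHE[d] : Measure E3) (hull s) ≠ ⊤ := by
  obtain ⟨c, hc, hm⟩ := h.measure_image
  rw [← h.image_eq, hm]
  exact ENNReal.mul_ne_top ENNReal.ofReal_ne_top (volume_refSimplex_ne_top d)

lemma Enumerates.measure_hull_ne_zero (h : Enumerates a s) :
    (μHE[d] : Measure E3) (hull s) ≠ 0 := by
  obtain ⟨c, hc, hm⟩ := h.measure_image
  rw [← h.image_eq, hm]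
  exact mul_ne_zero (by simpa using hc) (volume_refSimplex_ne_zero d)

lemma integrableOn_hull_of_measure_ne_top {F : Type*} [NormedAddCommGroup F] {μ : Measure E3}
    (hμ : μ (hull s) ≠ ⊤) {g : E3 → F} (hg : Continuous g) : IntegrableOn g (hull s) μ := by
  obtain ⟨C, hC⟩ := (isCompact_hull s).exists_bound_of_continuousOn hg.continuousOn
  refine IntegrableOn.of_bound (lt_top_iff_ne_top.2 hμ)
    (hg.continuousOn.aestronglyMeasurable_of_isCompact (isCompact_hull s) (measurableSet_hull s)) C
    ((ae_restrict_iff' (measurableSet_hull s)).2 (Filter.Eventually.of_forall hC))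

lemma Enumerates.integrableOn {F : Type*} [NormedAddCommGroup F]
    (h : Enumerates a s) {g : E3 → F} (hg : Continuous g) :
    IntegrableOn g (hull s) (μHE[d] : Measure E3) :=
  integrableOn_hull_of_measure_ne_top h.measure_hull_ne_top hg

/-- A nonnegative continuous function with vanishing integral over a simplex vanishes there. -/
lemma Enumerates.eq_zero_of_integral_eq_zero (h : Enumerates a s) {g : E3 → ℝ}
    (hg : Continuous g) (h0 : ∀ x ∈ hull s, 0 ≤ g x)
    (hi : ∫ x in hull s, g x ∂μHE[d] = 0) : ∀ x ∈ hull s, g x = 0 := by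
  obtain ⟨c, hc, hI⟩ := h.integral_hull (F := ℝ)
  have hi' : ∫ t in refSimplex d, g (param a t) = 0 := by
    have := hI g; rw [hi, smul_eq_mul] at this
    exact (mul_eq_zero.1 this.symm).resolve_left hc.ne'
  have hcont : Continuous fun t => g (param a t) := by fun_prop
  have hInt : IntegrableOn (fun t => g (param a t)) (refSimplex d) :=
    hcont.continuousOn.integrableOn_compact (isCompact_refSimplex d)
  have hae := (setIntegral_eq_zero_iff_of_nonneg_ae
    ((ae_restrict_iff' (isClosed_refSimplex d).measurableSet).2
      (Filter.Eventually.of_forall fun t ht => h0 _ (h.param_mem ht))) hInt).1 hi'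
  have := Measure.eqOn_of_ae_eq hae hcont.continuousOn continuousOn_const
    (refSimplex_subset_closure_interior d)
  intro x hx
  rw [← h.image_eq] at hx
  obtain ⟨t, ht, rfl⟩ := hx
  exact this ht

/-- The integral over a simplex, normalised so that it only depends on its vertices. -/
def simplexInt (d : ℕ) (s : Finset E3) (g : E3 → ℝ) : ℝ :=
  volume.real (refSimplex d) * ⨍ x in hull s, g x ∂μHE[d]

/-- The unknown scaling factor cancels between the integral and the measure in the average. Hence
the right side is the same for all enumerations, and Stokes' formula can use whichever enumeration
suits each facet. -/
lemma Enumerates.simplexInt_eq (h : Enumerates a s) (g : E3 → ℝ) :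
    simplexInt d s g = ∫ t in refSimplex d, g (param a t) := by
  obtain ⟨c, hc, hI⟩ := h.integral_hull (F := ℝ)
  have h1 := hI fun _ => 1
  simp only [integral_const, smul_eq_mul, mul_one, MeasurableSet.univ, measureReal_restrict_apply,
    Set.univ_inter] at h1
  have h2 : volume.real (refSimplex d) ≠ 0 :=
    (ENNReal.toReal_pos (volume_refSimplex_ne_zero d) (volume_refSimplex_ne_top d)).ne'
  rw [simplexInt, setAverage_eq, hI, h1, smul_eq_mul, smul_eq_mul]
  field_simp

lemma integral_hull_eq_simplexInt (hs : AffineIndependent ℝ ((↑) : s → E3))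
    (hc : s.card = d + 1) : ∃ c : ℝ, 0 < c ∧ ∀ g : E3 → ℝ,
      ∫ x in hull s, g x ∂μHE[d] = c * simplexInt d s g := by
  obtain ⟨a, ha⟩ := exists_enumerates hs hc
  obtain ⟨c, hc, hI⟩ := ha.integral_hull (F := ℝ)
  exact ⟨c, hc, fun g => by rw [ha.simplexInt_eq, hI, smul_eq_mul]⟩

lemma mem_refSimplex_cons {r : ℝ} {y : Fin d → ℝ} :
    (Fin.cons r y : Fin (d + 1) → ℝ) ∈ refSimplex (d + 1) ↔
      y ∈ refSimplex d ∧ r ∈ Set.Icc 0 (1 - ∑ i, y i) := by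
  simp only [refSimplex, Set.mem_ofPred_eq, Fin.forall_fin_succ, Fin.cons_zero, Fin.cons_succ,
    Fin.sum_univ_succ, Set.mem_Icc]
  constructor
  · rintro ⟨⟨h1, h2⟩, h3⟩; exact ⟨⟨h2, by linarith⟩, h1, by linarith⟩
  · rintro ⟨⟨h1, h2⟩, h3, h4⟩; exact ⟨⟨h3, h1⟩, by linarith⟩

/-- Fubini: the slice over `y` is the interval from `0` to `1 - ∑ y`. -/
lemma setIntegral_refSimplex_succ {g : (Fin (d + 1) → ℝ) → ℝ} (hg : Continuous g) :
    ∫ t in refSimplex (d + 1), g t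
      = ∫ y in refSimplex d, ∫ r in (0 : ℝ)..(1 - ∑ i, y i), g (Fin.cons r y) := by
  have hms := (isClosed_refSimplex (d + 1)).measurableSet
  have hms' := (isClosed_refSimplex d).measurableSet
  have hmp := (volume_preserving_piFinSuccAbove (fun _ : Fin (d + 1) => ℝ) 0).symm
  have hInt : Integrable ((refSimplex (d + 1)).indicator g) :=
    (integrable_indicator_iff hms).2
      (hg.continuousOn.integrableOn_compact (isCompact_refSimplex _))
  rw [← integral_indicator hms, ← integral_indicator hms',
    ← hmp.integral_comp (MeasurableEquiv.measurableEmbedding _)]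
  have hInt' := (hmp.integrable_comp_emb (MeasurableEquiv.measurableEmbedding _)).2 hInt
  rw [Measure.volume_eq_prod, integral_prod_symm (fun z : ℝ × (Fin d → ℝ) => (refSimplex (d + 1)).indicator g
    ((MeasurableEquiv.piFinSuccAbove (fun _ : Fin (d + 1) => ℝ) 0).symm z)) hInt']
  congr 1
  ext y
  have hcons : ∀ r : ℝ, (MeasurableEquiv.piFinSuccAbove (fun _ : Fin (d + 1) => ℝ) 0).symm (r, y)
      = Fin.cons r y := fun r => by
    ext i; simp [MeasurableEquiv.piFinSuccAbove, Fin.insertNthEquiv]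
  by_cases hy : y ∈ refSimplex d
  · have h1 : (fun r : ℝ => (refSimplex (d + 1)).indicator g
        ((MeasurableEquiv.piFinSuccAbove (fun _ : Fin (d + 1) => ℝ) 0).symm (r, y)))
        = (Set.Icc 0 (1 - ∑ i, y i)).indicator fun r => g (Fin.cons r y) := by
      ext r
      rw [hcons]
      by_cases hr : r ∈ Set.Icc 0 (1 - ∑ i, y i)
      · rw [Set.indicator_of_mem hr, Set.indicator_of_mem (mem_refSimplex_cons.2 ⟨hy, hr⟩)]
      · rw [Set.indicator_of_notMem hr,
          Set.indicator_of_notMem fun h => hr (mem_refSimplex_cons.1 h).2]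
    rw [Set.indicator_of_mem hy, h1, integral_indicator measurableSet_Icc,
      integral_Icc_eq_integral_Ioc, intervalIntegral.integral_of_le (by linarith [hy.2])]
  · rw [Set.indicator_of_notMem hy]
    convert integral_zero ℝ ℝ with r
    rw [hcons, Set.indicator_of_notMem fun h => hy (mem_refSimplex_cons.1 h).1]

/-- With `x` and `y` listed first, the first coordinate translates along the edge from `x` to `y`,
starting on the facet opposite to `y`. -/
lemma param_cons_cons (x y : E3) (b : Fin d → E3) (r : ℝ) (t : Fin d → ℝ) :
    param (Fin.cons x (Fin.cons y b : Fin (d + 1) → E3)) (Fin.cons r t)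
      = param (Fin.cons x b) t + r • (y - x) := by
  simp [param, Fin.sum_univ_succ]
  abel

/-- The Stokes formula on a simplex for the derivative in the direction of an edge. -/
lemma simplexInt_fderiv [DecidableEq E3] (hs : AffineIndependent ℝ ((↑) : s → E3))
    (hc : s.card = d + 2) {x y : E3} (hx : x ∈ s) (hy : y ∈ s) {g : E3 → ℝ}
    (hg : ContDiff ℝ 1 g) :
    simplexInt (d + 1) s (fun z => fderiv ℝ g z (y - x))
      = simplexInt d (s.erase x) g - simplexInt d (s.erase y) g := by
  by_cases hxy : x = y
  · subst hxy; simp [simplexInt]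
  obtain ⟨b, h1, h2, h3⟩ := exists_enumerates_cons_cons hs hc hx hy hxy
  have hfd : Continuous fun z => fderiv ℝ g z (y - x) :=
    (hg.continuous_fderiv one_ne_zero).clm_apply continuous_const
  have hgc := hg.continuous
  rw [h1.simplexInt_eq, h2.simplexInt_eq, h3.simplexInt_eq,
    setIntegral_refSimplex_succ (by fun_prop), ← integral_sub]
  rotate_left
  · exact (by fun_prop : Continuous _).continuousOn.integrableOn_compact (isCompact_refSimplex d)
  · exact (by fun_prop : Continuous _).continuousOn.integrableOn_compact (isCompact_refSimplex d)
  congr 1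
  ext t
  have hder : ∀ r : ℝ, HasDerivAt
      (fun r : ℝ => g (param (Fin.cons x b : Fin (d + 1) → E3) t + r • (y - x)))
      (fderiv ℝ g (param (Fin.cons x b : Fin (d + 1) → E3) t + r • (y - x)) (y - x)) r := by
    intro r
    refine ((hg.differentiable one_ne_zero _).hasFDerivAt).comp_hasDerivAt r ?_
    simpa using ((hasDerivAt_id r).smul_const (y - x)).const_add (param (Fin.cons x b) t)
  simp only [param_cons_cons]
  -- The inner integral runs along the edge direction. Its upper end point `r = 1 - ∑ t` lies on the
  -- facet opposite to `x`, its lower one on the facet opposite to `y`.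
  rw [intervalIntegral.integral_eq_sub_of_hasDerivAt (fun r _ => hder r)]
  · congr 2
    · simp only [param, Fin.cons_zero, Fin.cons_succ, smul_sub, Finset.sum_sub_distrib,
        ← Finset.sum_smul, sub_smul, one_smul]
      abel_nf
    · simp
  · exact (by fun_prop : Continuous _).intervalIntegrable _ _

end Integrals

/-! ### Degree bounds -/

section Degree

variable {σ τ : Type*}

/-- The polynomials of degree at most `k` in any set of variables. -/
def degLE (σ : Type*) (k : ℤ) : Submodule ℝ (MvPolynomial σ ℝ) :=
  restrictSupport ℝ {m | (m.degree : ℤ) ≤ k}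

lemma polyDeg_eq (k : ℤ) : polyDeg k = degLE (Fin 3) k := rfl

lemma mem_degLE {k : ℤ} {P : MvPolynomial σ ℝ} :
    P ∈ degLE σ k ↔ ∀ m ∈ P.support, (m.degree : ℤ) ≤ k := by
  rw [degLE, mem_restrictSupport_iff]; rfl

/-- The case `P = 0` is separate because `k` may be negative, while the zero polynomial has total
degree `0`. -/
lemma mem_degLE_iff_totalDegree {k : ℤ} {P : MvPolynomial σ ℝ} :
    P ∈ degLE σ k ↔ P = 0 ∨ (P.totalDegree : ℤ) ≤ k := by
  rw [mem_degLE]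
  constructor
  · intro h
    by_cases hP : P = 0
    · exact Or.inl hP
    · right
      obtain ⟨m, hm, hd⟩ := Finset.exists_mem_eq_sup P.support
        (by simpa [Finset.nonempty_iff_ne_empty] using hP) fun m => m.degree
      have : P.totalDegree = m.degree := by
        rw [← hd]; rfl
      rw [this]; exact h m hm
  · rintro (rfl | h) m hm
    · simp at hm
    · have : m.degree ≤ P.totalDegree := le_totalDegree hm
      omega

lemma degLE_mono {k l : ℤ} (h : k ≤ l) : degLE σ k ≤ degLE σ l :=
  restrictSupport_mono ℝ fun _ hm => le_trans hm h

lemma mul_mem_degLE {k l : ℤ} {P Q : MvPolynomial σ ℝ} (hP : P ∈ degLE σ k)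
    (hQ : Q ∈ degLE σ l) : P * Q ∈ degLE σ (k + l) := by
  rw [mem_degLE_iff_totalDegree] at *
  rcases hP with rfl | hP
  · simp
  rcases hQ with rfl | hQ
  · simp
  right
  have := totalDegree_mul P Q
  omega

lemma C_mem_degLE (c : ℝ) {k : ℤ} (hk : 0 ≤ k) : (C c : MvPolynomial σ ℝ) ∈ degLE σ k := by
  rw [mem_degLE_iff_totalDegree]; right; simpa

lemma one_mem_degLE {k : ℤ} (hk : 0 ≤ k) : (1 : MvPolynomial σ ℝ) ∈ degLE σ k := by
  simpa using C_mem_degLE 1 hk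

lemma X_mem_degLE (i : σ) : (X i : MvPolynomial σ ℝ) ∈ degLE σ 1 := by
  rw [mem_degLE_iff_totalDegree]; right; simp

lemma C_mul_mem_degLE (c : ℝ) {k : ℤ} {P : MvPolynomial σ ℝ} (hP : P ∈ degLE σ k) :
    C c * P ∈ degLE σ k := by
  rw [C_mul']; exact Submodule.smul_mem _ _ hP

lemma pderiv_mem_degLE {k : ℤ} {P : MvPolynomial σ ℝ} (hP : P ∈ degLE σ k) (i : σ) :
    pderiv i P ∈ degLE σ (k - 1) := by
  classical
  rw [P.as_sum, map_sum]
  refine Submodule.sum_mem _ fun m hm => ?_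
  rw [pderiv_monomial]
  by_cases h0 : m i = 0
  · simp [h0]
  rw [degLE, monomial_mem_restrictSupport]
  left
  have h1 := mem_degLE.1 hP m hm
  have h2 : (m - Finsupp.single i 1).degree + 1 = m.degree := by
    have : m = (m - Finsupp.single i 1) + Finsupp.single i 1 := by
      rw [tsub_add_cancel_of_le]
      rw [Finsupp.single_le_iff]; omega
    conv_rhs => rw [this]
    rw [map_add]; simp
  show (((m - Finsupp.single i 1).degree : ℕ) : ℤ) ≤ k - 1
  omega

lemma aeval_mem_degLE {f : σ → MvPolynomial τ ℝ} (hf : ∀ i, f i ∈ degLE τ 1) {k : ℤ}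
    {P : MvPolynomial σ ℝ} (hP : P ∈ degLE σ k) : aeval f P ∈ degLE τ k := by
  rw [P.as_sum, map_sum]
  refine Submodule.sum_mem _ fun m hm => degLE_mono (mem_degLE.1 hP m hm) ?_
  rw [aeval_monomial]
  refine C_mul_mem_degLE (P.coeff m) ?_
  have hpow : ∀ (i : σ) (n : ℕ), f i ^ n ∈ degLE τ n := by
    intro i n
    induction n with
    | zero => simpa using one_mem_degLE le_rfl
    | succ n ih => rw [pow_succ]; push_cast; exact mul_mem_degLE ih (hf i)
  rw [Finsupp.prod, Finsupp.degree_apply]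
  induction m.support using Finset.cons_induction with
  | empty => simpa using one_mem_degLE le_rfl
  | cons i S hi ih =>
    rw [Finset.prod_cons, Finset.sum_cons, Nat.cast_add]
    exact mul_mem_degLE (hpow i _) ih

/-- Total degree is additive over a domain, so removing a nonconstant factor lowers it by at least
one. This supplies the degrees of all cofactors of bubbles. -/
lemma mem_degLE_of_mul_mem {k : ℤ} {L Q : MvPolynomial σ ℝ} (hL : 1 ≤ L.totalDegree)
    (h : L * Q ∈ degLE σ k) : Q ∈ degLE σ (k - 1) := by
  by_cases hQ : Q = 0
  · simp [hQ]
  have hL0 : L ≠ 0 := by rintro rfl; simp at hL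
  rw [mem_degLE_iff_totalDegree] at *
  right
  have := h.resolve_left (mul_ne_zero hL0 hQ)
  rw [totalDegree_mul_of_isDomain hL0 hQ] at this
  push_cast at this
  omega

lemma mem_degLE_of_pow_mul_mem {k : ℤ} {L Q : MvPolynomial σ ℝ} (hL : 1 ≤ L.totalDegree) (m : ℕ)
    (h : L ^ m * Q ∈ degLE σ k) : Q ∈ degLE σ (k - m) := by
  induction m generalizing k with
  | zero => simpa using h
  | succ m ih =>
    rw [pow_succ', mul_assoc] at h
    have := ih (mem_degLE_of_mul_mem hL h)
    push_cast; rwa [sub_sub, add_comm] at this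

lemma mem_degLE_of_prod_mul_mem {ι : Type*} (S : Finset ι) {k : ℤ} {L : ι → MvPolynomial σ ℝ}
    {Q : MvPolynomial σ ℝ} (hL : ∀ i, 1 ≤ (L i).totalDegree) (m : ℕ)
    (h : (∏ i ∈ S, L i ^ m) * Q ∈ degLE σ k) : Q ∈ degLE σ (k - S.card * m) := by
  induction S using Finset.cons_induction generalizing k with
  | empty => simpa using h
  | cons i S hi ih =>
    rw [Finset.prod_cons, mul_assoc] at h
    have := ih (mem_degLE_of_pow_mul_mem (hL i) m h)
    rw [Finset.card_cons]; push_cast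
    convert this using 2; ring

lemma pderiv_aeval [Fintype σ] (f : σ → MvPolynomial τ ℝ) (j : τ) (P : MvPolynomial σ ℝ) :
    pderiv j (aeval f P) = ∑ k, aeval f (pderiv k P) * pderiv j (f k) := by
  classical
  induction P using MvPolynomial.induction_on with
  | C c => simp
  | add P Q hP hQ => simp only [map_add, hP, hQ, add_mul, Finset.sum_add_distrib]
  | mul_X P i hP =>
    simp only [map_mul, aeval_X, pderiv_mul, hP, map_add, add_mul, Finset.sum_add_distrib,
      Finset.sum_mul, pderiv_X]
    congr 1
    · exact Finset.sum_congr rfl fun k _ => by ring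
    · rw [Finset.sum_eq_single i]
      · simp
      · intro b _ hb; simp [hb.symm]
      · simp

end Degree

/-! ### Divisibility by affine forms -/

section Division

variable {σ : Type*}

/-- The substitution agrees with the identity on the variables modulo `L`, hence on all polynomials.
Geometrically it moves a point along `v` by the value of `L` there. -/
lemma sub_aeval_sub_mem_span (L : MvPolynomial σ ℝ) (v : σ → ℝ) (P : MvPolynomial σ ℝ) :
    L ∣ P - aeval (fun j => X j - C (v j) * L) P := by
  rw [← Ideal.mem_span_singleton, ← Ideal.Quotient.eq]
  have : (Ideal.Quotient.mkₐ ℝ (Ideal.span {L})) =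
      (Ideal.Quotient.mkₐ ℝ (Ideal.span {L})).comp (aeval fun j => X j - C (v j) * L) := by
    ext j
    simp only [AlgHom.coe_comp, Function.comp_apply, aeval_X, Ideal.Quotient.mkₐ_eq_mk]
    rw [Ideal.Quotient.eq, Ideal.mem_span_singleton]
    exact ⟨C (v j), by ring⟩
  exact DFunLike.congr_fun this P

lemma dvd_of_aeval_eq_zero {L : MvPolynomial σ ℝ} {v : σ → ℝ} {P : MvPolynomial σ ℝ}
    (h : aeval (fun j => X j - C (v j) * L) P = 0) : L ∣ P := by
  have := sub_aeval_sub_mem_span L v P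
  rwa [h, sub_zero] at this

/-- The polynomials killed by the substitution are precisely the multiples of `L`, and its target is
a domain. -/
lemma prime_of_aeval_eq_zero {L : MvPolynomial σ ℝ} {v : σ → ℝ} (hL : L ≠ 0)
    (h : aeval (fun j => X j - C (v j) * L) L = 0) : Prime L := by
  refine ⟨hL, fun hu => ?_, fun P Q hPQ => ?_⟩
  · have := hu.map (aeval fun j => X j - C (v j) * L)
    rw [h] at this
    exact not_isUnit_zero this
  · obtain ⟨R, hR⟩ := hPQ
    have h2 := congrArg (aeval fun j => X j - C (v j) * L) hR
    rw [map_mul, map_mul, h, zero_mul, mul_eq_zero] at h2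
    exact h2.imp dvd_of_aeval_eq_zero dvd_of_aeval_eq_zero

end Division

/-! ### Barycentric coordinates on the reference simplex -/

section Bary

variable {n : ℕ}

/-- The barycentric coordinates of the reference simplex. -/
def bary (d : ℕ) : Fin (d + 1) → MvPolynomial (Fin d) ℝ := Fin.cons (1 - ∑ j, X j) X

@[simp] lemma bary_succ (d : ℕ) (j : Fin d) : bary d j.succ = X j := rfl

@[simp] lemma bary_zero (d : ℕ) : bary d 0 = 1 - ∑ j, X j := rfl

/-- The vertices of the reference simplex. -/
def refVertex (d : ℕ) : Fin (d + 1) → (Fin d → ℝ) := Fin.cons 0 fun j => Pi.single j 1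

lemma eval_bary_refVertex (d : ℕ) (i j : Fin (d + 1)) :
    eval (refVertex d j) (bary d i) = if i = j then 1 else 0 := by
  refine Fin.cases ?_ (fun i => ?_) i <;> refine Fin.cases ?_ (fun j => ?_) j
  · simp [refVertex]
  · simp [refVertex, (Fin.succ_ne_zero j).symm]
  · simp [refVertex]
  · simp [refVertex, Pi.single_apply]

lemma eval_bary_nonneg {d : ℕ} {t : Fin d → ℝ} (ht : t ∈ refSimplex d) (i : Fin (d + 1)) :
    0 ≤ eval t (bary d i) := by
  refine Fin.cases ?_ (fun i => ?_) i
  · simpa using ht.2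
  · simpa using ht.1 i

lemma bary_ne_zero (d : ℕ) (i : Fin (d + 1)) : bary d i ≠ 0 := by
  intro h
  have := eval_bary_refVertex d i i
  simp [h] at this

lemma bary_mem_degLE (d : ℕ) (i : Fin (d + 1)) : bary d i ∈ degLE (Fin d) 1 := by
  refine Fin.cases ?_ (fun i => ?_) i
  · exact Submodule.sub_mem _ (one_mem_degLE zero_le_one)
      (Submodule.sum_mem _ fun j _ => X_mem_degLE j)
  · exact X_mem_degLE i

/-- The coordinate direction along which `bary i` is eliminated. -/
def baryDir (n : ℕ) : Fin (n + 2) → (Fin (n + 1) → ℝ) :=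
  Fin.cons (-Pi.single 0 1) fun j => Pi.single j 1

/-- `bary i` grows with slope one along `baryDir i`, so the substitution subtracts it from itself.
-/
lemma aeval_bary (i : Fin (n + 2)) :
    aeval (fun j => X j - C (baryDir n i j) * bary (n + 1) i) (bary (n + 1) i) = 0 := by
  refine Fin.cases ?_ (fun i => ?_) i
  · simp [baryDir, Pi.single_apply, Finset.sum_add_distrib]
  · simp [baryDir]

lemma prime_bary (i : Fin (n + 2)) : Prime (bary (n + 1) i) :=
  prime_of_aeval_eq_zero (bary_ne_zero _ i) (aeval_bary i)

lemma one_le_totalDegree_bary (i : Fin (n + 2)) : 1 ≤ (bary (n + 1) i).totalDegree := by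
  by_contra! h
  have h0 : (bary (n + 1) i).totalDegree = 0 := by omega
  rw [totalDegree_eq_zero_iff_eq_C] at h0
  have h1 := eval_bary_refVertex (n + 1) i i
  obtain ⟨j, hj⟩ := exists_ne i
  have h2 := eval_bary_refVertex (n + 1) i j
  rw [h0, eval_C] at h1 h2
  rw [if_pos rfl] at h1
  rw [if_neg hj.symm] at h2
  linarith

/-- A polynomial that vanishes on a facet of the reference simplex is divisible by the
corresponding barycentric coordinate. -/
lemma bary_dvd {i : Fin (n + 2)} {P : MvPolynomial (Fin (n + 1)) ℝ}
    (h : ∀ t ∈ refSimplex (n + 1), eval t (bary (n + 1) i) = 0 → eval t P = 0) :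
    bary (n + 1) i ∣ P := by
  refine dvd_of_aeval_eq_zero (v := baryDir n i)
    (funext_set (fun _ => Set.Ioo (0 : ℝ) (1 / ((n + 1 : ℕ) + 1)))
      (fun _ => Set.Ioo_infinite (by positivity)) fun t ht => ?_)
  have hT := pi_Ioo_subset_refSimplex (n + 1) ht
  rw [map_zero]
  have he : ∀ Q : MvPolynomial (Fin (n + 1)) ℝ,
      eval t (aeval (fun j => X j - C (baryDir n i j) * bary (n + 1) i) Q)
      = eval (fun j => t j - baryDir n i j * eval t (bary (n + 1) i)) Q := by
    intro Q
    induction Q using MvPolynomial.induction_on with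
    | C c => simp
    | add P Q hP hQ => simp only [map_add, hP, hQ]
    | mul_X P i hP => simp only [map_mul, hP, aeval_X, map_sub, eval_X, eval_C]
  rw [he]
  -- The shifted point stays in the simplex: the weight of vertex `i` is handed over to vertex `0`,
  -- or to vertex `1` when `i = 0`.
  refine h _ ⟨fun j => ?_, ?_⟩ ?_
  · revert j
    refine Fin.cases ?_ (fun i => ?_) i
    · intro j
      have h1 := hT.1 j
      have h2 : 0 ≤ eval t (bary (n + 1) 0) := eval_bary_nonneg hT 0
      simp only [baryDir, Fin.cons_zero, Pi.neg_apply, Pi.single_apply]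
      split_ifs <;> nlinarith
    · intro j
      have h1 := hT.1 j
      simp only [baryDir, Fin.cons_succ, Pi.single_apply, bary_succ, eval_X]
      split_ifs with hj
      · subst hj; simp
      · simpa using h1
  · refine Fin.cases ?_ (fun i => ?_) i
    · simp [baryDir, Pi.single_apply, Finset.sum_add_distrib]
    · have h1 := hT.1 i
      have h2 := hT.2
      simp [baryDir, Pi.single_apply]
      linarith
  · rw [← he, aeval_bary, map_zero]

lemma isRelPrime_bary {i j : Fin (n + 2)} (hij : i ≠ j) :
    IsRelPrime (bary (n + 1) i) (bary (n + 1) j) := by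
  rw [(prime_bary i).irreducible.isRelPrime_iff_not_dvd]
  rintro ⟨Q, hQ⟩
  have h1 := eval_bary_refVertex (n + 1) j j
  rw [hQ, map_mul, eval_bary_refVertex, if_neg hij] at h1
  simp at h1

lemma prod_bary_pow_dvd {P : MvPolynomial (Fin (n + 1)) ℝ} (m : ℕ)
    (h : ∀ i, bary (n + 1) i ^ m ∣ P) : ∏ i, bary (n + 1) i ^ m ∣ P := by
  refine Finset.prod_dvd_of_isRelPrime ?_ fun i _ => h i
  intro i _ j _ hij
  exact (isRelPrime_bary hij).pow

/-- A polynomial whose derivatives and which itself are divisible by a barycentric coordinate is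
divisible by its square. -/
lemma bary_sq_dvd {i : Fin (n + 2)} {P : MvPolynomial (Fin (n + 1)) ℝ}
    (h : bary (n + 1) i ∣ P) (hd : ∀ j, bary (n + 1) i ∣ pderiv j P) :
    bary (n + 1) i ^ 2 ∣ P := by
  obtain ⟨Q, rfl⟩ := h
  rw [pow_two]
  refine mul_dvd_mul_left _ ?_
  -- Some derivative of the barycentric coordinate is a nonzero constant `c`. In `∂ⱼ(λ Q) = c Q + λ
  -- ∂ⱼ Q` the left side is divisible by `λ`, hence so is `Q`.
  obtain ⟨j, c, hc, hj⟩ : ∃ j, ∃ c : ℝ, c ≠ 0 ∧ pderiv j (bary (n + 1) i) = C c := by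
    refine Fin.cases ⟨0, -1, by norm_num, ?_⟩ (fun i => ⟨i, 1, one_ne_zero, ?_⟩) i
    · simp [pderiv_X, Pi.single_apply]
    · simp
  have h1 := hd j
  rw [pderiv_mul, hj, add_comm (C c * Q)] at h1
  have h2 := (dvd_add_right (Dvd.intro _ rfl)).1 h1
  have : Q = C c⁻¹ * (C c * Q) := by rw [← mul_assoc, ← C_mul, inv_mul_cancel₀ hc]; simp
  rw [this]
  exact h2.mul_left _

end Bary

/-! ### Euler scaling and potentials -/

section Euler

variable {σ : Type*}

/-- Division of each monomial `m` by `|m| + c`; this inverts `c + ∑ Xᵢ ∂ᵢ`. -/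
def eulerInv (σ : Type*) (c : ℕ) : MvPolynomial σ ℝ →ₗ[ℝ] MvPolynomial σ ℝ :=
  (basisMonomials σ ℝ).constr ℝ fun m => monomial m ((m.degree + c : ℝ)⁻¹)

lemma eulerInv_monomial (c : ℕ) (m : σ →₀ ℕ) (r : ℝ) :
    eulerInv σ c (monomial m r) = monomial m (r * (m.degree + c : ℝ)⁻¹) := by
  have : (monomial m r : MvPolynomial σ ℝ) = r • basisMonomials σ ℝ m := by
    rw [coe_basisMonomials, smul_monomial, smul_eq_mul, mul_one]
  rw [this, map_smul, eulerInv, Module.Basis.constr_basis, smul_monomial, smul_eq_mul]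

/-- Differentiation lowers the degree by one, so the shift has to rise by one to keep the same
denominator. -/
lemma pderiv_eulerInv (c : ℕ) (j : σ) (P : MvPolynomial σ ℝ) :
    pderiv j (eulerInv σ c P) = eulerInv σ (c + 1) (pderiv j P) := by
  induction P using MvPolynomial.induction_on' with
  | add P Q hP hQ => simp only [map_add, hP, hQ]
  | monomial m r =>
    rw [eulerInv_monomial, pderiv_monomial, pderiv_monomial, eulerInv_monomial]
    by_cases h0 : m j = 0
    · simp [h0]
    have h2 : (m - Finsupp.single j 1).degree + 1 = m.degree := by
      have : m = (m - Finsupp.single j 1) + Finsupp.single j 1 := by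
        rw [tsub_add_cancel_of_le]
        rw [Finsupp.single_le_iff]; omega
      conv_rhs => rw [this]
      rw [map_add]; simp
    rw [← h2]; push_cast
    congr 1
    rw [add_right_comm, add_assoc _ (c : ℝ)]
    ring

lemma euler_eulerInv [Fintype σ] {c : ℕ} (hc : 0 < c) (P : MvPolynomial σ ℝ) :
    ∑ j, X j * pderiv j (eulerInv σ c P) + (c : ℝ) • eulerInv σ c P = P := by
  induction P using MvPolynomial.induction_on' with
  | add P Q hP hQ =>
    simp only [map_add, mul_add, Finset.sum_add_distrib, smul_add]
    rw [add_add_add_comm, hP, hQ]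
  | monomial m r =>
    simp only [eulerInv_monomial, X_mul_pderiv_monomial, ← Finset.sum_smul]
    rw [← Finsupp.degree_eq_sum, smul_monomial, smul_monomial, ← map_add]
    congr 1
    have : (m.degree + c : ℝ) ≠ 0 := by positivity
    rw [nsmul_eq_mul, smul_eq_mul]
    field_simp

lemma eulerInv_mem_degLE (c : ℕ) {k : ℤ} {P : MvPolynomial σ ℝ} (hP : P ∈ degLE σ k) :
    eulerInv σ c P ∈ degLE σ k := by
  rw [P.as_sum, map_sum]
  refine Submodule.sum_mem _ fun m hm => ?_
  rw [eulerInv_monomial, degLE, monomial_mem_restrictSupport]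
  exact Or.inl (mem_degLE.1 hP m hm)

/-- Closed polynomial one-forms are exact. -/
lemma exists_potential [Fintype σ] {k : ℤ} {W : σ → MvPolynomial σ ℝ}
    (hW : ∀ i, W i ∈ degLE σ k) (hc : ∀ i j, pderiv j (W i) = pderiv i (W j)) :
    ∃ φ ∈ degLE σ (k + 1), ∀ i, pderiv i φ = W i := by
  classical
  -- This is Poincaré's potential `∫₀¹ x · W(s x) ds`: integrating `s ^ m` produces the factor `1 /
  -- (m + 1)` on monomials of degree `m`.
  refine ⟨∑ i, X i * eulerInv σ 1 (W i), Submodule.sum_mem _ fun i _ => ?_, fun j => ?_⟩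
  · rw [add_comm]
    exact mul_mem_degLE (X_mem_degLE i) (eulerInv_mem_degLE 1 (hW i))
  · conv_rhs => rw [← euler_eulerInv one_pos (W j)]
    simp only [map_sum, pderiv_mul, Finset.sum_add_distrib, pderiv_eulerInv, hc _ j]
    rw [add_comm]
    congr 1
    rw [Finset.sum_eq_single j]
    · simp
    · intro i _ hi; simp [pderiv_X, hi.symm]
    · simp

/-- The divergence maps `x P_k` onto `P_k`. -/
lemma exists_sum_pderiv_X_mul [Fintype σ] [Nonempty σ] {k : ℤ} {P : MvPolynomial σ ℝ}
    (hP : P ∈ degLE σ k) : ∃ R ∈ degLE σ k, ∑ i, pderiv i (X i * R) = P := by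
  -- Since `div (x R) = n R + x · ∇R` in `n` variables, the Euler operator has to be inverted with
  -- shift `n`.
  refine ⟨eulerInv σ (Fintype.card σ) P, eulerInv_mem_degLE _ hP, ?_⟩
  conv_rhs => rw [← euler_eulerInv (Fintype.card_pos (α := σ)) P]
  simp only [pderiv_mul, pderiv_X_self, one_mul, Finset.sum_add_distrib, Finset.sum_const,
    Finset.card_univ]
  rw [add_comm, Nat.cast_smul_eq_nsmul]

lemma hasDerivAt_eval_line [Fintype σ] (P : MvPolynomial σ ℝ) (x v : σ → ℝ) (r : ℝ) :
    HasDerivAt (fun r : ℝ => eval (x + r • v) P)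
      (∑ k, v k * eval (x + r • v) (pderiv k P)) r := by
  classical
  induction P using MvPolynomial.induction_on with
  | C c => simpa using hasDerivAt_const r c
  | add P Q hP hQ =>
    simp only [map_add, mul_add, Finset.sum_add_distrib]
    exact hP.add hQ
  | mul_X P i hP =>
    have h1 : HasDerivAt (fun r : ℝ => x i + r * v i) (v i) r := by
      simpa using ((hasDerivAt_id r).mul_const (v i)).const_add (x i)
    have h2 := hP.mul h1
    have h3 : (∑ k, v k * eval (x + r • v) (pderiv k P)) * (x i + r * v i)
        + eval (x + r • v) P * v i = ∑ k, v k * eval (x + r • v) (pderiv k (P * X i)) := by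
      simp only [pderiv_mul, map_add, map_mul, mul_add, Finset.sum_add_distrib, eval_X,
        Pi.add_apply, Pi.smul_apply, smul_eq_mul]
      rw [Finset.sum_eq_single (f := fun k => v k * (eval (x + r • v) P * _)) i]
      · simp only [pderiv_X_self, map_one, mul_one, Finset.sum_mul, ← Finset.sum_add_distrib]
        congr 1
        · exact Finset.sum_congr rfl fun k _ => by ring
        · ring
      · intro b _ hb; simp [pderiv_X, hb.symm]
      · simp
    rw [← h3]
    refine h2.congr_of_eventuallyEq (Filter.Eventually.of_forall fun r => ?_)
    simp

/-- A polynomial whose derivative vanishes in the directions of a convex set is constant on it. -/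
lemma eval_eq_of_deriv_eq_zero [Fintype σ] {P : MvPolynomial σ ℝ} {S : Set (σ → ℝ)}
    (hS : Convex ℝ S) {x y : σ → ℝ} (hx : x ∈ S) (hy : y ∈ S)
    (h : ∀ z ∈ S, ∑ k, (y k - x k) * eval z (pderiv k P) = 0) : eval x P = eval y P := by
  obtain ⟨c, hc, hc'⟩ := exists_hasDerivAt_eq_slope
    (fun r : ℝ => eval (x + r • (y - x)) P) _ zero_lt_one
    (fun r _ => (hasDerivAt_eval_line P x (y - x) r).continuousAt.continuousWithinAt)
    (fun r _ => hasDerivAt_eval_line P x (y - x) r)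
  have := h _ (hS.add_smul_sub_mem hx hy ⟨hc.1.le, hc.2.le⟩)
  simp only [Pi.sub_apply] at hc'
  rw [this] at hc'
  simp at hc'
  linarith

end Euler

/-! ### Polynomials as functions on space -/

section Functions

lemma polyFun_apply (P : Poly) (x : E3) : polyFun P x = eval x.ofLp P := rfl

lemma fieldFun_apply (w : PolyField) (x : E3) (i : Fin 3) : fieldFun w x i = eval x.ofLp (w i) :=
  rfl

lemma contDiff_polyFun (P : Poly) {n : WithTop ℕ∞} : ContDiff ℝ n (polyFun P) := by
  have h1 := (AnalyticOnNhd.eval_mvPolynomial (𝕜 := ℝ) P).contDiff (n := n)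
  exact h1.comp (PiLp.contDiff_ofLp (𝕜 := ℝ) (p := 2))

@[fun_prop]
lemma continuous_polyFun (P : Poly) : Continuous (polyFun P) :=
  (contDiff_polyFun P (n := 0)).continuous

lemma contDiff_fieldFun (w : PolyField) {n : WithTop ℕ∞} : ContDiff ℝ n (fieldFun w) :=
  contDiff_euclidean.2 fun i => contDiff_polyFun (w i)

@[fun_prop]
lemma continuous_fieldFun (w : PolyField) : Continuous (fieldFun w) :=
  (contDiff_fieldFun w (n := 0)).continuous

/-- The component of a polynomial field in the direction `v`. -/
def dotPoly (w : PolyField) (v : E3) : Poly := ∑ i, C (v i) * w i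

lemma polyFun_dotPoly (w : PolyField) (v x : E3) :
    polyFun (dotPoly w v) x = inner ℝ (fieldFun w x) v := by
  simp [polyFun_apply, dotPoly, PiLp.inner_apply, fieldFun_apply, mul_comm]

lemma dotPoly_mem {w : PolyField} {k : ℤ} (hw : w ∈ polyFieldDeg k) (v : E3) :
    dotPoly w v ∈ polyDeg k :=
  Submodule.sum_mem _ fun i _ => C_mul_mem_degLE _ (hw i trivial)

lemma mem_polyFieldDeg {w : PolyField} {k : ℤ} :
    w ∈ polyFieldDeg k ↔ ∀ i, w i ∈ polyDeg k := by
  simp [polyFieldDeg, Submodule.mem_pi]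

lemma fderiv_polyFun (P : Poly) (x v : E3) :
    fderiv ℝ (polyFun P) x v = polyFun (dotPoly (gradField P) v) x := by
  have h1 := ((contDiff_polyFun P (n := 1)).differentiable one_ne_zero x).hasFDerivAt
  have hl : HasDerivAt (fun r : ℝ => x + r • v) v 0 := by
    simpa using ((hasDerivAt_id (0 : ℝ)).smul_const v).const_add x
  have h1' : HasFDerivAt (polyFun P) (fderiv ℝ (polyFun P) x) (x + (0 : ℝ) • v) := by simpa
  have h2 := h1'.comp_hasDerivAt (0 : ℝ) hl
  have h3 := hasDerivAt_eval_line P x.ofLp v.ofLp 0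
  have := h2.unique h3
  rw [this]
  simp [polyFun_apply, dotPoly, gradField]

lemma cross_apply (u v : E3) : (cross u v).ofLp =
    ![u 1 * v 2 - u 2 * v 1, u 2 * v 0 - u 0 * v 2, u 0 * v 1 - u 1 * v 0] := by
  simp [cross, crossProduct]

lemma cross_zero_apply (u v : E3) : cross u v 0 = u 1 * v 2 - u 2 * v 1 := by simp [cross_apply]
lemma cross_one_apply (u v : E3) : cross u v 1 = u 2 * v 0 - u 0 * v 2 := by simp [cross_apply]
lemma cross_two_apply (u v : E3) : cross u v 2 = u 0 * v 1 - u 1 * v 0 := by simp [cross_apply]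

lemma inner_eq (u v : E3) : inner ℝ u v = u 0 * v 0 + u 1 * v 1 + u 2 * v 2 := by
  simp [PiLp.inner_apply, Fin.sum_univ_three, mul_comm]

lemma curlField_zero (w : PolyField) : curlField w 0 = pderiv 1 (w 2) - pderiv 2 (w 1) := rfl
lemma curlField_one (w : PolyField) : curlField w 1 = pderiv 2 (w 0) - pderiv 0 (w 2) := rfl
lemma curlField_two (w : PolyField) : curlField w 2 = pderiv 0 (w 1) - pderiv 1 (w 0) := rfl

/-- This is the exterior derivative of the one-form `w` on the pair `(u, v)`. For tangent vectors of
a face it shows that the normal component of the curl involves only tangential components and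
tangential derivatives. -/
lemma dotPoly_curlField_cross (w : PolyField) (u v : E3) :
    dotPoly (curlField w) (cross u v)
      = dotPoly (gradField (dotPoly w v)) u - dotPoly (gradField (dotPoly w u)) v := by
  simp only [dotPoly, Fin.sum_univ_three, gradField, map_add, pderiv_C_mul, curlField_zero,
    curlField_one, curlField_two, cross_zero_apply, cross_one_apply, cross_two_apply, C_sub, C_mul]
  ring

lemma curlField_mem {w : PolyField} {k : ℤ} (hw : w ∈ polyFieldDeg k) :
    curlField w ∈ polyFieldDeg (k - 1) := by
  rw [mem_polyFieldDeg] at *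
  have h : ∀ i j l m, pderiv i (w j) - pderiv l (w m) ∈ polyDeg (k - 1) := fun i j l m =>
    Submodule.sub_mem _ (pderiv_mem_degLE (hw j) i) (pderiv_mem_degLE (hw m) l)
  intro i
  fin_cases i
  exacts [h 1 2 2 1, h 2 0 0 2, h 0 1 1 0]

lemma partialField_add (i : Fin 3) (w z : PolyField) :
    partialField i (w + z) = partialField i w + partialField i z := by
  ext1 j; simp [partialField]

lemma partialField_smul (i : Fin 3) (c : ℝ) (w : PolyField) :
    partialField i (c • w) = c • partialField i w := by
  ext1 j; simp [partialField]

lemma curlField_add (w z : PolyField) : curlField (w + z) = curlField w + curlField z := by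
  ext1 j; fin_cases j <;> simp [curlField] <;> ring

lemma curlField_smul (c : ℝ) (w : PolyField) : curlField (c • w) = c • curlField w := by
  ext1 j; fin_cases j <;> simp [curlField, smul_sub]

lemma polyFun_mul (P Q : Poly) (x : E3) : polyFun (P * Q) x = polyFun P x * polyFun Q x := by
  simp [polyFun_apply]

end Functions

/-! ### Pull-back to the reference simplex -/

section Pull

variable {d : ℕ} {a : Fin (d + 1) → E3} {s : Finset E3}

/-- Pull-back of polynomials along the parametrisation of a simplex. -/
def pull (a : Fin (d + 1) → E3) : Poly →ₐ[ℝ] MvPolynomial (Fin d) ℝ :=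
  aeval fun k => C (a 0 k) + ∑ j, C ((a j.succ - a 0) k) * X j

lemma eval_pull (a : Fin (d + 1) → E3) (P : Poly) (t : Fin d → ℝ) :
    eval t (pull a P) = polyFun P (param a t) := by
  rw [polyFun_apply, pull]
  induction P using MvPolynomial.induction_on with
  | C c => simp
  | add P Q hP hQ => simp only [map_add, hP, hQ]
  | mul_X P i hP =>
    rw [map_mul, map_mul, hP, aeval_X, map_mul, eval_X]
    congr 1
    simp [param, mul_comm]

lemma pull_mem_degLE (a : Fin (d + 1) → E3) {P : Poly} {k : ℤ} (hP : P ∈ polyDeg k) :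
    pull a P ∈ degLE (Fin d) k :=
  aeval_mem_degLE (fun _ => Submodule.add_mem _ (C_mem_degLE _ zero_le_one)
    (Submodule.sum_mem _ fun j _ => C_mul_mem_degLE _ (X_mem_degLE j))) hP

lemma pull_C (a : Fin (d + 1) → E3) (c : ℝ) : pull a (C c) = C c := by
  simp [pull]

/-- The chain rule: the `j`-th coordinate direction is mapped to the edge vector issuing from `a 0`.
-/
lemma pderiv_pull (a : Fin (d + 1) → E3) (P : Poly) (j : Fin d) :
    pderiv j (pull a P) = pull a (dotPoly (gradField P) (a j.succ - a 0)) := by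
  classical
  rw [pull, pderiv_aeval, ← pull, dotPoly, map_sum]
  refine Finset.sum_congr rfl fun k _ => ?_
  rw [map_mul, pull_C, mul_comm]
  congr 1
  rw [map_add, pderiv_C, zero_add, map_sum, Finset.sum_eq_single j]
  · rw [pderiv_C_mul, pderiv_X_self, mul_one]
  · intro i _ hi; rw [pderiv_C_mul, pderiv_X_of_ne hi, mul_zero]
  · simp

lemma pull_eq_zero_iff (a : Fin (d + 1) → E3) (P : Poly) :
    pull a P = 0 ↔ ∀ t ∈ refSimplex d, polyFun P (param a t) = 0 := by
  constructor
  · intro h t _; rw [← eval_pull, h, map_zero]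
  · intro h
    refine funext_set (fun _ => Set.Ioo (0 : ℝ) (1 / (d + 1)))
      (fun _ => Set.Ioo_infinite (by positivity)) fun t ht => ?_
    rw [eval_pull, h t (pi_Ioo_subset_refSimplex d ht), map_zero]

lemma Enumerates.pull_eq_zero_iff (h : Enumerates a s) (P : Poly) :
    pull a P = 0 ↔ ∀ x ∈ hull s, polyFun P x = 0 := by
  rw [NodalCurl.pull_eq_zero_iff, ← h.image_eq, Set.forall_mem_image]

/-- Polynomials on the reference simplex extend to polynomials on space of the same degree. -/
lemma Enumerates.exists_lift (h : Enumerates a s) : ∃ lift : MvPolynomial (Fin d) ℝ →ₐ[ℝ] Poly,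
    (∀ Q, pull a (lift Q) = Q) ∧ ∀ k Q, Q ∈ degLE (Fin d) k → lift Q ∈ polyDeg k := by
  obtain ⟨g, hg⟩ := (paramLinear a).exists_leftInverse_of_injective
    (LinearMap.ker_eq_bot.2 h.paramLinear_injective)
  -- The affine function `x ↦ g (x - a 0) j` on space; it recovers the parameter `t j` from `param a
  -- t`.
  let ℓ : Fin d → Poly := fun j =>
    ∑ k, C (g (EuclideanSpace.single k 1) j) * (X k - C (a 0 k))
  have hℓ : ∀ j, pull a (ℓ j) = X j := by
    intro j
    refine MvPolynomial.funext fun t => ?_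
    rw [eval_pull, eval_X, polyFun_apply, param_eq]
    have h1 : paramLinear a (WithLp.toLp 2 t) = ∑ k, (paramLinear a (WithLp.toLp 2 t)) k •
        (EuclideanSpace.single k (1 : ℝ) : E3) := by
      ext i; simp [Finset.sum_apply, Pi.single_apply]
    have h2 : g (paramLinear a (WithLp.toLp 2 t)) j = t j := by
      have := LinearMap.congr_fun hg (WithLp.toLp 2 t)
      rw [LinearMap.comp_apply] at this
      rw [this]; rfl
    rw [h1, map_sum] at h2
    rw [← h2]
    simp [ℓ, mul_comm]
  refine ⟨aeval ℓ, fun Q => ?_, fun k Q hQ => aeval_mem_degLE (fun j => ?_) hQ⟩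
  · have : (pull a).comp (aeval ℓ) = AlgHom.id ℝ _ := by
      ext1 j; simp [hℓ]
    exact DFunLike.congr_fun this Q
  · exact Submodule.sum_mem _ fun k _ => C_mul_mem_degLE _
      (Submodule.sub_mem _ (X_mem_degLE k) (C_mem_degLE _ zero_le_one))

lemma param_eq_sum (a : Fin (d + 1) → E3) (t : Fin d → ℝ) :
    param a t = ∑ i, eval t (bary d i) • a i := by
  simp only [Fin.sum_univ_succ, bary_zero, bary_succ, eval_X, map_sub, map_one, map_sum, param,
    smul_sub, Finset.sum_sub_distrib, ← Finset.sum_smul, sub_smul, one_smul]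
  abel

lemma sum_eval_bary (t : Fin d → ℝ) : ∑ i, eval t (bary d i) = 1 := by
  simp [Fin.sum_univ_succ]

lemma Enumerates.param_mem_hull_erase [DecidableEq E3] (h : Enumerates a s) {t : Fin d → ℝ}
    (ht : t ∈ refSimplex d) {i : Fin (d + 1)} (hi : eval t (bary d i) = 0) :
    param a t ∈ hull (s.erase (a i)) := by
  rw [param_eq_sum, ← Finset.sum_erase Finset.univ (a := i) (by rw [hi, zero_smul])]
  refine (convex_convexHull ℝ _).sum_mem (fun j _ => eval_bary_nonneg ht j) ?_ fun j hj => ?_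
  · rw [Finset.sum_erase (f := fun i => eval t (bary d i)) _ hi, sum_eval_bary]
  · refine subset_convexHull ℝ _ ?_
    rw [Finset.mem_coe, Finset.mem_erase]
    exact ⟨fun hji => (Finset.mem_erase.1 hj).1 (h.injective hji), h.mem j⟩

lemma param_refVertex (a : Fin (d + 1) → E3) (i : Fin (d + 1)) : param a (refVertex d i) = a i := by
  rw [param_eq_sum]; simp [eval_bary_refVertex]

lemma Enumerates.bary_dvd_pull [DecidableEq E3] {n : ℕ} {a : Fin (n + 2) → E3}
    (h : Enumerates a s) {i : Fin (n + 2)} {P : Poly}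
    (hP : ∀ x ∈ hull (s.erase (a i)), polyFun P x = 0) : bary (n + 1) i ∣ pull a P :=
  bary_dvd fun t ht hi => by rw [eval_pull]; exact hP _ (h.param_mem_hull_erase ht hi)

lemma convex_facet (i : Fin (d + 1)) : Convex ℝ {t ∈ refSimplex d | eval t (bary d i) = 0} := by
  have h : ∀ (x y : Fin d → ℝ) (α β : ℝ), α + β = 1 →
      eval (α • x + β • y) (bary d i) = α * eval x (bary d i) + β * eval y (bary d i) := by
    intro x y α β hαβ
    refine Fin.cases ?_ (fun j => ?_) i
    · simp only [bary_zero, map_sub, map_one, map_sum, eval_X, Pi.add_apply, Pi.smul_apply,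
        smul_eq_mul, Finset.sum_add_distrib, ← Finset.mul_sum]
      linear_combination -hαβ
    · simp
  intro x hx y hy α β hα hβ hαβ
  exact ⟨convex_refSimplex d hx.1 hy.1 hα hβ hαβ, by rw [h x y α β hαβ, hx.2, hy.2]; simp⟩

end Pull

/-! ### Vector algebra -/

section Vectors

lemma ext3 {u v : E3} (h0 : u 0 = v 0) (h1 : u 1 = v 1) (h2 : u 2 = v 2) : u = v := by
  ext i; fin_cases i <;> assumption

lemma cross_cross (u v z : E3) : cross u (cross v z) = inner ℝ u z • v - inner ℝ u v • z := by
  refine ext3 ?_ ?_ ?_ <;>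
  · simp only [cross_zero_apply, cross_one_apply, cross_two_apply, inner_eq, PiLp.sub_apply,
      PiLp.smul_apply, smul_eq_mul]
    ring

/-- Splitting of the inner product into the part along `ν` and the part orthogonal to it. It
translates vanishing of `u × ν` into vanishing of tangential components. -/
lemma inner_mul_inner (u v ν : E3) : inner ℝ u v * inner ℝ ν ν
    = inner ℝ u ν * inner ℝ v ν + inner ℝ (cross u ν) (cross v ν) := by
  simp only [inner_eq, cross_zero_apply, cross_one_apply, cross_two_apply]
  ring

lemma cross_smul_right (c : ℝ) (u v : E3) : cross u (c • v) = c • cross u v := by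
  refine ext3 ?_ ?_ ?_ <;>
  · simp only [cross_zero_apply, cross_one_apply, cross_two_apply, PiLp.smul_apply, smul_eq_mul]
    ring

lemma cross_add_left (u v z : E3) : cross (u + v) z = cross u z + cross v z := by
  refine ext3 ?_ ?_ ?_ <;>
  · simp only [cross_zero_apply, cross_one_apply, cross_two_apply, PiLp.add_apply]
    ring

lemma cross_smul_left (c : ℝ) (u v : E3) : cross (c • u) v = c • cross u v := by
  refine ext3 ?_ ?_ ?_ <;>
  · simp only [cross_zero_apply, cross_one_apply, cross_two_apply, PiLp.smul_apply, smul_eq_mul]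
    ring

lemma cross_sub_left (u v z : E3) : cross (u - v) z = cross u z - cross v z := by
  refine ext3 ?_ ?_ ?_ <;>
  · simp only [cross_zero_apply, cross_one_apply, cross_two_apply, PiLp.sub_apply]
    ring

@[fun_prop]
lemma Continuous.cross {X : Type*} [TopologicalSpace X] {f g : X → E3} (hf : Continuous f)
    (hg : Continuous g) : Continuous fun x => cross (f x) (g x) := by
  have h : Continuous fun x => ((NodalCurl.cross (f x) (g x)).ofLp : Fin 3 → ℝ) := by
    refine continuous_pi fun i => ?_
    fin_cases i <;> simp only [cross_apply] <;> simp <;> fun_prop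
  exact (PiLp.continuous_toLp 2 _).comp h

/-- A vector orthogonal to `u` and `v` is a multiple of `u × v`. -/
lemma exists_eq_smul_cross {u v ν : E3} (huv : LinearIndependent ℝ ![u, v])
    (hu : inner ℝ u ν = 0) (hv : inner ℝ v ν = 0) : ∃ c : ℝ, ν = c • cross u v := by
  set n := cross u v with hn
  -- `ν` is parallel to `n`, and expanding `n × (ν × n) = 0` solves for `ν` once `n ≠ 0` is known.
  have h1 : cross ν n = 0 := by
    rw [hn, cross_cross, real_inner_comm, hv, real_inner_comm, hu]; simp
  have hn0 : n ≠ 0 := by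
    intro h0
    have h2 : cross u (cross u v) = 0 := by
      rw [← hn, h0]; refine ext3 ?_ ?_ ?_ <;> simp [cross_zero_apply, cross_one_apply,
        cross_two_apply]
    rw [cross_cross] at h2
    have h3 := LinearIndependent.pair_iff.1 huv (inner ℝ u v) (-inner ℝ u u)
      (by rw [neg_smul, ← sub_eq_add_neg]; exact h2)
    have h4 : inner ℝ u u = (0 : ℝ) := by linarith [h3.2]
    exact huv.ne_zero 0 (inner_self_eq_zero.1 h4)
  have hnn : inner ℝ n n ≠ (0 : ℝ) := fun h => hn0 (inner_self_eq_zero.1 h)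
  refine ⟨inner ℝ ν n / inner ℝ n n, ?_⟩
  have h2 : cross n (cross ν n) = inner ℝ n n • ν - inner ℝ n ν • n := cross_cross n ν n
  rw [h1] at h2
  have h3 : cross n 0 = 0 := by
    refine ext3 ?_ ?_ ?_ <;> simp [cross_zero_apply, cross_one_apply, cross_two_apply]
  rw [h3] at h2
  rw [div_eq_inv_mul, mul_smul, real_inner_comm n ν, ← sub_eq_zero.1 h2.symm, smul_smul,
    inv_mul_cancel₀ hnn, one_smul]

lemma dotPoly_smul (w : PolyField) (c : ℝ) (v : E3) : dotPoly w (c • v) = C c * dotPoly w v := by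
  simp only [dotPoly, PiLp.smul_apply, smul_eq_mul, C_mul, Finset.mul_sum, mul_assoc]

end Vectors

/-! ### Polynomials orthogonal to their bubble factor -/

section Bubble

variable {d : ℕ} {a : Fin (d + 1) → E3} {s : Finset E3}

/-- A polynomial that vanishes to order `m` on the facets of a simplex and is orthogonal to the
polynomials of complementary degree vanishes on the simplex. -/
lemma Enumerates.eq_zero_of_orthogonal {n : ℕ} {a : Fin (n + 2) → E3} (h : Enumerates a s)
    {P : Poly} {k : ℤ} (hP : P ∈ polyDeg k) (m : ℕ) (hd : ∀ i, bary (n + 1) i ^ m ∣ pull a P)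
    (ho : ∀ Q ∈ polyDeg (k - (n + 2) * m),
      ∫ x in hull s, polyFun P x * polyFun Q x ∂μHE[n + 1] = 0) :
    ∀ x ∈ hull s, polyFun P x = 0 := by
  obtain ⟨lift, hl, hld⟩ := h.exists_lift
  obtain ⟨Q, hQ⟩ := prod_bary_pow_dvd m hd
  have hQd : Q ∈ degLE (Fin (n + 1)) (k - (n + 2) * m) := by
    have h1 := pull_mem_degLE a hP
    rw [hQ] at h1
    have := mem_degLE_of_prod_mul_mem Finset.univ one_le_totalDegree_bary m h1
    simpa using this
  -- Testing with an extension of the cofactor `Q` makes the integrand a nonnegative bubble times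
  -- `Q²`.
  have h0 := h.eq_zero_of_integral_eq_zero (g := fun x => polyFun P x * polyFun (lift Q) x)
    (by fun_prop) ?_ (ho _ (hld _ _ hQd))
  · rw [← h.pull_eq_zero_iff]
    have h1 : pull a (P * lift Q) = 0 := by
      rw [h.pull_eq_zero_iff]; intro x hx; rw [polyFun_mul]; exact h0 x hx
    rw [map_mul, hl, mul_eq_zero] at h1
    rcases h1 with h1 | h1
    · exact h1
    · rw [hQ, h1, mul_zero]
  · intro x hx
    rw [← h.image_eq] at hx
    obtain ⟨t, ht, rfl⟩ := hx
    rw [← eval_pull, ← eval_pull, hl, hQ, map_mul, mul_assoc, map_prod]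
    refine mul_nonneg (Finset.prod_nonneg fun i _ => ?_) (mul_self_nonneg _)
    rw [map_pow]; exact pow_nonneg (eval_bary_nonneg ht i) m

/-- A polynomial whose tangential derivatives vanish on the facets is constant on the boundary. -/
lemma eval_eq_on_facets {n : ℕ} {P : MvPolynomial (Fin (n + 2)) ℝ}
    (h : ∀ i, ∀ x ∈ refSimplex (n + 2), eval x (bary (n + 2) i) = 0 →
      ∀ y ∈ refSimplex (n + 2), eval y (bary (n + 2) i) = 0 →
      ∀ z ∈ refSimplex (n + 2), eval z (bary (n + 2) i) = 0 →
        ∑ k, (y k - x k) * eval z (pderiv k P) = 0)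
    (i : Fin (n + 3)) {t : Fin (n + 2) → ℝ} (ht : t ∈ refSimplex (n + 2))
    (hi : eval t (bary (n + 2) i) = 0) : eval t P = eval 0 P := by
  have hmem : ∀ i, refVertex (n + 2) i ∈ refSimplex (n + 2) := fun i =>
    Fin.cases ⟨fun j => by simp [refVertex], by simp [refVertex]⟩
      (fun l => ⟨fun j => by
        simp only [refVertex, Fin.cons_succ, Pi.single_apply]; split_ifs <;> norm_num,
        by simp [refVertex]⟩) i
  have hv : ∀ i j, j ≠ i → eval (refVertex (n + 2) j) (bary (n + 2) i) = 0 := fun i j hij => by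
    rw [eval_bary_refVertex, if_neg hij.symm]
  have key : ∀ i j, j ≠ i → ∀ t ∈ refSimplex (n + 2), eval t (bary (n + 2) i) = 0 →
      eval t P = eval (refVertex (n + 2) j) P := fun i j hij t ht hi =>
    eval_eq_of_deriv_eq_zero (convex_facet i) ⟨ht, hi⟩ ⟨hmem j, hv i j hij⟩
      fun z hz => h i t ht hi _ (hmem j) (hv i j hij) z hz.1 hz.2
  have h0 : refVertex (n + 2) 0 = 0 := rfl
  rw [← h0]
  -- The facet opposite to vertex `0` does not contain it. There one passes to vertex `1`, and from
  -- there to vertex `0` within the facet opposite to vertex `2`; this is where dimension at least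
  -- two is needed.
  by_cases hi0 : i = 0
  · subst hi0
    have h12 : (0 : Fin (n + 2)).succ ≠ (1 : Fin (n + 2)).succ :=
      (Fin.succ_injective _).ne (by simp)
    rw [key 0 (0 : Fin (n + 2)).succ (Fin.succ_ne_zero _) t ht hi,
      key (1 : Fin (n + 2)).succ 0 (Fin.succ_ne_zero _).symm _ (hmem _) (hv _ _ h12)]
  · exact key i 0 (Ne.symm hi0) t ht hi

lemma bary_dvd_sub_C {n : ℕ} {P : MvPolynomial (Fin (n + 2)) ℝ}
    (h : ∀ i, ∀ x ∈ refSimplex (n + 2), eval x (bary (n + 2) i) = 0 →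
      ∀ y ∈ refSimplex (n + 2), eval y (bary (n + 2) i) = 0 →
      ∀ z ∈ refSimplex (n + 2), eval z (bary (n + 2) i) = 0 →
        ∑ k, (y k - x k) * eval z (pderiv k P) = 0) (i : Fin (n + 3)) :
    bary (n + 2) i ∣ P - C (eval 0 P) :=
  bary_dvd fun t ht hi => by rw [map_sub, eval_C, eval_eq_on_facets h i ht hi, sub_self]

end Bubble

/-! ### Test functions given by polynomials -/

section Tests

variable {s : Finset E3}

lemma indicator_mem_polyOn {Q : Poly} {k : ℤ} (hQ : Q ∈ polyDeg k) :
    (hull s).indicator (polyFun Q) ∈ polyOn s k := ⟨Q, hQ, rfl⟩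

lemma indicator_mem_polyFieldOn {z : PolyField} {k : ℤ} (hz : z ∈ polyFieldDeg k) :
    (hull s).indicator (fieldFun z) ∈ polyFieldOn s k := ⟨z, hz, rfl⟩

lemma setIntegral_hull_congr {F : Type*} [NormedAddCommGroup F] [NormedSpace ℝ F]
    {μ : Measure E3} {g g' : E3 → F} (h : ∀ x ∈ hull s, g x = g' x) :
    ∫ x in hull s, g x ∂μ = ∫ x in hull s, g' x ∂μ :=
  setIntegral_congr_fun (measurableSet_hull s) h

end Tests

/-! ### Edges -/

section Edge

variable {e : Finset E3} {p : ℕ} {w : PolyField}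

/-- On an edge the facet opposite to a vertex is just the other end point. -/
lemma Enumerates.bary_dvd_pull_of_vertex {a : Fin 2 → E3} (h : Enumerates a e) {P : Poly}
    (hP : ∀ x ∈ e, polyFun P x = 0) (i : Fin 2) : bary 1 i ∣ pull a P := by
  classical
  refine h.bary_dvd_pull fun x hx => ?_
  have hc : (e.erase (a i)).card = 1 := by
    rw [Finset.card_erase_of_mem (h.mem i), h.card_eq]
  obtain ⟨b, hb⟩ := Finset.card_eq_one.1 hc
  rw [hb] at hx
  simp only [hull, Finset.coe_singleton, convexHull_singleton, Set.mem_singleton_iff] at hx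
  rw [hx]
  exact hP b (Finset.mem_of_mem_erase (a := a i) (by rw [hb]; simp))

/-- Each component has double zeros at both ends, so it is a squared bubble of degree four times a
polynomial of degree `p - 4`, which is the degree of the moments. -/
lemma field_eq_zero_on_edge (hi : AffineIndependent ℝ ((↑) : e → E3)) (hc : e.card = 2)
    (hw : w ∈ polyFieldDeg p) (hv : ∀ a ∈ e, fieldFun w a = 0)
    (hd : ∀ a ∈ e, ∀ i, fieldFun (partialField i w) a = 0)
    (hm : ∀ q ∈ polyFieldOn e ((p : ℤ) - 4),
      ∫ x in hull e, inner ℝ (fieldFun w x) (q x) ∂μHE[1] = 0) :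
    ∀ x ∈ hull e, fieldFun w x = 0 := by
  obtain ⟨a, ha⟩ := exists_enumerates hi hc
  have key : ∀ i, ∀ x ∈ hull e, polyFun (w i) x = 0 := by
    intro i
    refine ha.eq_zero_of_orthogonal (mem_polyFieldDeg.1 hw i) 2 (fun j => ?_) fun Q hQ => ?_
    · refine bary_sq_dvd (ha.bary_dvd_pull_of_vertex (fun x hx => ?_) j) fun l => ?_
      · exact congrArg (fun v : E3 => v i) (hv x hx)
      · rw [pderiv_pull]
        refine ha.bary_dvd_pull_of_vertex (fun x hx => ?_) j
        rw [polyFun_dotPoly, inner_eq]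
        have h : ∀ k, fieldFun (gradField (w i)) x k = 0 := fun k =>
          congrArg (fun v : E3 => v i) (hd x hx k)
        simp [h]
    · have hz : (Pi.single i Q : PolyField) ∈ polyFieldDeg ((p : ℤ) - 4) := by
        rw [mem_polyFieldDeg]
        intro j
        by_cases hj : j = i
        · subst hj; rw [Pi.single_eq_same]; convert hQ using 2; ring
        · rw [Pi.single_eq_of_ne hj]; exact Submodule.zero_mem _
      rw [← hm _ (indicator_mem_polyFieldOn hz)]
      refine setIntegral_hull_congr fun x hx => ?_
      rw [Set.indicator_of_mem hx, PiLp.inner_apply, Finset.sum_eq_single i]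
      · simp [fieldFun_apply, polyFun_apply, mul_comm]
      · intro j _ hj; simp [fieldFun_apply, Pi.single_eq_of_ne hj]
      · simp
  intro x hx
  ext i
  exact key i x hx

/-- Both `u` and the edge vector are orthogonal to the two given normals, hence multiples of their
cross product; thus `u` is tangent to the edge. Consequently the choice of the normals is
immaterial. -/
lemma inner_eq_zero_of_isEdgeNormals (hc : e.card = 2) {ν : Fin 2 → E3}
    (hν : IsEdgeNormals e ν) {u ν' : E3} (hu : ∀ i, inner ℝ u (ν i) = 0)
    (hν' : ∀ a ∈ e, ∀ b ∈ e, inner ℝ (a - b) ν' = 0) : inner ℝ u ν' = 0 := by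
  obtain ⟨a, b, hab, rfl⟩ := Finset.card_eq_two.1 hc
  have ht : a - b ≠ 0 := sub_ne_zero.2 hab
  have hτ : ∀ v : E3, (∀ x ∈ ({a, b} : Finset E3), ∀ y ∈ ({a, b} : Finset E3),
      inner ℝ (x - y) v = 0) → inner ℝ (a - b) v = 0 := fun v hv =>
    hv a (by simp) b (by simp)
  have hl : LinearIndependent ℝ ![ν 0, ν 1] := by
    convert hν.2.2 using 1; ext i; fin_cases i <;> rfl
  obtain ⟨c, hcross⟩ := exists_eq_smul_cross hl
    (by rw [real_inner_comm]; exact hτ _ (hν.2.1 0)) (by rw [real_inner_comm]; exact hτ _ (hν.2.1 1))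
  obtain ⟨c', hcross'⟩ := exists_eq_smul_cross hl
    (by rw [real_inner_comm]; exact hu 0) (by rw [real_inner_comm]; exact hu 1)
  have hc0 : c ≠ 0 := by rintro rfl; exact ht (by rw [hcross, zero_smul])
  have : u = (c' / c) • (a - b) := by
    rw [hcross, smul_smul, div_mul_cancel₀ _ hc0]; exact hcross'
  rw [this, inner_smul_left, hτ _ hν', mul_zero]

/-- The curl is a combination of first derivatives, so it vanishes at the end points. Its degree `p
- 1` minus two simple zeros leaves the degree `p - 3` of the moments. -/
lemma curl_normal_eq_zero_on_edge (hi : AffineIndependent ℝ ((↑) : e → E3)) (hc : e.card = 2)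
    (hw : w ∈ polyFieldDeg p) (hd : ∀ a ∈ e, ∀ i, fieldFun (partialField i w) a = 0)
    {ν : Fin 2 → E3} (hν : IsEdgeNormals e ν)
    (hm : ∀ i, ∀ q ∈ polyOn e ((p : ℤ) - 3),
      ∫ x in hull e, inner ℝ (fieldFun (curlField w) x) (ν i) * q x ∂μHE[1] = 0) :
    ∀ x ∈ hull e, ∀ ν' : E3, (∀ a ∈ e, ∀ b ∈ e, inner ℝ (a - b) ν' = 0) →
      inner ℝ (fieldFun (curlField w) x) ν' = 0 := by
  obtain ⟨a, ha⟩ := exists_enumerates hi hc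
  have key : ∀ i, ∀ x ∈ hull e, polyFun (dotPoly (curlField w) (ν i)) x = 0 := by
    intro i
    refine ha.eq_zero_of_orthogonal (dotPoly_mem (curlField_mem hw) _) 1 (fun j => ?_)
      fun Q hQ => ?_
    · rw [pow_one]
      refine ha.bary_dvd_pull_of_vertex (fun x hx => ?_) j
      have h : ∀ k l, eval x.ofLp (pderiv k (w l)) = 0 := fun k l =>
        congrArg (fun v : E3 => v l) (hd x hx k)
      rw [polyFun_dotPoly, inner_eq]
      simp [fieldFun_apply, curlField, h]
    · have hQ' : Q ∈ polyDeg ((p : ℤ) - 3) := by convert hQ using 2; push_cast; ring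
      rw [← hm i _ (indicator_mem_polyOn hQ')]
      refine setIntegral_hull_congr fun x hx => ?_
      rw [Set.indicator_of_mem hx, polyFun_dotPoly]
  intro x hx ν' hν'
  exact inner_eq_zero_of_isEdgeNormals hc hν
    (fun i => by rw [← polyFun_dotPoly]; exact key i x hx) hν'

end Edge

/-! ### Faces: the normal component of the curl and the tangential trace -/

section Face

variable {f : Finset E3} {p : ℕ} {w : PolyField} {ν : E3}

lemma IsFaceNormal.ne_zero (hν : IsFaceNormal f ν) : ν ≠ 0 := by
  rintro rfl; simpa using hν.1

lemma inner_eq_zero_of_cross_eq_zero {u v ν : E3} (hν : ν ≠ 0) (hu : cross u ν = 0)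
    (hv : inner ℝ v ν = 0) : inner ℝ u v = 0 := by
  have := inner_mul_inner u v ν
  rw [hu, hv, inner_zero_left, mul_zero, add_zero, mul_eq_zero] at this
  exact this.resolve_right fun h => hν (inner_self_eq_zero.1 h)

lemma Enumerates.linearIndependent_pair {a : Fin 3 → E3} (ha : Enumerates a f) :
    LinearIndependent ℝ ![a 1 - a 0, a 2 - a 0] := by
  convert ha.linearIndependent using 1
  ext i; fin_cases i <;> rfl

lemma IsFaceNormal.exists_eq_smul_cross (hν : IsFaceNormal f ν) {a : Fin 3 → E3}
    (ha : Enumerates a f) : ∃ c : ℝ, c ≠ 0 ∧ ν = c • cross (a 1 - a 0) (a 2 - a 0) := by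
  obtain ⟨c, hc⟩ := NodalCurl.exists_eq_smul_cross ha.linearIndependent_pair
    (hν.2 _ (ha.mem 1) _ (ha.mem 0)) (hν.2 _ (ha.mem 2) _ (ha.mem 0))
  refine ⟨c, ?_, hc⟩
  rintro rfl
  exact hν.ne_zero (by rw [hc, zero_smul])

lemma cross_eq_zero_of_inner_eq_zero (hν : IsFaceNormal f ν) {a : Fin 3 → E3}
    (ha : Enumerates a f) {u : E3} (h : ∀ j : Fin 2, inner ℝ u (a j.succ - a 0) = 0) :
    cross u ν = 0 := by
  obtain ⟨c, -, hc⟩ := hν.exists_eq_smul_cross ha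
  have h1 : inner ℝ u (a 1 - a 0) = 0 := h 0
  have h2 : inner ℝ u (a 2 - a 0) = 0 := h 1
  rw [hc, cross_smul_right, cross_cross, h1, h2]; simp

/-- The normal component of the curl, pulled back to the reference triangle. -/
lemma Enumerates.pull_curl_normal {a : Fin 3 → E3} (w : PolyField) {c : ℝ}
    (hc : ν = c • cross (a 1 - a 0) (a 2 - a 0)) :
    pull a (dotPoly (curlField w) ν) = C c *
      (pderiv 0 (pull a (dotPoly w (a 2 - a 0))) - pderiv 1 (pull a (dotPoly w (a 1 - a 0)))) := by
  rw [hc, dotPoly_smul, map_mul, pull_C, dotPoly_curlField_cross, map_sub, pderiv_pull,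
    pderiv_pull]
  rfl

/-- If the tangential trace vanishes on a face then so does the normal component of the curl. -/
lemma curl_normal_eq_zero_of_trace_eq_zero (hi : AffineIndependent ℝ ((↑) : f → E3))
    (hc : f.card = 3) (hν : IsFaceNormal f ν)
    (h : ∀ x ∈ hull f, cross (fieldFun w x) ν = 0) :
    ∀ x ∈ hull f, inner ℝ (fieldFun (curlField w) x) ν = 0 := by
  obtain ⟨a, ha⟩ := exists_enumerates hi hc
  obtain ⟨c, -, hc⟩ := hν.exists_eq_smul_cross ha
  have hW : ∀ i, pull a (dotPoly w (a i - a 0)) = 0 := fun i => by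
    rw [ha.pull_eq_zero_iff]
    intro x hx
    rw [polyFun_dotPoly]
    exact inner_eq_zero_of_cross_eq_zero hν.ne_zero (h x hx) (hν.2 _ (ha.mem i) _ (ha.mem 0))
  have h0 : pull a (dotPoly (curlField w) ν) = 0 := by
    rw [Enumerates.pull_curl_normal w hc, hW, hW]; simp
  intro x hx
  rw [← polyFun_dotPoly]
  exact (ha.pull_eq_zero_iff _).1 h0 x hx

lemma simplexInt_eq_zero {d : ℕ} {s : Finset E3} {g : E3 → ℝ} (h : ∀ x ∈ hull s, g x = 0) :
    simplexInt d s g = 0 := by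
  rw [simplexInt, setAverage_eq, setIntegral_hull_congr (g' := fun _ => 0) h]; simp

lemma simplexInt_sub {d : ℕ} {s : Finset E3} (hi : AffineIndependent ℝ ((↑) : s → E3))
    (hc : s.card = d + 1) {g g' : E3 → ℝ} (hg : Continuous g) (hg' : Continuous g') :
    simplexInt d s (fun x => g x - g' x) = simplexInt d s g - simplexInt d s g' := by
  obtain ⟨a, ha⟩ := exists_enumerates hi hc
  simp only [simplexInt, setAverage_eq]
  rw [integral_sub (ha.integrableOn hg) (ha.integrableOn hg'), smul_sub, mul_sub]

/-- The curl of a field that vanishes on the edges of a face has zero mean flux through it. -/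
lemma integral_curl_normal_eq_zero (hi : AffineIndependent ℝ ((↑) : f → E3)) (hc : f.card = 3)
    (hν : IsFaceNormal f ν)
    (hw : ∀ e ⊆ f, e.card = 2 → ∀ x ∈ hull e, fieldFun w x = 0) :
    ∫ x in hull f, inner ℝ (fieldFun (curlField w) x) ν ∂μHE[2] = 0 := by
  classical
  obtain ⟨a, ha⟩ := exists_enumerates hi hc
  obtain ⟨c, -, hν'⟩ := hν.exists_eq_smul_cross ha
  obtain ⟨C, -, hC⟩ := integral_hull_eq_simplexInt hi hc
  -- Each of the two terms of the normal curl is a derivative along an edge vector, so its integral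
  -- reduces to edge integrals of components of `w`.
  have hD : ∀ (i : Fin 3) (v : E3), simplexInt 2 f
      (fun x => fderiv ℝ (polyFun (dotPoly w v)) x (a i - a 0)) = 0 := by
    intro i v
    have hz : ∀ y ∈ f, simplexInt 1 (f.erase y) (polyFun (dotPoly w v)) = 0 := fun y hy =>
      simplexInt_eq_zero fun x hx => by
        rw [polyFun_dotPoly, hw _ (Finset.erase_subset _ _)
          (by rw [Finset.card_erase_of_mem hy, hc]) x hx, inner_zero_left]
    rw [simplexInt_fderiv hi hc (ha.mem 0) (ha.mem i) (contDiff_polyFun _),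
      hz _ (ha.mem 0), hz _ (ha.mem i), sub_zero]
  have hR : ∀ x, inner ℝ (fieldFun (curlField w) x) ν
      = c * (fderiv ℝ (polyFun (dotPoly w (a 2 - a 0))) x (a 1 - a 0)
        - fderiv ℝ (polyFun (dotPoly w (a 1 - a 0))) x (a 2 - a 0)) := by
    intro x
    rw [hν', inner_smul_right, ← polyFun_dotPoly, dotPoly_curlField_cross, map_sub, Pi.sub_apply,
      fderiv_polyFun, fderiv_polyFun]
  simp only [hR]
  rw [integral_const_mul, hC, simplexInt_sub hi hc, hD, hD, sub_zero, mul_zero, mul_zero]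
  · simp only [fderiv_polyFun]; fun_prop
  · simp only [fderiv_polyFun]; fun_prop

/-- A field that vanishes on the edges of a face together with its normal curl, and has vanishing
curl moments on the face, has vanishing normal curl on the face. -/
lemma curl_normal_eq_zero_on_face (hp : 4 ≤ p) (hi : AffineIndependent ℝ ((↑) : f → E3))
    (hc : f.card = 3) (hν : IsFaceNormal f ν) (hw : w ∈ polyFieldDeg p)
    (hv : ∀ e ⊆ f, e.card = 2 → ∀ x ∈ hull e, fieldFun w x = 0)
    (hcv : ∀ e ⊆ f, e.card = 2 → ∀ x ∈ hull e, ∀ ν' : E3,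
      (∀ a ∈ e, ∀ b ∈ e, inner ℝ (a - b) ν' = 0) → inner ℝ (fieldFun (curlField w) x) ν' = 0)
    (hcm : ∀ g ∈ meanZeroOn f ((p : ℤ) - 4),
      ∫ x in hull f, inner ℝ (fieldFun (curlField w) x) ν * g x ∂μHE[2] = 0)
    {a : Fin 3 → E3} (ha : Enumerates a f) :
    pull a (dotPoly (curlField w) ν) = 0 := by
  classical
  have hecard : ∀ i, (f.erase (a i)).card = 2 := fun i => by
    rw [Finset.card_erase_of_mem (ha.mem i), hc]
  rw [ha.pull_eq_zero_iff]
  refine ha.eq_zero_of_orthogonal (dotPoly_mem (curlField_mem hw) _) 1 (fun i => ?_)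
    fun Q hQ => ?_
  · rw [pow_one]
    refine ha.bary_dvd_pull fun x hx => ?_
    rw [polyFun_dotPoly]
    exact hcv _ (Finset.erase_subset _ _) (hecard i) x hx ν fun y hy z hz =>
      hν.2 y (Finset.mem_of_mem_erase hy) z (Finset.mem_of_mem_erase hz)
  · have hQ' : Q ∈ polyDeg ((p : ℤ) - 4) := by convert hQ using 2; push_cast; ring
    -- The degrees of freedom only see test functions of mean zero. Subtracting the mean of `Q`
    -- costs nothing, because the normal curl itself has zero integral.
    set m : ℝ := ⨍ x in hull f, polyFun Q x ∂μHE[2] with hm'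
    have hQm : Q - C m ∈ polyDeg ((p : ℤ) - 4) :=
      -- Constants belong to the test degree `p - 4` because `p ≥ 4`.
      Submodule.sub_mem _ hQ' (C_mem_degLE m (by omega))
    have hpf : ∀ x, polyFun (Q - C m) x = polyFun Q x - m := fun x => by
      simp [polyFun_apply]
    have hmz : (hull f).indicator (polyFun (Q - C m)) ∈ meanZeroOn f ((p : ℤ) - 4) := by
      refine Submodule.subset_span ⟨indicator_mem_polyOn hQm, ?_⟩
      rw [setIntegral_hull_congr (g' := fun x => polyFun Q x - m)
        fun x hx => by rw [Set.indicator_of_mem hx, hpf]]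
      rw [integral_sub (ha.integrableOn (by fun_prop)) (ha.integrableOn (by fun_prop)), hm',
        setAverage_eq, setIntegral_const, smul_eq_mul, smul_eq_mul, ← mul_assoc,
        mul_inv_cancel₀, one_mul, sub_self]
      exact (ENNReal.toReal_pos ha.measure_hull_ne_zero ha.measure_hull_ne_top).ne'
    have h1 := hcm _ hmz
    rw [setIntegral_hull_congr (g' := fun x => polyFun (dotPoly (curlField w) ν) x * polyFun Q x
      - m * inner ℝ (fieldFun (curlField w) x) ν) fun x hx => by
        rw [Set.indicator_of_mem hx, hpf, polyFun_dotPoly]; ring,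
      integral_sub (ha.integrableOn (by fun_prop)) (ha.integrableOn (by fun_prop)),
      integral_const_mul, integral_curl_normal_eq_zero hi hc hν hv, mul_zero, sub_zero] at h1
    exact h1

/-- Squared bubbles on the reference triangle come from admissible bubbles on the face. -/
lemma Enumerates.exists_bubble {a : Fin 3 → E3} (ha : Enumerates a f) {k : ℤ}
    {ψ : MvPolynomial (Fin 2) ℝ} (hψ : ψ ∈ degLE (Fin 2) k) :
    ∃ Ψ ∈ polyDeg k, ∃ L : E3 → Poly, IsBarycentric f L ∧
      pull a (Ψ * ∏ x ∈ f, L x ^ 2) = (∏ i, bary 2 i ^ 2) * ψ := by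
  classical
  obtain ⟨lift, hl, hld⟩ := ha.exists_lift
  let L : E3 → Poly := Function.extend a (fun i => lift (bary 2 i)) 0
  have hL : ∀ i, L (a i) = lift (bary 2 i) := fun i => ha.injective.extend_apply _ _ i
  have hbar : IsBarycentric f L := by
    have he : ∀ i j, polyFun (L (a i)) (a j) = if i = j then 1 else 0 := fun i j => by
      rw [hL, ← param_refVertex a j, ← eval_pull, hl, eval_bary_refVertex]
    intro x hx
    obtain ⟨i, rfl⟩ := ha.exists_eq hx
    refine ⟨by rw [hL]; exact hld _ _ (bary_mem_degLE 2 i), by rw [he, if_pos rfl], ?_⟩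
    intro y hy hyx
    obtain ⟨j, rfl⟩ := ha.exists_eq hy
    rw [he, if_neg fun hij => hyx (by rw [hij])]
  have hprod : ∏ x ∈ f, L x ^ 2 = ∏ i, lift (bary 2 i) ^ 2 := by
    have : f = Finset.univ.image a := by
      rw [← Finset.coe_inj, ← ha.range_eq]; simp
    rw [this, Finset.prod_image fun i _ j _ hij => ha.injective hij]
    exact Finset.prod_congr rfl fun i _ => by rw [hL]
  refine ⟨lift ψ, hld _ _ hψ, L, hbar, ?_⟩
  rw [hprod, map_mul, hl, map_prod, mul_comm]
  simp only [map_pow, hl]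

/-- A field whose value and normal curl vanish on the edges of a face, and which has vanishing face
moments, has vanishing tangential trace. -/
lemma trace_eq_zero_on_face (hp : 4 ≤ p) (hi : AffineIndependent ℝ ((↑) : f → E3))
    (hc : f.card = 3) (hν : IsFaceNormal f ν) (hw : w ∈ polyFieldDeg p)
    (hv : ∀ e ⊆ f, e.card = 2 → ∀ x ∈ hull e, fieldFun w x = 0)
    (hcv : ∀ e ⊆ f, e.card = 2 → ∀ x ∈ hull e, ∀ ν' : E3,
      (∀ a ∈ e, ∀ b ∈ e, inner ℝ (a - b) ν' = 0) → inner ℝ (fieldFun (curlField w) x) ν' = 0)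
    (hm : ∀ q ∈ curlBubbleOn f ν ((p : ℤ) - 5),
      ∫ x in hull f, inner ℝ (cross (fieldFun w x) ν) (q x) ∂μHE[2] = 0)
    (hcm : ∀ g ∈ meanZeroOn f ((p : ℤ) - 4),
      ∫ x in hull f, inner ℝ (fieldFun (curlField w) x) ν * g x ∂μHE[2] = 0) :
    ∀ x ∈ hull f, cross (fieldFun w x) ν = 0 := by
  classical
  obtain ⟨a, ha⟩ := exists_enumerates hi hc
  obtain ⟨c, hc0, hν'⟩ := hν.exists_eq_smul_cross ha
  have hecard : ∀ i, (f.erase (a i)).card = 2 := fun i => by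
    rw [Finset.card_erase_of_mem (ha.mem i), hc]
  have hR := curl_normal_eq_zero_on_face hp hi hc hν hw hv hcv hcm ha
  set W : Fin 2 → MvPolynomial (Fin 2) ℝ := fun j => pull a (dotPoly w (a j.succ - a 0)) with hWdef
  have hWe : ∀ i j, bary 2 i ∣ W j := fun i j => ha.bary_dvd_pull fun x hx => by
    rw [polyFun_dotPoly, hv _ (Finset.erase_subset _ _) (hecard i) x hx, inner_zero_left]
  rw [Enumerates.pull_curl_normal w hν'] at hR
  have hR' : pderiv 0 (W 1) = pderiv 1 (W 0) :=
    sub_eq_zero.1 ((mul_eq_zero.1 hR).resolve_left (by simpa using hc0))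
  -- In the coordinates of the reference triangle, vanishing of the normal curl says that the
  -- tangential trace is a closed one-form.
  obtain ⟨φ₁, hφd₁, hφ₁⟩ := exists_potential (W := W) (k := p)
    (fun i => pull_mem_degLE a (dotPoly_mem hw _))
    (Fin.forall_fin_two.2 ⟨Fin.forall_fin_two.2 ⟨rfl, hR'.symm⟩, Fin.forall_fin_two.2 ⟨hR', rfl⟩⟩)
  set φ := φ₁ - C (eval 0 φ₁) with hφdef
  have hφd : φ ∈ degLE (Fin 2) ((p : ℤ) + 1) :=
    Submodule.sub_mem _ hφd₁ (C_mem_degLE _ (by omega))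
  have hφ : ∀ i, pderiv i φ = W i := fun i => by rw [hφdef, map_sub, pderiv_C, sub_zero, hφ₁]
  have hφb : ∀ i, bary 2 i ∣ φ := bary_dvd_sub_C fun i x _ _ y _ _ z _ hz =>
    Finset.sum_eq_zero fun k _ => by
      obtain ⟨Q, hQ⟩ := hWe i k
      rw [hφ₁, hQ, map_mul, hz, zero_mul, mul_zero]
  -- The potential vanishes on the boundary and so does its gradient `W`, so every barycentric
  -- coordinate divides it twice. The cofactor has degree `(p + 1) - 6`.
  obtain ⟨ψ, hψ⟩ := prod_bary_pow_dvd 2 fun i => bary_sq_dvd (hφb i) fun j => by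
    rw [hφ j]; exact hWe i j
  have hψd : ψ ∈ degLE (Fin 2) ((p : ℤ) - 5) := by
    rw [hψ] at hφd
    have := mem_degLE_of_prod_mul_mem Finset.univ one_le_totalDegree_bary 2 hφd
    convert this using 2; simp; ring
  obtain ⟨Ψ, hΨ, L, hbar, hpΦ⟩ := ha.exists_bubble hψd
  rw [← hψ] at hpΦ
  set Φ := Ψ * ∏ x ∈ f, L x ^ 2 with hΦ
  -- Both fields have the same inner products with the edge vectors, since `Φ` restricts to the
  -- potential `φ`; the cross product with `ν` sees nothing else. Hence `w × ν` may be tested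
  -- against itself.
  have hcross : ∀ x ∈ hull f, cross (fieldFun (gradField Φ) x) ν = cross (fieldFun w x) ν := by
    intro x hx
    rw [← sub_eq_zero, ← cross_sub_left]
    refine cross_eq_zero_of_inner_eq_zero hν ha fun j => ?_
    have h0 : pull a (dotPoly (gradField Φ) (a j.succ - a 0) - dotPoly w (a j.succ - a 0)) = 0 := by
      rw [map_sub, ← pderiv_pull, hpΦ, hφ, sub_self]
    have := (ha.pull_eq_zero_iff _).1 h0 x hx
    rwa [map_sub, Pi.sub_apply, polyFun_dotPoly, polyFun_dotPoly, ← inner_sub_left] at this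
  have hq : (hull f).indicator (fun x => cross (fieldFun (gradField Φ) x) ν)
      ∈ curlBubbleOn f ν ((p : ℤ) - 5) :=
    Submodule.subset_span ⟨Ψ, hΨ, L, hbar, rfl⟩
  have h1 := hm _ hq
  rw [setIntegral_hull_congr (g' := fun x => inner ℝ (cross (fieldFun w x) ν)
    (cross (fieldFun w x) ν)) fun x hx => by rw [Set.indicator_of_mem hx, hcross x hx]] at h1
  intro x hx
  exact inner_self_eq_zero.1 (ha.eq_zero_of_integral_eq_zero (by fun_prop)
    (fun x _ => real_inner_self_nonneg) h1 x hx)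

end Face

/-! ### Barycentric gradients and Stokes' formula on a tetrahedron -/

section Cell

variable {K : Finset E3}

lemma volume_eq_euclideanHausdorffMeasure : (volume : Measure E3) = μHE[3] :=
  (EuclideanSpace.euclideanHausdorffMeasure_eq_volume 3).symm

lemma Enumerates.paramLinear_surjective {a : Fin 4 → E3} (ha : Enumerates a K) :
    Function.Surjective (paramLinear a) :=
  (LinearMap.injective_iff_surjective_of_finrank_eq_finrank (by simp)).1 ha.paramLinear_injective

/-- Kronecker's delta on points. -/
def kron (d b : E3) : ℝ := Set.indicator {d} 1 b

@[simp] lemma kron_self (d : E3) : kron d d = 1 := by simp [kron]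

lemma kron_of_ne {d b : E3} (h : b ≠ d) : kron d b = 0 := by simp [kron, h]

lemma sum_kron {b : E3} (hb : b ∈ K) : ∑ d ∈ K, kron d b = 1 := by
  rw [Finset.sum_eq_single b (fun d _ hd => kron_of_ne hd.symm) (fun h => absurd hb h), kron_self]

/-- With `d` listed second, the first coordinate of the inverse parametrisation is the linear part
of the barycentric coordinate of `d`; the vector comes from Riesz representation. -/
lemma exists_baryGrad (hi : AffineIndependent ℝ ((↑) : K → E3)) (hc : K.card = 4) {d : E3}
    (hd : d ∈ K) : ∃ n : E3, ∀ b ∈ K, ∀ c ∈ K,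
      inner ℝ n (b - c) = kron d b - kron d c := by
  classical
  obtain ⟨x, hx, hxd⟩ := Finset.exists_mem_ne (s := K) (by omega) d
  obtain ⟨b, ha, -⟩ := exists_enumerates_cons_cons (d := 2) hi hc hx hd hxd
  set a : Fin 4 → E3 := Fin.cons x (Fin.cons d b : Fin 3 → E3) with ha'
  obtain ⟨g, hg⟩ := (paramLinear a).exists_leftInverse_of_injective
    (LinearMap.ker_eq_bot.2 ha.paramLinear_injective)
  let ℓ : E3 →ₗ[ℝ] ℝ := (EuclideanSpace.proj (0 : Fin 3)).toLinearMap ∘ₗ g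
  refine ⟨(InnerProductSpace.toDual ℝ E3).symm (LinearMap.toContinuousLinearMap ℓ), ?_⟩
  have hn : ∀ v, inner ℝ ((InnerProductSpace.toDual ℝ E3).symm
      (LinearMap.toContinuousLinearMap ℓ)) v = ℓ v := fun v => by
    rw [InnerProductSpace.toDual_symm_apply]; rfl
  have key : ∀ i, ℓ (a i - a 0) = kron d (a i) := by
    intro i
    have h0 : a 1 = d := rfl
    refine Fin.cases ?_ (fun j => ?_) i
    · have : a 0 ≠ d := hxd
      rw [sub_self, map_zero, kron_of_ne this]
    · have h1 : a j.succ - a 0 = paramLinear a (EuclideanSpace.single j 1) := by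
        rw [paramLinear_apply, Finset.sum_eq_single j]
        · simp
        · intro k _ hk; simp [hk]
        · simp
      have h2 : g (paramLinear a (EuclideanSpace.single j 1)) = EuclideanSpace.single j 1 :=
        LinearMap.congr_fun hg _
      have h3 : ℓ (a j.succ - a 0) = (EuclideanSpace.single j (1 : ℝ) : EuclideanSpace ℝ (Fin 3)) 0 := by
        rw [h1]; show g _ 0 = _; rw [h2]
      rw [h3]
      by_cases hj : j = 0
      · subst hj
        have : a (Fin.succ 0) = d := rfl
        rw [this, kron_self]; simp
      · have : a j.succ ≠ d := fun h => hj (by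
          have h4 : j.succ = 1 := ha.injective (h.trans h0.symm)
          exact Fin.succ_injective _ h4)
        rw [kron_of_ne this]; simp [Ne.symm hj]
  intro y hy z hz
  obtain ⟨i, rfl⟩ := ha.exists_eq hy
  obtain ⟨j, rfl⟩ := ha.exists_eq hz
  rw [hn, ← sub_sub_sub_cancel_right _ _ (a 0), map_sub, key, key]

open Classical in
/-- The gradient of the barycentric coordinate of the vertex `d` of the tetrahedron `K`. -/
def baryGrad (K : Finset E3) (d : E3) : E3 :=
  if h : ∃ n : E3, ∀ b ∈ K, ∀ c ∈ K, inner ℝ n (b - c) = kron d b - kron d c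
  then h.choose else 0

lemma inner_baryGrad (hi : AffineIndependent ℝ ((↑) : K → E3)) (hc : K.card = 4) {b c d : E3}
    (hd : d ∈ K) (hb : b ∈ K) (hc' : c ∈ K) :
    inner ℝ (baryGrad K d) (b - c) = kron d b - kron d c := by
  rw [baryGrad, dif_pos (exists_baryGrad hi hc hd)]
  exact (exists_baryGrad hi hc hd).choose_spec b hb c hc'

/-- The derivative in the direction `v` of the identity `x - d₀ = ∑ λ_d(x) (d - d₀)`. It is enough
to check it on the edge vectors from `d₀`, which span. -/
lemma sum_inner_baryGrad_smul (hi : AffineIndependent ℝ ((↑) : K → E3)) (hc : K.card = 4)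
    {d₀ : E3} (hd₀ : d₀ ∈ K) (v : E3) :
    ∑ d ∈ K, inner ℝ (baryGrad K d) v • (d - d₀) = v := by
  classical
  obtain ⟨x, hx, hxd⟩ := Finset.exists_mem_ne (s := K) (by omega) d₀
  obtain ⟨b, ha, -⟩ := exists_enumerates_cons_cons (d := 2) hi hc hd₀ hx hxd.symm
  set a : Fin 4 → E3 := Fin.cons d₀ (Fin.cons x b : Fin 3 → E3) with ha'
  have ha0 : a 0 = d₀ := rfl
  obtain ⟨t, rfl⟩ := ha.paramLinear_surjective v
  have key : ∀ j : Fin 3, ∑ d ∈ K, inner ℝ (baryGrad K d) (a j.succ - a 0) • (d - d₀)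
      = a j.succ - a 0 := by
    intro j
    rw [Finset.sum_eq_single (a j.succ)]
    · rw [inner_baryGrad hi hc (ha.mem _) (ha.mem _) (ha.mem _), kron_self,
        kron_of_ne (fun h => (Fin.succ_ne_zero j).symm (ha.injective h)), sub_zero,
        one_smul, ha0]
    · intro d hd hne
      rw [inner_baryGrad hi hc hd (ha.mem _) (ha.mem _), kron_of_ne hne.symm]
      by_cases h0 : a 0 = d
      · rw [← h0, ha0, sub_self, smul_zero]
      · rw [kron_of_ne h0, sub_self, zero_smul]
    · exact fun h => absurd (ha.mem _) h
  rw [paramLinear_apply]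
  simp only [inner_sum, inner_smul_right, Finset.sum_smul, mul_smul]
  rw [Finset.sum_comm]
  refine Finset.sum_congr rfl fun j _ => ?_
  rw [← Finset.smul_sum, key]

/-- Barycentric coordinates add up to one, so their gradients add up to zero. -/
lemma sum_inner_baryGrad (hi : AffineIndependent ℝ ((↑) : K → E3)) (hc : K.card = 4) (v : E3) :
    ∑ d ∈ K, inner ℝ (baryGrad K d) v = 0 := by
  classical
  obtain ⟨d₀, hd₀⟩ := Finset.card_pos.1 (by omega : 0 < K.card)
  rw [← sum_inner_baryGrad_smul hi hc hd₀ v]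
  simp only [inner_sum, inner_smul_right]
  rw [Finset.sum_comm]
  refine Finset.sum_eq_zero fun b hb => ?_
  rw [← Finset.mul_sum]
  have : ∑ d ∈ K, inner ℝ (baryGrad K d) (b - d₀) = 0 := by
    rw [Finset.sum_congr rfl fun d hd => inner_baryGrad hi hc hd hb hd₀, Finset.sum_sub_distrib]
    rw [sum_kron hb, sum_kron hd₀, sub_self]
  rw [this, mul_zero]

lemma simplexInt_sum {d : ℕ} {s : Finset E3} (hi : AffineIndependent ℝ ((↑) : s → E3))
    (hc : s.card = d + 1) {ι : Type*} (I : Finset ι) {g : ι → E3 → ℝ}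
    (hg : ∀ i ∈ I, Continuous (g i)) :
    simplexInt d s (fun x => ∑ i ∈ I, g i x) = ∑ i ∈ I, simplexInt d s (g i) := by
  obtain ⟨a, ha⟩ := exists_enumerates hi hc
  simp only [simplexInt, setAverage_eq]
  rw [integral_finsetSum I fun i h => ha.integrableOn (hg i h), Finset.smul_sum, Finset.mul_sum]

lemma simplexInt_const_mul {d : ℕ} {s : Finset E3} (c : ℝ) (g : E3 → ℝ) :
    simplexInt d s (fun x => c * g x) = c * simplexInt d s g := by
  simp only [simplexInt, setAverage_eq, integral_const_mul, smul_eq_mul]; ring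

/-- Expand `v` in the edge vectors from one vertex `d₀` and use Stokes' formula along each. The
contributions of the facet opposite to `d₀` cancel because the gradients sum to zero. Up to scaling,
`-baryGrad K d` is the outward area vector of the face opposite to `d`, so no orientation has to be
chosen. -/
lemma simplexInt_fderiv_cell [DecidableEq E3] (hi : AffineIndependent ℝ ((↑) : K → E3))
    (hc : K.card = 4) {g : E3 → ℝ} (hg : ContDiff ℝ 1 g) (v : E3) :
    simplexInt 3 K (fun x => fderiv ℝ g x v)
      = -∑ d ∈ K, inner ℝ (baryGrad K d) v * simplexInt 2 (K.erase d) g := by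
  obtain ⟨d₀, hd₀⟩ := Finset.card_pos.1 (by omega : 0 < K.card)
  have hfd : ∀ v, Continuous fun z => fderiv ℝ g z v := fun v =>
    (hg.continuous_fderiv one_ne_zero).clm_apply continuous_const
  have h1 : ∀ x, fderiv ℝ g x v = ∑ d ∈ K, inner ℝ (baryGrad K d) v * fderiv ℝ g x (d - d₀) := by
    intro x
    conv_lhs => rw [← sum_inner_baryGrad_smul hi hc hd₀ v, map_sum]
    simp only [map_smul, smul_eq_mul]
  simp only [h1]
  rw [simplexInt_sum hi hc (g := fun d x => inner ℝ (baryGrad K d) v * fderiv ℝ g x (d - d₀)) _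
    fun d _ => continuous_const.mul (hfd _)]
  simp only [simplexInt_const_mul]
  rw [Finset.sum_congr rfl fun d hd => by rw [simplexInt_fderiv hi hc hd₀ hd hg]]
  simp only [mul_sub, Finset.sum_sub_distrib, ← Finset.sum_mul]
  rw [sum_inner_baryGrad hi hc, zero_mul, zero_sub]

lemma fderiv_coord {G : E3 → E3} {x : E3} (hG : DifferentiableAt ℝ G x) (v : E3) (i : Fin 3) :
    fderiv ℝ (fun y => G y i) x v = fderiv ℝ G x v i := by
  have := ((EuclideanSpace.proj (𝕜 := ℝ) i).hasFDerivAt (x := G x)).comp x hG.hasFDerivAt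
  have h2 : HasFDerivAt (fun y => G y i) _ x := this
  rw [h2.fderiv]; rfl

/-- The divergence theorem on a tetrahedron. -/
lemma simplexInt_div [DecidableEq E3] (hi : AffineIndependent ℝ ((↑) : K → E3))
    (hc : K.card = 4) {G : E3 → E3} (hG : ContDiff ℝ 1 G) :
    simplexInt 3 K (fun x => ∑ i, fderiv ℝ (fun y => G y i) x (EuclideanSpace.single i 1))
      = -∑ d ∈ K, simplexInt 2 (K.erase d) fun x => inner ℝ (baryGrad K d) (G x) := by
  have hGi : ∀ i, ContDiff ℝ 1 fun y => G y i := contDiff_euclidean.1 hG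
  have hfd : ∀ (i : Fin 3) (v : E3), Continuous fun z => fderiv ℝ (fun y => G y i) z v := fun i v =>
    ((hGi i).continuous_fderiv one_ne_zero).clm_apply continuous_const
  rw [simplexInt_sum hi hc _ fun i _ => hfd i _]
  simp only [simplexInt_fderiv_cell hi hc (hGi _)]
  rw [Finset.sum_neg_distrib, Finset.sum_comm, neg_inj]
  refine Finset.sum_congr rfl fun d hd => ?_
  have h2 : (fun x => inner ℝ (baryGrad K d) (G x)) = fun x => ∑ i, baryGrad K d i * G x i := by
    ext x; simp [PiLp.inner_apply, mul_comm]
  rw [h2, simplexInt_sum (affineIndependent_subset hi (Finset.erase_subset d K))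
    (by rw [Finset.card_erase_of_mem hd, hc]) (g := fun i x => baryGrad K d i * G x i) _
    fun i _ => continuous_const.mul (hGi i).continuous]
  simp [simplexInt_const_mul, EuclideanSpace.inner_single_right]

lemma contDiff_cross {u v : E3 → E3} {n : WithTop ℕ∞} (hu : ContDiff ℝ n u)
    (hv : ContDiff ℝ n v) : ContDiff ℝ n fun x => cross (u x) (v x) := by
  rw [contDiff_euclidean] at *
  intro i
  fin_cases i
  · simp only [Fin.zero_eta, cross_zero_apply]
    exact ((hu 1).mul (hv 2)).sub ((hu 2).mul (hv 1))
  · simp only [Fin.mk_one, cross_one_apply]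
    exact ((hu 2).mul (hv 0)).sub ((hu 0).mul (hv 2))
  · simp only [Fin.reduceFinMk, cross_two_apply]
    exact ((hu 0).mul (hv 1)).sub ((hu 1).mul (hv 0))

lemma div_cross {u φ : E3 → E3} {x : E3} (hu : DifferentiableAt ℝ u x)
    (hφ : DifferentiableAt ℝ φ x) :
    ∑ i, fderiv ℝ (fun y => cross (u y) (φ y) i) x (EuclideanSpace.single i 1)
      = inner ℝ (vcurl u x) (φ x) - inner ℝ (u x) (vcurl φ x) := by
  have hui : ∀ i, DifferentiableAt ℝ (fun y => u y i) x := differentiableAt_euclidean.1 hu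
  have hφi : ∀ i, DifferentiableAt ℝ (fun y => φ y i) x := differentiableAt_euclidean.1 hφ
  have key : ∀ i j (v : E3), fderiv ℝ (fun y => u y i * φ y j - u y j * φ y i) x v
      = u x i * fderiv ℝ φ x v j + φ x j * fderiv ℝ u x v i
        - (u x j * fderiv ℝ φ x v i + φ x i * fderiv ℝ u x v j) := by
    intro i j v
    rw [fderiv_fun_sub ((hui i).fun_mul (hφi j)) ((hui j).fun_mul (hφi i)), fderiv_fun_mul (hui i) (hφi j),
      fderiv_fun_mul (hui j) (hφi i)]
    simp only [sub_apply, add_apply,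
      smul_apply, smul_eq_mul, fderiv_coord hu, fderiv_coord hφ]
  rw [Fin.sum_univ_three]
  simp only [cross_zero_apply, cross_one_apply, cross_two_apply, key, inner_eq, vcurl]
  simp
  ring

lemma vcurl_fieldFun (w : PolyField) (x : E3) : vcurl (fieldFun w) x = fieldFun (curlField w) x := by
  have hD : ∀ (j i : Fin 3), fderiv ℝ (fieldFun w) x (EuclideanSpace.single j 1) i
      = eval x.ofLp (pderiv j (w i)) := by
    intro j i
    rw [← fderiv_coord ((contDiff_fieldFun w (n := 1)).differentiable one_ne_zero x)]
    have : (fun y => fieldFun w y i) = polyFun (w i) := rfl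
    rw [this, fderiv_polyFun, polyFun_apply, dotPoly, Finset.sum_eq_single j]
    · simp [gradField]
    · intro k _ hk; simp [hk]
    · simp
  refine ext3 ?_ ?_ ?_ <;> simp [vcurl, hD, fieldFun_apply, curlField]

/-- Integration by parts for the curl on a tetrahedron. -/
lemma simplexInt_curl [DecidableEq E3] (hi : AffineIndependent ℝ ((↑) : K → E3))
    (hc : K.card = 4) (w : PolyField) {φ : E3 → E3} (hφ : ContDiff ℝ 1 φ) :
    simplexInt 3 K (fun x => inner ℝ (fieldFun (curlField w) x) (φ x)
        - inner ℝ (fieldFun w x) (vcurl φ x))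
      = -∑ d ∈ K, simplexInt 2 (K.erase d) fun x =>
          inner ℝ (baryGrad K d) (cross (fieldFun w x) (φ x)) := by
  rw [← simplexInt_div hi hc (contDiff_cross (contDiff_fieldFun w) hφ)]
  congr 1
  ext x
  rw [div_cross ((contDiff_fieldFun w (n := 1)).differentiable one_ne_zero x)
    (hφ.differentiable one_ne_zero x), vcurl_fieldFun]

lemma integral_cell_eq_simplexInt (hi : AffineIndependent ℝ ((↑) : K → E3)) (hc : K.card = 4) :
    ∃ c : ℝ, 0 < c ∧ ∀ g : E3 → ℝ, ∫ x in hull K, g x = c * simplexInt 3 K g := by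
  rw [volume_eq_euclideanHausdorffMeasure]
  exact integral_hull_eq_simplexInt hi hc

lemma inner_sub_eq_zero_of_mem_hull {F : Finset E3} {u : E3}
    (h : ∀ b ∈ F, ∀ c ∈ F, inner ℝ u (b - c) = 0) {x y : E3} (hx : x ∈ hull F) (hy : y ∈ hull F) :
    inner ℝ u (y - x) = 0 := by
  have hne : F.Nonempty := by
    rw [Finset.nonempty_iff_ne_empty]; rintro rfl; simp [hull] at hx
  obtain ⟨b, hb⟩ := hne
  have key : hull F ⊆ {z | inner ℝ u z = inner ℝ u b} := by
    refine convexHull_min (fun z hz => ?_) ?_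
    · have := h z hz b hb
      rw [inner_sub_right] at this
      exact sub_eq_zero.1 this
    · intro z hz z' hz' α β _ _ hαβ
      rw [Set.mem_ofPred_eq] at *
      rw [inner_add_right, inner_smul_right, inner_smul_right, hz, hz', ← add_mul, hαβ, one_mul]
  rw [inner_sub_right, key hx, key hy, sub_self]

/-- The parametrisation of a tetrahedron is onto space, so vanishing of the pull-back is vanishing
everywhere. -/
lemma Enumerates.eq_zero_of_hull {a : Fin 4 → E3} (ha : Enumerates a K) {P : Poly}
    (h : ∀ x ∈ hull K, polyFun P x = 0) : P = 0 := by
  have h0 := (ha.pull_eq_zero_iff P).2 h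
  refine MvPolynomial.funext fun x => ?_
  obtain ⟨t, ht⟩ := ha.paramLinear_surjective (WithLp.toLp 2 x - a 0)
  have h1 := eval_pull a P t.ofLp
  rw [h0, map_zero, param_eq, WithLp.toLp_ofLp, ht, add_sub_cancel] at h1
  rw [map_zero]; exact h1.symm

end Cell

/-! ### Tetrahedra: fields without tangential trace -/

section CellUniqueness

variable {K : Finset E3} {p : ℕ} {w : PolyField}

/-- The tangential trace of `w` vanishes on the faces of `K`. -/
def TraceZero (K : Finset E3) (w : PolyField) : Prop :=
  ∀ F ⊆ K, F.card = 3 → ∀ x ∈ hull F, ∀ b ∈ F, ∀ c ∈ F, inner ℝ (fieldFun w x) (b - c) = 0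

/-- Vectors orthogonal to the same triangle are parallel. -/
lemma inner_cross_eq_zero {F : Finset E3} (hi : AffineIndependent ℝ ((↑) : F → E3))
    (hc : F.card = 3) {n u : E3} (hn : ∀ b ∈ F, ∀ c ∈ F, inner ℝ n (b - c) = 0)
    (hu : ∀ b ∈ F, ∀ c ∈ F, inner ℝ u (b - c) = 0) (z : E3) : inner ℝ n (cross u z) = 0 := by
  obtain ⟨a, ha⟩ := exists_enumerates hi hc
  have h : ∀ v : E3, (∀ b ∈ F, ∀ c ∈ F, inner ℝ v (b - c) = 0) →
      ∃ c : ℝ, v = c • cross (a 1 - a 0) (a 2 - a 0) := fun v hv =>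
    exists_eq_smul_cross ha.linearIndependent_pair
      (by rw [real_inner_comm]; exact hv _ (ha.mem 1) _ (ha.mem 0))
      (by rw [real_inner_comm]; exact hv _ (ha.mem 2) _ (ha.mem 0))
  obtain ⟨α, rfl⟩ := h n hn
  obtain ⟨β, rfl⟩ := h u hu
  rw [inner_smul_left, cross_smul_left, inner_smul_right]
  have : ∀ m : E3, inner ℝ m (cross m z) = 0 := fun m => by
    rw [inner_eq, cross_zero_apply, cross_one_apply, cross_two_apply]; ring
  rw [this]; simp

lemma inner_baryGrad_face [DecidableEq E3] (hi : AffineIndependent ℝ ((↑) : K → E3))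
    (hc : K.card = 4) {d : E3} (hd : d ∈ K) :
    ∀ b ∈ K.erase d, ∀ c ∈ K.erase d, inner ℝ (baryGrad K d) (b - c) = 0 := by
  intro b hb c hc'
  rw [inner_baryGrad hi hc hd (Finset.mem_of_mem_erase hb) (Finset.mem_of_mem_erase hc'),
    kron_of_ne (Finset.ne_of_mem_erase hb), kron_of_ne (Finset.ne_of_mem_erase hc'), sub_self]

/-- `baryGrad K (a i)` is the gradient of the `i`-th barycentric coordinate. -/
lemma Enumerates.inner_baryGrad_param {a : Fin 4 → E3} (ha : Enumerates a K) (t : Fin 3 → ℝ)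
    (i : Fin 4) {b : E3} (hb : b ∈ K) :
    inner ℝ (baryGrad K (a i)) (param a t - b) = eval t (bary 3 i) - kron (a i) b := by
  have h1 : param a t - b = ∑ j, eval t (bary 3 j) • (a j - b) := by
    simp only [smul_sub, Finset.sum_sub_distrib, ← Finset.sum_smul, sum_eval_bary, one_smul,
      param_eq_sum]
  rw [h1, inner_sum]
  simp only [inner_smul_right, inner_baryGrad ha.indep_coe ha.card_eq (ha.mem _) (ha.mem _) hb,
    mul_sub, Finset.sum_sub_distrib, ← Finset.sum_mul, sum_eval_bary, one_mul]
  rw [Finset.sum_eq_single i, kron_self, mul_one]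
  · intro j _ hj; rw [kron_of_ne fun h => hj (ha.injective h), mul_zero]
  · simp

/-- On each face `w` is parallel to the area vector, so the triple product in the boundary term
vanishes. -/
lemma integral_inner_curl_of_traceZero (hi : AffineIndependent ℝ ((↑) : K → E3))
    (hc : K.card = 4) (hw : TraceZero K w) (z : PolyField) :
    ∫ x in hull K, inner ℝ (fieldFun (curlField w) x) (fieldFun z x)
      = ∫ x in hull K, inner ℝ (fieldFun w x) (fieldFun (curlField z) x) := by
  classical
  obtain ⟨c, -, hI⟩ := integral_cell_eq_simplexInt hi hc
  have h1 := simplexInt_curl hi hc w (contDiff_fieldFun z (n := 1))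
  rw [Finset.sum_eq_zero fun d hd => simplexInt_eq_zero fun x hx => ?_, neg_zero,
    simplexInt_sub hi hc (by fun_prop) (by simp only [vcurl_fieldFun]; fun_prop), sub_eq_zero] at h1
  · rw [hI, hI, h1]; simp only [vcurl_fieldFun]
  · have hc3 : (K.erase d).card = 3 := by rw [Finset.card_erase_of_mem hd, hc]
    exact inner_cross_eq_zero (affineIndependent_subset hi (Finset.erase_subset _ _)) hc3
      (inner_baryGrad_face hi hc hd)
      (fun b hb c hc' => hw _ (Finset.erase_subset _ _) hc3 x hx b hb c hc') _

/-- The divergence theorem for `φ z`, which vanishes on the boundary. -/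
lemma integral_div_eq_zero (hi : AffineIndependent ℝ ((↑) : K → E3)) (hc : K.card = 4) {φ : Poly}
    (hφ : ∀ F ⊆ K, F.card = 3 → ∀ x ∈ hull F, polyFun φ x = 0) (z : PolyField) :
    ∫ x in hull K, (inner ℝ (fieldFun (gradField φ) x) (fieldFun z x)
      + polyFun φ x * polyFun (∑ i, pderiv i (z i)) x) = 0 := by
  classical
  obtain ⟨c, -, hI⟩ := integral_cell_eq_simplexInt hi hc
  have h1 := simplexInt_div hi hc (G := fieldFun fun i => φ * z i) (contDiff_fieldFun _)
  rw [Finset.sum_eq_zero fun d hd => simplexInt_eq_zero fun x hx => ?_, neg_zero] at h1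
  · rw [hI, ← mul_zero c, ← h1]
    congr 2
    ext x
    have h2 : ∀ i : Fin 3, fderiv ℝ (fun y => fieldFun (fun i => φ * z i) y i) x
        (EuclideanSpace.single i 1) = polyFun (pderiv i (φ * z i)) x := by
      intro i
      have : (fun y => fieldFun (fun i => φ * z i) y i) = polyFun (φ * z i) := rfl
      rw [this, fderiv_polyFun, dotPoly, Finset.sum_eq_single i]
      · simp [gradField]
      · intro k _ hk; simp [hk]
      · simp
    simp only [h2]
    simp only [polyFun_apply, inner_eq, fieldFun_apply, gradField, Fin.sum_univ_three,
      pderiv_mul, map_add, map_mul]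
    ring
  · have hc3 : (K.erase d).card = 3 := by rw [Finset.card_erase_of_mem hd, hc]
    have : fieldFun (fun i => φ * z i) x = 0 := by
      ext i
      have := hφ _ (Finset.erase_subset _ _) hc3 x hx
      rw [polyFun_apply] at this
      simp [fieldFun_apply, this]
    rw [this, inner_zero_right]

/-- A field with vanishing tangential trace that is orthogonal to `RT_{p-2}` is curl free. -/
lemma curl_eq_zero_of_traceZero (hi : AffineIndependent ℝ ((↑) : K → E3)) (hc : K.card = 4)
    (hw : w ∈ polyFieldDeg p) (ht : TraceZero K w)
    (hm : ∀ z ∈ polyFieldDeg ((p : ℤ) - 3),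
      ∫ x in hull K, inner ℝ (fieldFun w x) (fieldFun z x) = 0) : curlField w = 0 := by
  classical
  obtain ⟨a, ha⟩ := exists_enumerates hi hc
  obtain ⟨lift, hl, hld⟩ := ha.exists_lift
  set n : Fin 3 → E3 := fun i => baryGrad K (a i.succ) with hn
  set W : Fin 3 → MvPolynomial (Fin 3) ℝ := fun j => pull a (dotPoly w (a j.succ - a 0)) with hW
  have hinj := ha.injective
  -- For `j ≠ i` the edge vector `a j.succ - a 0` is tangent to the face on which the coordinate `X
  -- i` vanishes.
  have hWd : ∀ i j, j ≠ i → (X i : MvPolynomial (Fin 3) ℝ) ∣ W j := fun i j hij =>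
    ha.bary_dvd_pull (i := i.succ) fun x hx => by
      rw [polyFun_dotPoly]
      refine ht _ (Finset.erase_subset _ _)
        (by rw [Finset.card_erase_of_mem (ha.mem _), hc]) x hx _ ?_ _ ?_
      · exact Finset.mem_erase.2 ⟨fun h => hij (Fin.succ_injective _ (hinj h)), ha.mem _⟩
      · exact Finset.mem_erase.2 ⟨fun h => (Fin.succ_ne_zero i).symm (hinj h), ha.mem _⟩
  -- Differentiation along that face preserves divisibility by its coordinate.
  have hWd' : ∀ i j k, j ≠ i → k ≠ i → (X i : MvPolynomial (Fin 3) ℝ) ∣ pderiv k (W j) := by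
    intro i j k hij hik
    obtain ⟨Q, hQ⟩ := hWd i j hij
    rw [hQ, pderiv_mul, pderiv_X_of_ne hik.symm, zero_mul, zero_add]
    exact Dvd.intro _ rfl
  have hVd : ∀ i, (X i : MvPolynomial (Fin 3) ℝ) ∣ pull a (dotPoly (curlField w) (n i)) := by
    have key : ∀ i j k : Fin 3, j ≠ i → k ≠ i → j ≠ k →
        (X i : MvPolynomial (Fin 3) ℝ) ∣ pull a (dotPoly (curlField w) (n i)) := by
      intro i j k hij hik hjk
      have hlin : LinearIndependent ℝ ![a j.succ - a 0, a k.succ - a 0] := by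
        have := ha.linearIndependent.comp ![j, k] (by
          intro x y hxy
          fin_cases x <;> fin_cases y <;> simp_all)
        convert this using 1
        ext x; fin_cases x <;> rfl
      -- `n i` is normal to the two remaining edge vectors, hence a multiple of their cross product,
      -- so the curl along `n i` consists of the derivatives just treated.
      have horth : ∀ l : Fin 3, l ≠ i → inner ℝ (a l.succ - a 0) (n i) = 0 := fun l hli => by
        rw [real_inner_comm, hn, inner_baryGrad hi hc (ha.mem _) (ha.mem _) (ha.mem _),
          kron_of_ne fun h => hli (Fin.succ_injective _ (hinj h)),
          kron_of_ne fun h => (Fin.succ_ne_zero i).symm (hinj h), sub_self]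
      obtain ⟨c, hc⟩ := exists_eq_smul_cross hlin (horth j hij) (horth k hik)
      rw [hc, dotPoly_smul, dotPoly_curlField_cross, map_mul, map_sub, ← pderiv_pull, ← pderiv_pull]
      exact ((hWd' i k j hik hij).sub (hWd' i j k hij hik)).mul_left _
    intro i
    fin_cases i
    exacts [key 0 1 2 (by decide) (by decide) (by decide),
      key 1 0 2 (by decide) (by decide) (by decide), key 2 0 1 (by decide) (by decide) (by decide)]
  choose q hq using hVd
  have hqd : ∀ i, q i ∈ degLE (Fin 3) ((p : ℤ) - 2) := fun i => by
    have h1 := pull_mem_degLE a (dotPoly_mem (curlField_mem hw) (n i))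
    rw [hq] at h1
    have := mem_degLE_of_mul_mem (by simp) h1
    convert this using 2; ring
  -- The test field is chosen so that the integrand becomes `∑ t i * q i ^ 2`, nonnegative on the
  -- tetrahedron. Its degree is `p - 2`, and so its curl has the admissible degree `p - 3`.
  set z : PolyField := fun k => ∑ i, C (n i k) * lift (q i) with hz
  have hzd : z ∈ polyFieldDeg ((p : ℤ) - 2) := mem_polyFieldDeg.2 fun k =>
    Submodule.sum_mem _ fun i _ => C_mul_mem_degLE _ (hld _ _ (hqd i))
  have hvz : ∀ t, inner ℝ (fieldFun (curlField w) (param a t)) (fieldFun z (param a t))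
      = ∑ i, t i * eval t (q i) ^ 2 := by
    intro t
    have h1 : ∀ i, polyFun (lift (q i)) (param a t) = eval t (q i) := fun i => by
      rw [← eval_pull, hl]
    have h2 : ∀ i, inner ℝ (fieldFun (curlField w) (param a t)) (n i) = t i * eval t (q i) :=
      fun i => by rw [← polyFun_dotPoly, ← eval_pull, hq, map_mul, eval_X]
    have h3 : fieldFun z (param a t) = ∑ i, eval t (q i) • n i := by
      ext k
      simp only [fieldFun_apply, hz, map_sum, map_mul, eval_C, WithLp.ofLp_sum, Finset.sum_apply,
        PiLp.smul_apply, smul_eq_mul, ← h1, polyFun_apply]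
      exact Finset.sum_congr rfl fun i _ => mul_comm _ _
    rw [h3, inner_sum]
    refine Finset.sum_congr rfl fun i _ => ?_
    rw [inner_smul_right, h2]; ring
  have hInt : ∫ x in hull K, inner ℝ (fieldFun (curlField w) x) (fieldFun z x) = 0 := by
    rw [integral_inner_curl_of_traceZero hi hc ht]
    refine hm _ ?_
    convert curlField_mem hzd using 2; ring
  rw [volume_eq_euclideanHausdorffMeasure] at hInt
  have h0 := ha.eq_zero_of_integral_eq_zero (by fun_prop) (fun x hx => by
    rw [← ha.image_eq] at hx
    obtain ⟨t, ht, rfl⟩ := hx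
    rw [hvz]
    exact Finset.sum_nonneg fun i _ => mul_nonneg (ht.1 i) (sq_nonneg _)) hInt
  have hq0 : ∀ i, q i = 0 := by
    intro i
    refine funext_set (fun _ => Set.Ioo (0 : ℝ) (1 / ((3 : ℕ) + 1)))
      (fun _ => Set.Ioo_infinite (by norm_num)) fun t ht => ?_
    have h1 := h0 _ (ha.param_mem (pi_Ioo_subset_refSimplex 3 ht))
    rw [hvz, Finset.sum_eq_zero_iff_of_nonneg fun i _ =>
      mul_nonneg (ht i trivial).1.le (sq_nonneg _)] at h1
    have h2 := h1 i (Finset.mem_univ i)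
    rw [mul_eq_zero] at h2
    rw [map_zero]
    exact pow_eq_zero_iff (two_ne_zero) |>.1 (h2.resolve_left (ht i trivial).1.ne')
  have hv0 : ∀ x ∈ hull K, fieldFun (curlField w) x = 0 := by
    intro x hx
    -- A vector is recovered from its products with the barycentric gradients. Taking `a 0` as base
    -- point removes the one gradient that is not among the `n i`.
    rw [← sum_inner_baryGrad_smul hi hc (ha.mem 0) (fieldFun (curlField w) x)]
    refine Finset.sum_eq_zero fun d hd => ?_
    obtain ⟨i, rfl⟩ := ha.exists_eq hd
    refine Fin.cases (by simp) (fun j => ?_) i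
    have h1 := (ha.pull_eq_zero_iff _).1 (by rw [hq j, hq0 j, mul_zero]) x hx
    rw [polyFun_dotPoly, real_inner_comm] at h1
    rw [h1, zero_smul]
  ext1 k
  exact ha.eq_zero_of_hull fun x hx => congrArg (fun v : E3 => v k) (hv0 x hx)

/-- A field with vanishing tangential trace that is orthogonal to `RT_{p-2}` vanishes. -/
lemma eq_zero_of_traceZero (hi : AffineIndependent ℝ ((↑) : K → E3)) (hc : K.card = 4)
    (hw : w ∈ polyFieldDeg p) (ht : TraceZero K w)
    (hm : ∀ z ∈ raviartThomasOn K ((p : ℤ) - 2),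
      ∫ x in hull K, inner ℝ (fieldFun w x) (z x) = 0) : w = 0 := by
  classical
  obtain ⟨a, ha⟩ := exists_enumerates hi hc
  have hm' : ∀ z ∈ raviartThomas ((p : ℤ) - 2),
      ∫ x in hull K, inner ℝ (fieldFun w x) (fieldFun z x) = 0 := fun z hz => by
    rw [← hm _ ⟨z, hz, rfl⟩]
    exact setIntegral_hull_congr fun x hx => by
      show _ = inner ℝ _ ((hull K).indicator (fieldFun z) x)
      rw [Set.indicator_of_mem hx]
  have hcurl := curl_eq_zero_of_traceZero hi hc hw ht fun z hz =>
    hm' z (Submodule.mem_sup_left (by convert hz using 2; ring))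
  have h01 : pderiv 0 (w 1) = pderiv 1 (w 0) := sub_eq_zero.1 (congrFun hcurl 2)
  have h12 : pderiv 1 (w 2) = pderiv 2 (w 1) := sub_eq_zero.1 (congrFun hcurl 0)
  have h20 : pderiv 2 (w 0) = pderiv 0 (w 2) := sub_eq_zero.1 (congrFun hcurl 1)
  obtain ⟨φ₁, hφd₁, hφ₁⟩ := exists_potential (W := w) (k := p) (mem_polyFieldDeg.1 hw)
    (by simp only [Fin.forall_fin_succ, Fin.succ_zero_eq_one, Fin.succ_one_eq_two,
          IsEmpty.forall_iff, h01, h12, h20]; simp)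
  set φ := φ₁ - C (eval 0 (pull a φ₁)) with hφdef
  have hφd : φ ∈ polyDeg ((p : ℤ) + 1) :=
    Submodule.sub_mem _ hφd₁ (C_mem_degLE _ (by omega))
  have hgrad : gradField φ = w := by
    ext1 i; rw [gradField, hφdef, map_sub, pderiv_C, sub_zero, hφ₁]
  have hb : ∀ i, bary 3 i ∣ pull a φ := by
    intro i
    rw [hφdef, map_sub, pull_C]
    refine bary_dvd_sub_C (fun i x hx hxi y hy hyi z hz hzi => ?_) i
    have hg1 : gradField φ₁ = w := funext hφ₁
    -- The derivative of the potential along a facet is a tangential component of `w`, which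
    -- vanishes there.
    have h1 : ∑ k, (y k - x k) * eval z (pderiv k (pull a φ₁))
        = inner ℝ (fieldFun w (param a z)) (param a y - param a x) := by
      have h2 : param a y - param a x = ∑ k, (y k - x k) • (a k.succ - a 0) := by
        simp only [param, sub_smul, Finset.sum_sub_distrib]; abel
      rw [h2, inner_sum]
      refine Finset.sum_congr rfl fun k _ => ?_
      rw [inner_smul_right, pderiv_pull, eval_pull, polyFun_dotPoly, hg1]
    rw [h1]
    exact inner_sub_eq_zero_of_mem_hull
      (ht _ (Finset.erase_subset _ _) (by rw [Finset.card_erase_of_mem (ha.mem i), hc]) _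
        (ha.param_mem_hull_erase hz hzi))
      (ha.param_mem_hull_erase hx hxi) (ha.param_mem_hull_erase hy hyi)
  have hφF : ∀ F ⊆ K, F.card = 3 → ∀ x ∈ hull F, polyFun φ x = 0 := by
    intro F hFK hF x hx
    obtain ⟨d, hd, hdF⟩ : ∃ d ∈ K, d ∉ F := by
      by_contra! h
      have := Finset.card_le_card h
      omega
    obtain ⟨i, rfl⟩ := ha.exists_eq hd
    obtain ⟨t, ht, rfl⟩ : x ∈ param a '' refSimplex 3 := by
      rw [ha.image_eq]; exact convexHull_mono (by exact_mod_cast hFK) hx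
    obtain ⟨Q, hQ⟩ := hb i
    rw [← eval_pull, hQ, map_mul]
    have : eval t (bary 3 i) = 0 := by
      obtain ⟨b, hb⟩ := Finset.card_pos.1 (by omega : 0 < F.card)
      have hne : ∀ y ∈ F, y ≠ a i := fun y hy h => hdF (h ▸ hy)
      have h1 := ha.inner_baryGrad_param t i (hFK hb)
      rw [kron_of_ne (hne b hb), sub_zero] at h1
      rw [← h1]
      refine inner_sub_eq_zero_of_mem_hull (fun y hy z hz => ?_) (subset_convexHull ℝ _ hb) hx
      rw [inner_baryGrad hi hc hd (hFK hy) (hFK hz), kron_of_ne (hne y hy), kron_of_ne (hne z hz),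
        sub_self]
    rw [this, zero_mul]
  -- Four simple zeros leave test polynomials of degree `(p + 1) - 4 = p - 3`. Each is the
  -- divergence of some `x R` in the Raviart-Thomas space, and integration by parts turns the
  -- pairing with `φ` into an interior moment of `w`.
  have hφ0 := ha.eq_zero_of_orthogonal hφd 1 (fun i => by rw [pow_one]; exact hb i) fun Q hQ => by
    have hQ' : Q ∈ degLE (Fin 3) ((p : ℤ) - 3) := by
      rw [← polyDeg_eq]; convert hQ using 2; push_cast; ring
    obtain ⟨R, hR, hdiv⟩ := exists_sum_pderiv_X_mul hQ'
    have h1 := integral_div_eq_zero hi hc hφF (positionMul R)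
    have h2 := hm' (positionMul R) (Submodule.mem_sup_right
      ⟨R, by rw [show (p : ℤ) - 2 - 1 = p - 3 by ring]; exact hR, rfl⟩)
    rw [hgrad, show (∑ i, pderiv i (positionMul R i)) = Q from hdiv] at h1
    rw [volume_eq_euclideanHausdorffMeasure] at h1 h2
    rw [integral_add (ha.integrableOn (by fun_prop)) (ha.integrableOn (by fun_prop)), h2,
      zero_add] at h1
    exact h1
  have hφz : φ = 0 := ha.eq_zero_of_hull hφ0
  rw [← hgrad, hφz]
  ext1 i; simp [gradField]

end CellUniqueness

/-! ### Dimensions -/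

section Dimensions

/-- Writing the degree as `n - (d + 1)` makes the binomial coefficient correct also for the negative
degrees reached, where both sides are zero. -/
lemma finite_and_finrank_degLE (d n : ℕ) :
    Module.Finite ℝ (degLE (Fin (d + 1)) ((n : ℤ) - (d + 1))) ∧
      Module.finrank ℝ (degLE (Fin (d + 1)) ((n : ℤ) - (d + 1))) = n.choose (d + 1) := by
  classical
  let S : Set (Fin (d + 1) →₀ ℕ) := {m | (m.degree : ℤ) ≤ (n : ℤ) - (d + 1)}
  let b : Module.Basis S ℝ (degLE (Fin (d + 1)) ((n : ℤ) - (d + 1))) :=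
    basisRestrictSupport ℝ S
  have hdeg : ∀ (k : ℕ) (m : Fin (d + 1) →₀ ℕ),
      m ∈ Finset.univ.finsuppAntidiag k ↔ m.degree = k := by
    intro k m
    rw [Finset.mem_finsuppAntidiag, Finsupp.degree_eq_sum]; simp
  by_cases hn : n < d + 1
  · have hS : IsEmpty S := ⟨fun m => by have := m.2; simp only [S, Set.mem_ofPred_eq] at this; omega⟩
    refine ⟨Module.Finite.of_basis b, ?_⟩
    rw [Module.finrank_eq_nat_card_basis b, Nat.card_of_isEmpty, Nat.choose_eq_zero_of_lt hn]
  · obtain ⟨k, rfl⟩ : ∃ k, n = k + d + 1 := ⟨n - (d + 1), by omega⟩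
    let T : Finset (Fin (d + 1) →₀ ℕ) :=
      (Finset.range (k + 1)).biUnion fun j => Finset.univ.finsuppAntidiag j
    have hST : S = T := by
      ext m
      simp only [S, T, Finset.coe_biUnion, Set.mem_iUnion, Finset.mem_coe, hdeg, Finset.mem_range,
        Set.mem_ofPred_eq, exists_prop, exists_eq_right']
      push_cast
      omega
    have hfin : Finite S := by rw [hST]; exact Finset.finite_toSet T
    refine ⟨Module.Finite.of_basis b, ?_⟩
    rw [Module.finrank_eq_nat_card_basis b, hST, Nat.card_coe_set_eq, Set.ncard_coe_finset,
      Finset.card_biUnion]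
    -- The hockey-stick identity sums the numbers of monomials of each exact degree.
    · rw [← Nat.sum_range_add_choose]
      refine Finset.sum_congr rfl fun j _ => ?_
      rw [Finset.card_finsuppAntidiag_nat_eq_choose, Finset.card_univ, Fintype.card_fin]
      rw [show d + 1 + j - 1 = j + d by omega, Nat.choose_symm_add]
    · intro i _ j _ hij
      rw [Function.onFun, Finset.disjoint_left]
      intro m hi hj
      rw [hdeg] at hi hj
      exact hij (hi.symm.trans hj)

instance finite_degLE (d : ℕ) (k : ℤ) : Module.Finite ℝ (degLE (Fin (d + 1)) k) := by
  obtain ⟨n, hn⟩ : ∃ n : ℕ, k ≤ (n : ℤ) - (d + 1) := ⟨(k + (d + 1)).toNat, by omega⟩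
  have := (finite_and_finrank_degLE d n).1
  exact Submodule.finiteDimensional_of_le (degLE_mono hn)

lemma finrank_degLE (d n : ℕ) {k : ℤ} (hk : k = (n : ℤ) - (d + 1)) :
    Module.finrank ℝ (degLE (Fin (d + 1)) k) = n.choose (d + 1) := by
  rw [hk]; exact (finite_and_finrank_degLE d n).2

instance finite_polyDeg (k : ℤ) : Module.Finite ℝ (polyDeg k) := finite_degLE 2 k

lemma finrank_polyDeg (n : ℕ) {k : ℤ} (hk : k = (n : ℤ) - 3) :
    Module.finrank ℝ (polyDeg k) = n.choose 3 :=
  finrank_degLE 2 n (by rw [hk]; norm_num)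

/-- `[P_k]³` as a product. -/
def polyFieldDegEquiv (k : ℤ) : polyFieldDeg k ≃ₗ[ℝ] (Fin 3 → polyDeg k) where
  toFun w i := ⟨w.1 i, mem_polyFieldDeg.1 w.2 i⟩
  invFun w := ⟨fun i => (w i).1, mem_polyFieldDeg.2 fun i => (w i).2⟩
  map_add' _ _ := rfl
  map_smul' _ _ := rfl
  left_inv _ := rfl
  right_inv _ := rfl

instance finite_polyFieldDeg (k : ℤ) : Module.Finite ℝ (polyFieldDeg k) :=
  Module.Finite.equiv (polyFieldDegEquiv k).symm

lemma finrank_polyFieldDeg (k : ℤ) :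
    Module.finrank ℝ (polyFieldDeg k) = 3 * Module.finrank ℝ (polyDeg k) := by
  rw [(polyFieldDegEquiv k).finrank_eq, Module.finrank_pi_fintype]; simp

/-- Test spaces are bounded by parametrising them. Upper bounds suffice, since injectivity of the
degrees of freedom provides the reverse inequality. -/
lemma finite_and_finrank_le_of_le_range {V W : Type*} [AddCommGroup V] [Module ℝ V]
    [AddCommGroup W] [Module ℝ W] [Module.Finite ℝ V] {S : Submodule ℝ W} (f : V →ₗ[ℝ] W)
    (h : S ≤ LinearMap.range f) :
    Module.Finite ℝ S ∧ Module.finrank ℝ S ≤ Module.finrank ℝ V :=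
  ⟨Submodule.finiteDimensional_of_le h, (Submodule.finrank_mono h).trans (LinearMap.finrank_range_le f)⟩

variable {d : ℕ} {a : Fin (d + 2) → E3} {s : Finset E3}

lemma Enumerates.polyFun_lift_pull (h : Enumerates a s)
    {lift : MvPolynomial (Fin (d + 1)) ℝ →ₐ[ℝ] Poly} (hl : ∀ Q, pull a (lift Q) = Q) (P : Poly)
    {x : E3} (hx : x ∈ hull s) : polyFun (lift (pull a P)) x = polyFun P x := by
  have := (h.pull_eq_zero_iff (lift (pull a P) - P)).1 (by rw [map_sub, hl, sub_self]) x hx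
  rwa [map_sub, Pi.sub_apply, sub_eq_zero] at this

lemma Enumerates.finrank_polyOn_le (h : Enumerates a s) (n : ℕ) {k : ℤ}
    (hk : k = (n : ℤ) - (d + 1)) :
    Module.Finite ℝ (polyOn s k) ∧ Module.finrank ℝ (polyOn s k) ≤ n.choose (d + 1) := by
  obtain ⟨lift, hl, hld⟩ := h.exists_lift
  have h1 : polyOn s k ≤ LinearMap.range ((restrictTo ℝ (hull s) ∘ₗ polyFun) ∘ₗ
      lift.toLinearMap ∘ₗ (degLE (Fin (d + 1)) k).subtype) := by
    rintro _ ⟨P, hP, rfl⟩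
    refine ⟨⟨pull a P, pull_mem_degLE a hP⟩, ?_⟩
    refine Set.indicator_congr fun x hx => ?_
    exact h.polyFun_lift_pull hl P hx
  have := finite_and_finrank_le_of_le_range _ h1
  rwa [finrank_degLE d n hk] at this

lemma Enumerates.finrank_polyFieldOn_le (h : Enumerates a s) (n : ℕ) {k : ℤ}
    (hk : k = (n : ℤ) - (d + 1)) :
    Module.Finite ℝ (polyFieldOn s k) ∧
      Module.finrank ℝ (polyFieldOn s k) ≤ 3 * n.choose (d + 1) := by
  obtain ⟨lift, hl, hld⟩ := h.exists_lift
  let Λ : (Fin 3 → degLE (Fin (d + 1)) k) →ₗ[ℝ] PolyField :=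
    LinearMap.pi fun i => lift.toLinearMap ∘ₗ (degLE (Fin (d + 1)) k).subtype ∘ₗ LinearMap.proj i
  have h1 : polyFieldOn s k ≤ LinearMap.range ((restrictTo E3 (hull s) ∘ₗ fieldFun) ∘ₗ Λ) := by
    rintro _ ⟨w, hw, rfl⟩
    refine ⟨fun i => ⟨pull a (w i), pull_mem_degLE a (mem_polyFieldDeg.1 hw i)⟩, ?_⟩
    refine Set.indicator_congr fun x hx => ?_
    ext i
    exact h.polyFun_lift_pull hl (w i) hx
  have := finite_and_finrank_le_of_le_range _ h1
  rw [Module.finrank_pi_fintype] at this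
  simpa [finrank_degLE d n hk] using this

/-- An affine function is determined by its values at the vertices. -/
lemma eq_sum_bary {d : ℕ} {P : MvPolynomial (Fin d) ℝ} (hP : P ∈ degLE (Fin d) 1) :
    P = ∑ i, C (eval (refVertex d i) P) * bary d i := by
  classical
  let f : MvPolynomial (Fin d) ℝ →ₗ[ℝ] MvPolynomial (Fin d) ℝ :=
    { toFun := fun P => ∑ i, C (eval (refVertex d i) P) * bary d i
      map_add' := fun P Q => by simp only [map_add, add_mul, Finset.sum_add_distrib]
      map_smul' := fun c P => by
        simp only [smul_eval, RingHom.id_apply, Finset.smul_sum, C_mul', smul_smul] }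
  show P = f P
  rw [P.as_sum, map_sum]
  refine Finset.sum_congr rfl fun m hm => ?_
  have hm1 : m.degree ≤ 1 := by exact_mod_cast mem_degLE.1 hP m hm
  have hsum : ∑ i, bary d i = 1 := by simp [Fin.sum_univ_succ]
  have h1 : (monomial m (coeff m P) : MvPolynomial (Fin d) ℝ) = coeff m P • monomial m 1 := by
    rw [smul_monomial, smul_eq_mul, mul_one]
  rw [h1, map_smul]
  congr 1
  rcases Nat.lt_or_ge 0 m.degree with h0 | h0
  · obtain ⟨j, hj⟩ : ∃ j, m j ≠ 0 := by
      by_contra! h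
      have : m = 0 := Finsupp.ext h
      simp [this] at h0
    have hmj : m = Finsupp.single j 1 := by
      have h2 : m j + ∑ i ∈ Finset.univ.erase j, m i = m.degree := by
        rw [Finsupp.degree_eq_sum, Finset.add_sum_erase _ _ (Finset.mem_univ j)]
      ext i
      by_cases hij : i = j
      · subst hij; simp; omega
      · have h3 : m i ≤ ∑ i ∈ Finset.univ.erase j, m i :=
          Finset.single_le_sum (fun _ _ => Nat.zero_le _) (by simp [hij])
        rw [Finsupp.single_eq_of_ne hij]; omega
    have hX : (monomial m (1 : ℝ) : MvPolynomial (Fin d) ℝ) = X j := by rw [hmj]; rfl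
    rw [hX]
    show X j = ∑ i, C (eval (refVertex d i) (X j)) * bary d i
    have h4 : ∀ i, eval (refVertex d i) (X j : MvPolynomial (Fin d) ℝ)
        = if j.succ = i then 1 else 0 := fun i => by
      rw [← bary_succ, eval_bary_refVertex]
    simp only [h4, apply_ite C, C_1, C_0, ite_mul, one_mul, zero_mul]
    simp
  · have hm0 : m = 0 := by
      rw [← Finsupp.degree_eq_zero_iff]; omega
    rw [hm0]
    show (1 : MvPolynomial (Fin d) ℝ) = ∑ i, C (eval (refVertex d i) 1) * bary d i
    simp only [map_one, one_mul, hsum]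

/-- Affine functions are determined by their vertex values. Hence the squared bubble on the face
does not depend on the extensions `L`, and the fields in `curlBubbleOn` are parametrised linearly by
`ψ` alone. -/
lemma Enumerates.pull_barycentric {f : Finset E3} {a : Fin 3 → E3} (ha : Enumerates a f)
    {L : E3 → Poly} (hL : IsBarycentric f L) (i : Fin 3) : pull a (L (a i)) = bary 2 i := by
  rw [eq_sum_bary (pull_mem_degLE a (hL _ (ha.mem i)).1), Finset.sum_eq_single i]
  · rw [eval_pull, param_refVertex, (hL _ (ha.mem i)).2.1]; simp
  · intro j _ hj
    rw [eval_pull, param_refVertex,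
      (hL _ (ha.mem i)).2.2 _ (ha.mem j) fun h => hj (ha.injective h)]
    simp
  · simp

/-- The surface curl only depends on the values on the face. -/
lemma cross_grad_congr {f : Finset E3} {ν : E3} (hν : IsFaceNormal f ν) {a : Fin 3 → E3}
    (ha : Enumerates a f) {P Q : Poly} (h : pull a P = pull a Q) {x : E3} (hx : x ∈ hull f) :
    cross (fieldFun (gradField P) x) ν = cross (fieldFun (gradField Q) x) ν := by
  rw [← sub_eq_zero, ← cross_sub_left]
  refine cross_eq_zero_of_inner_eq_zero hν ha fun j => ?_
  have h0 : pull a (dotPoly (gradField P) (a j.succ - a 0)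
      - dotPoly (gradField Q) (a j.succ - a 0)) = 0 := by
    rw [map_sub, ← pderiv_pull, ← pderiv_pull, h, sub_self]
  have := (ha.pull_eq_zero_iff _).1 h0 x hx
  rwa [map_sub, Pi.sub_apply, polyFun_dotPoly, polyFun_dotPoly, ← inner_sub_left] at this

/-- The linear map `P ↦ ∇P × ν`, restricted to a set. -/
def surfCurl (s : Finset E3) (ν : E3) : Poly →ₗ[ℝ] (E3 → E3) where
  toFun P := (hull s).indicator fun x => cross (fieldFun (gradField P) x) ν
  map_add' P Q := by
    rw [← Set.indicator_add']
    congr 1; ext1 x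
    have : gradField (P + Q) = gradField P + gradField Q := by ext1 i; simp [gradField]
    rw [this, map_add, Pi.add_apply, Pi.add_apply, cross_add_left]
  map_smul' c P := by
    rw [RingHom.id_apply]
    refine Eq.trans ?_ (Set.indicator_const_smul _ c _)
    congr 1; ext1 x
    have : gradField (c • P) = c • gradField P := by ext1 i; simp [gradField]
    rw [this, map_smul, Pi.smul_apply, cross_smul_left]

lemma finrank_curlBubbleOn_le {f : Finset E3} (hi : AffineIndependent ℝ ((↑) : f → E3))
    (hc : f.card = 3) {ν : E3} (hν : IsFaceNormal f ν) (n : ℕ) {k : ℤ} (hk : k = (n : ℤ) - 2) :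
    Module.Finite ℝ (curlBubbleOn f ν k) ∧
      Module.finrank ℝ (curlBubbleOn f ν k) ≤ n.choose 2 := by
  obtain ⟨a, ha⟩ := exists_enumerates hi hc
  obtain ⟨lift, hl, hld⟩ := ha.exists_lift
  let M : degLE (Fin 2) k →ₗ[ℝ] Poly :=
    LinearMap.mulRight ℝ (∏ i, lift (bary 2 i) ^ 2) ∘ₗ lift.toLinearMap ∘ₗ
      (degLE (Fin 2) k).subtype
  have h1 : curlBubbleOn f ν k ≤ LinearMap.range (surfCurl f ν ∘ₗ M) := by
    refine Submodule.span_le.2 ?_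
    rintro _ ⟨ψ, hψ, L, hL, rfl⟩
    refine ⟨⟨pull a ψ, pull_mem_degLE a hψ⟩, Set.indicator_congr fun x hx => ?_⟩
    refine cross_grad_congr hν ha ?_ hx
    have hf : f = Finset.univ.map ⟨a, ha.injective⟩ := by
      rw [← Finset.coe_inj, ← ha.range_eq]; simp
    show pull a (lift (pull a ψ) * ∏ i, lift (bary 2 i) ^ 2) = _
    rw [map_mul, map_mul, hl, map_prod, map_prod]
    congr 1
    rw [hf, Finset.prod_map]
    refine Finset.prod_congr rfl fun i _ => ?_
    rw [map_pow, map_pow, hl]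
    exact congrArg (· ^ 2) (ha.pull_barycentric hL i).symm
  have := finite_and_finrank_le_of_le_range _ h1
  rwa [finrank_degLE 1 n (by rw [hk]; norm_num)] at this

/-- The intersection of the two summands contains `x P_{k-2}`. Subtracting its dimension from that
of `x P_{k-1}` leaves `m.choose 2` by Pascal's rule. -/
lemma finrank_raviartThomas_le (m : ℕ) {k : ℤ} (hk : k = (m : ℤ) - 1) :
    Module.Finite ℝ (raviartThomas k) ∧
      Module.finrank ℝ (raviartThomas k) ≤ 3 * (m + 1).choose 3 + m.choose 2 := by
  set A := polyFieldDeg (k - 1) with hA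
  set B := (polyDeg (k - 1)).map positionMul with hB
  have hinj : Function.Injective positionMul := by
    intro P Q h
    have h0 : (X 0 : Poly) * P = X 0 * Q := congrFun h 0
    exact mul_left_cancel₀ (X_ne_zero 0) h0
  have hfr : ∀ l, Module.finrank ℝ ((polyDeg l).map positionMul)
      = Module.finrank ℝ (polyDeg l) := fun l =>
    (Submodule.equivMapOfInjective _ hinj _).finrank_eq.symm
  have hsub : (polyDeg (k - 2)).map positionMul ≤ A ⊓ B := by
    refine le_inf ?_ (Submodule.map_mono (degLE_mono (by omega)))
    rintro _ ⟨P, hP, rfl⟩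
    rw [hA, mem_polyFieldDeg]
    intro i
    have := mul_mem_degLE (X_mem_degLE i) hP
    rw [show (1 : ℤ) + (k - 2) = k - 1 by ring] at this
    exact this
  have h1 := Submodule.finrank_sup_add_finrank_inf_eq A B
  have h2 := Submodule.finrank_mono hsub
  rw [hfr, finrank_polyDeg m (by rw [hk]; ring)] at h2
  rw [hB, hfr, ← hB, hA, finrank_polyFieldDeg, ← hA,
    finrank_polyDeg (m + 1) (by rw [hk]; push_cast; ring)] at h1
  have h3 := Nat.choose_succ_succ m 2
  refine ⟨Submodule.finite_sup A B, ?_⟩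
  show Module.finrank ℝ (A ⊔ B : Submodule ℝ PolyField) ≤ _
  simp only [Nat.succ_eq_add_one, Nat.reduceAdd] at h3
  omega

lemma finrank_raviartThomasOn_le (K : Finset E3) (m : ℕ) {k : ℤ} (hk : k = (m : ℤ) - 1) :
    Module.Finite ℝ (raviartThomasOn K k) ∧
      Module.finrank ℝ (raviartThomasOn K k) ≤ 3 * (m + 1).choose 3 + m.choose 2 := by
  obtain ⟨h1, h2⟩ := finrank_raviartThomas_le m hk
  exact ⟨Module.Finite.map _ _, (Submodule.finrank_map_le _ _).trans h2⟩

end Dimensions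

/-! ### Moments as linear maps -/

section Moments

/-- Restrictions of continuous functions to a simplex. -/
def contOn (s : Finset E3) (F : Type) [NormedAddCommGroup F] [NormedSpace ℝ F] :
    Submodule ℝ (E3 → F) where
  carrier := {q | ∃ g, Continuous g ∧ q = (hull s).indicator g}
  zero_mem' := ⟨0, continuous_zero, by simp⟩
  add_mem' := by
    rintro _ _ ⟨g, hg, rfl⟩ ⟨g', hg', rfl⟩
    exact ⟨g + g', hg.add hg', (Set.indicator_add' _ _ _).symm⟩
  smul_mem' := by
    rintro c _ ⟨g, hg, rfl⟩
    exact ⟨c • g, hg.const_smul c, (Set.indicator_const_smul _ c g).symm⟩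

variable {s : Finset E3} {k : ℤ}

lemma polyOn_le_contOn : polyOn s k ≤ contOn s ℝ := by
  rintro _ ⟨P, -, rfl⟩
  exact ⟨polyFun P, by fun_prop, rfl⟩

lemma polyFieldOn_le_contOn : polyFieldOn s k ≤ contOn s E3 := by
  rintro _ ⟨w, -, rfl⟩
  exact ⟨fieldFun w, by fun_prop, rfl⟩

lemma raviartThomasOn_le_contOn : raviartThomasOn s k ≤ contOn s E3 := by
  rintro _ ⟨w, -, rfl⟩
  exact ⟨fieldFun w, by fun_prop, rfl⟩

lemma meanZeroOn_le_polyOn : meanZeroOn s k ≤ polyOn s k :=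
  Submodule.span_le.2 fun _ hq => hq.1

lemma meanZeroOn_le_contOn : meanZeroOn s k ≤ contOn s ℝ :=
  meanZeroOn_le_polyOn.trans polyOn_le_contOn

lemma curlBubbleOn_le_contOn {ν : E3} : curlBubbleOn s ν k ≤ contOn s E3 := by
  refine Submodule.span_le.2 ?_
  rintro _ ⟨ψ, -, L, -, rfl⟩
  exact ⟨_, by fun_prop, rfl⟩

variable {F : Type} [NormedAddCommGroup F] [InnerProductSpace ℝ F]

lemma integrableOn_inner_contOn {μ : Measure E3} (hμ : μ (hull s) ≠ ⊤) {g q : E3 → F}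
    (hg : Continuous g) (hq : q ∈ contOn s F) :
    IntegrableOn (fun x => inner ℝ (g x) (q x)) (hull s) μ := by
  obtain ⟨g', hg', rfl⟩ := hq
  refine (integrableOn_hull_of_measure_ne_top hμ (hg.inner hg')).congr_fun (fun x hx => ?_)
    (measurableSet_hull s)
  simp only [Set.indicator_of_mem hx]

/-- The moments of a field depending linearly on `w` against a space of test functions. -/
def momentMap {μ : Measure E3} (hμ : μ (hull s) ≠ ⊤) {S : Submodule ℝ (E3 → F)}
    (hS : S ≤ contOn s F) (h : PolyField →ₗ[ℝ] (E3 → F)) (hh : ∀ w, Continuous (h w)) :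
    PolyField →ₗ[ℝ] Module.Dual ℝ S :=
  LinearMap.mk₂ ℝ (fun w (q : S) => ∫ x in hull s, inner ℝ (h w x) (q.1 x) ∂μ)
    (fun w w' q => by
      simp only [map_add, Pi.add_apply, inner_add_left]
      exact integral_add (integrableOn_inner_contOn hμ (hh w) (hS q.2))
        (integrableOn_inner_contOn hμ (hh w') (hS q.2)))
    (fun c w q => by
      simp only [map_smul, Pi.smul_apply, inner_smul_left, conj_trivial, integral_const_mul,
        smul_eq_mul])
    (fun w q q' => by
      simp only [Submodule.coe_add, Pi.add_apply, inner_add_right]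
      exact integral_add (integrableOn_inner_contOn hμ (hh w) (hS q.2))
        (integrableOn_inner_contOn hμ (hh w) (hS q'.2)))
    (fun c w q => by
      simp only [Submodule.coe_smul, Pi.smul_apply, inner_smul_right, integral_const_mul,
        smul_eq_mul])

lemma measure_hull_ne_top {d : ℕ} (hi : AffineIndependent ℝ ((↑) : s → E3))
    (hc : s.card = d + 1) : (μHE[d] : Measure E3) (hull s) ≠ ⊤ := by
  obtain ⟨a, ha⟩ := exists_enumerates hi hc
  exact ha.measure_hull_ne_top

/-- The partial derivative as a linear map. -/
def partialLin (i : Fin 3) : PolyField →ₗ[ℝ] PolyField where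
  toFun := partialField i
  map_add' := partialField_add i
  map_smul' := partialField_smul i

/-- The curl as a linear map. -/
def curlLin : PolyField →ₗ[ℝ] PolyField where
  toFun := curlField
  map_add' := curlField_add
  map_smul' := curlField_smul

/-- The component of the curl in the direction `ν`, as a linear map. -/
def curlDot (ν : E3) : PolyField →ₗ[ℝ] (E3 → ℝ) where
  toFun w x := inner ℝ (fieldFun (curlField w) x) ν
  map_add' w z := by ext x; simp [curlField_add, inner_add_left]
  map_smul' c w := by ext x; simp [curlField_smul, inner_smul_left]

/-- The cross product with `ν`, as a linear map. -/
def crossLin (ν : E3) : PolyField →ₗ[ℝ] (E3 → E3) where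
  toFun w x := cross (fieldFun w x) ν
  map_add' w z := by ext1 x; simp [cross_add_left]
  map_smul' c w := by ext1 x; simp [cross_smul_left]

lemma continuous_curlDot (ν : E3) (w : PolyField) : Continuous (curlDot ν w) := by
  show Continuous fun x => inner ℝ (fieldFun (curlField w) x) ν
  fun_prop

lemma continuous_crossLin (ν : E3) (w : PolyField) : Continuous (crossLin ν w) := by
  show Continuous fun x => cross (fieldFun w x) ν
  fun_prop

lemma real_inner_eq_mul (a b : ℝ) : inner ℝ a b = a * b := by simp [mul_comm]

/-- Edge moments of the field. -/
def edgeMoment (hi : AffineIndependent ℝ ((↑) : s → E3)) (hc : s.card = 2) (k : ℤ) :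
    PolyField →ₗ[ℝ] Module.Dual ℝ (polyFieldOn s k) :=
  momentMap (measure_hull_ne_top hi hc) polyFieldOn_le_contOn fieldFun continuous_fieldFun

/-- Edge moments of a component of the curl. -/
def edgeCurlMoment (hi : AffineIndependent ℝ ((↑) : s → E3)) (hc : s.card = 2) (ν : E3) (k : ℤ) :
    PolyField →ₗ[ℝ] Module.Dual ℝ (polyOn s k) :=
  momentMap (measure_hull_ne_top hi hc) polyOn_le_contOn (curlDot ν) (continuous_curlDot ν)

/-- Face moments of the tangential trace. -/
def faceMoment (hi : AffineIndependent ℝ ((↑) : s → E3)) (hc : s.card = 3) (ν : E3) (k : ℤ) :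
    PolyField →ₗ[ℝ] Module.Dual ℝ (curlBubbleOn s ν k) :=
  momentMap (measure_hull_ne_top hi hc) curlBubbleOn_le_contOn (crossLin ν) (continuous_crossLin ν)

/-- Face moments of the normal component of the curl. -/
def faceCurlMoment (hi : AffineIndependent ℝ ((↑) : s → E3)) (hc : s.card = 3) (ν : E3) (k : ℤ) :
    PolyField →ₗ[ℝ] Module.Dual ℝ (meanZeroOn s k) :=
  momentMap (measure_hull_ne_top hi hc) meanZeroOn_le_contOn (curlDot ν) (continuous_curlDot ν)

/-- Interior moments. -/
def interiorMoment (s : Finset E3) (k : ℤ) :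
    PolyField →ₗ[ℝ] Module.Dual ℝ (raviartThomasOn s k) :=
  momentMap (μ := volume) (isCompact_hull s).measure_lt_top.ne raviartThomasOn_le_contOn fieldFun
    continuous_fieldFun

lemma edgeMoment_apply (hi : AffineIndependent ℝ ((↑) : s → E3)) (hc : s.card = 2)
    (w : PolyField) (q : polyFieldOn s k) : edgeMoment hi hc k w q
      = ∫ x in hull s, inner ℝ (fieldFun w x) (q.1 x) ∂μHE[1] := rfl

lemma edgeCurlMoment_apply (hi : AffineIndependent ℝ ((↑) : s → E3)) (hc : s.card = 2) (ν : E3)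
    (w : PolyField) (q : polyOn s k) : edgeCurlMoment hi hc ν k w q
      = ∫ x in hull s, inner ℝ (fieldFun (curlField w) x) ν * q.1 x ∂μHE[1] :=
  integral_congr_ae (Filter.Eventually.of_forall fun _ => real_inner_eq_mul _ _)

lemma faceMoment_apply (hi : AffineIndependent ℝ ((↑) : s → E3)) (hc : s.card = 3) (ν : E3)
    (w : PolyField) (q : curlBubbleOn s ν k) : faceMoment hi hc ν k w q
      = ∫ x in hull s, inner ℝ (cross (fieldFun w x) ν) (q.1 x) ∂μHE[2] := rfl

lemma faceCurlMoment_apply (hi : AffineIndependent ℝ ((↑) : s → E3)) (hc : s.card = 3) (ν : E3)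
    (w : PolyField) (q : meanZeroOn s k) : faceCurlMoment hi hc ν k w q
      = ∫ x in hull s, inner ℝ (fieldFun (curlField w) x) ν * q.1 x ∂μHE[2] :=
  integral_congr_ae (Filter.Eventually.of_forall fun _ => real_inner_eq_mul _ _)

lemma interiorMoment_apply (w : PolyField) (q : raviartThomasOn s k) : interiorMoment s k w q
      = ∫ x in hull s, inner ℝ (fieldFun w x) (q.1 x) := rfl

/-- The constant `1` lies in `polyOn f k`, as `k ≥ 0`, but has nonzero integral, so the mean-zero
space is proper and loses at least one dimension. -/
lemma finrank_meanZeroOn_le {f : Finset E3} (hi : AffineIndependent ℝ ((↑) : f → E3))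
    (hc : f.card = 3) (n : ℕ) {k : ℤ} (hk : k = (n : ℤ) - 2) (hk0 : 0 ≤ k) :
    Module.Finite ℝ (meanZeroOn f k) ∧ Module.finrank ℝ (meanZeroOn f k) + 1 ≤ n.choose 2 := by
  obtain ⟨a, ha⟩ := exists_enumerates hi hc
  obtain ⟨h1, h2⟩ := ha.finrank_polyOn_le n (k := k) (by rw [hk]; norm_num)
  refine ⟨Submodule.finiteDimensional_of_le meanZeroOn_le_polyOn, ?_⟩
  refine (Nat.succ_le_of_lt (Submodule.finrank_lt_finrank_of_lt
    (lt_of_le_of_ne meanZeroOn_le_polyOn fun heq => ?_))).trans h2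
  have hInt : ∀ q ∈ meanZeroOn f k, ∫ x in hull f, q x ∂μHE[2] = 0 := by
    intro q hq
    have hio : ∀ q ∈ meanZeroOn f k, IntegrableOn q (hull f) (μHE[2] : Measure E3) := by
      intro q hq
      have := integrableOn_inner_contOn ha.measure_hull_ne_top (continuous_const (y := (1 : ℝ)))
        (meanZeroOn_le_contOn hq)
      simpa [real_inner_eq_mul] using this
    refine Submodule.span_induction (p := fun q _ => ∫ x in hull f, q x ∂μHE[2] = 0)
      (fun q hq => hq.2) (by simp) (fun q q' hq hq' h h' => ?_) (fun c q _ h => ?_) hq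
    · simp only [Pi.add_apply]
      rw [integral_add (hio q hq) (hio q' hq'), h, h', add_zero]
    · simp only [Pi.smul_apply]
      rw [integral_smul, h, smul_zero]
  have h1m : (hull f).indicator (polyFun 1) ∈ meanZeroOn f k := by
    rw [heq]; exact indicator_mem_polyOn (one_mem_degLE hk0)
  have h0 := hInt _ h1m
  rw [setIntegral_hull_congr (g' := fun _ => 1)
    fun x hx => by rw [Set.indicator_of_mem hx]; simp [polyFun_apply], setIntegral_const] at h0
  simp only [smul_eq_mul, mul_one] at h0
  exact (ENNReal.toReal_pos ha.measure_hull_ne_zero ha.measure_hull_ne_top).ne' h0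

end Moments

/-! ### Comparison of degrees of freedom and uniqueness -/

section Unique

variable {p : ℕ} {νe : Finset E3 → Fin 2 → E3} {νf : Finset E3 → E3} {K K' : Finset E3}
  {w w' : PolyField} {d : DofValues p νf}

/-- Since `K` and `K'` may differ, one statement serves two purposes: uniqueness on a tetrahedron
for `K = K'`, and continuity across tetrahedra otherwise. The same holds for the next two lemmas. -/
lemma HasDofs.edge_eq (h : HasDofs νe νf K w d) (h' : HasDofs νe νf K' w' d)
    (hw : w ∈ polyFieldDeg p) (hw' : w' ∈ polyFieldDeg p) {e : Finset E3}
    (hi : AffineIndependent ℝ ((↑) : e → E3)) (he : e ⊆ K) (he' : e ⊆ K') (hc : e.card = 2) :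
    ∀ x ∈ hull e, fieldFun (w - w') x = 0 := by
  refine field_eq_zero_on_edge hi hc (Submodule.sub_mem _ hw hw') (fun a ha => ?_)
    (fun a ha i => ?_) fun q hq => ?_
  · rw [map_sub, Pi.sub_apply, h.value a (he ha), h'.value a (he' ha), sub_self]
  · have := map_sub (partialLin i) w w'
    change partialField i (w - w') = partialField i w - partialField i w' at this
    rw [this, map_sub, Pi.sub_apply, h.deriv a (he ha), h'.deriv a (he' ha), sub_self]
  · have h1 := h.edge e he hc ⟨q, hq⟩
    have h2 := h'.edge e he' hc ⟨q, hq⟩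
    rw [← edgeMoment_apply hi hc] at h1 h2
    have := edgeMoment_apply hi hc (w - w') ⟨q, hq⟩
    rw [← this, map_sub, LinearMap.sub_apply, h1, h2, sub_self]

lemma HasDofs.edge_curl_eq (h : HasDofs νe νf K w d) (h' : HasDofs νe νf K' w' d)
    (hw : w ∈ polyFieldDeg p) (hw' : w' ∈ polyFieldDeg p) {e : Finset E3}
    (hi : AffineIndependent ℝ ((↑) : e → E3)) (he : e ⊆ K) (he' : e ⊆ K') (hc : e.card = 2)
    (hν : IsEdgeNormals e (νe e)) :
    ∀ x ∈ hull e, ∀ ν' : E3, (∀ a ∈ e, ∀ b ∈ e, inner ℝ (a - b) ν' = 0) →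
      inner ℝ (fieldFun (curlField (w - w')) x) ν' = 0 := by
  refine curl_normal_eq_zero_on_edge hi hc (Submodule.sub_mem _ hw hw')
    (fun a ha i => ?_) hν fun i q hq => ?_
  · have := map_sub (partialLin i) w w'
    change partialField i (w - w') = partialField i w - partialField i w' at this
    rw [this, map_sub, Pi.sub_apply, h.deriv a (he ha), h'.deriv a (he' ha), sub_self]
  · have h1 := h.edgeCurl e he hc i ⟨q, hq⟩
    have h2 := h'.edgeCurl e he' hc i ⟨q, hq⟩
    rw [← edgeCurlMoment_apply hi hc] at h1 h2
    have := edgeCurlMoment_apply hi hc (νe e i) (w - w') ⟨q, hq⟩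
    rw [← this, map_sub, LinearMap.sub_apply, h1, h2, sub_self]

/-- Fields with the same degrees of freedom on a face have the same tangential trace there. -/
lemma HasDofs.trace_eq (hp : 4 ≤ p) (h : HasDofs νe νf K w d) (h' : HasDofs νe νf K' w' d)
    (hw : w ∈ polyFieldDeg p) (hw' : w' ∈ polyFieldDeg p) {f : Finset E3}
    (hi : AffineIndependent ℝ ((↑) : f → E3)) (hf : f ⊆ K) (hf' : f ⊆ K') (hc : f.card = 3)
    (hνe : ∀ e ⊆ f, e.card = 2 → IsEdgeNormals e (νe e)) (hν : IsFaceNormal f (νf f)) :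
    ∀ x ∈ hull f, cross (fieldFun (w - w') x) (νf f) = 0 := by
  refine trace_eq_zero_on_face hp hi hc hν (Submodule.sub_mem _ hw hw')
    (fun e he hec => h.edge_eq h' hw hw' (affineIndependent_subset hi he) (he.trans hf)
      (he.trans hf') hec)
    (fun e he hec => h.edge_curl_eq h' hw hw' (affineIndependent_subset hi he) (he.trans hf)
      (he.trans hf') hec (hνe e he hec)) (fun q hq => ?_) fun q hq => ?_
  · have h1 := h.face f hf hc ⟨q, hq⟩
    have h2 := h'.face f hf' hc ⟨q, hq⟩
    rw [← faceMoment_apply hi hc] at h1 h2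
    have := faceMoment_apply hi hc (νf f) (w - w') ⟨q, hq⟩
    rw [← this, map_sub, LinearMap.sub_apply, h1, h2, sub_self]
  · have h1 := h.faceCurl f hf hc ⟨q, hq⟩
    have h2 := h'.faceCurl f hf' hc ⟨q, hq⟩
    rw [← faceCurlMoment_apply hi hc] at h1 h2
    have := faceCurlMoment_apply hi hc (νf f) (w - w') ⟨q, hq⟩
    rw [← this, map_sub, LinearMap.sub_apply, h1, h2, sub_self]

lemma HasDofs.unique (hp : 4 ≤ p) (hi : AffineIndependent ℝ ((↑) : K → E3)) (hc : K.card = 4)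
    (hνe : ∀ e ⊆ K, e.card = 2 → IsEdgeNormals e (νe e))
    (hνf : ∀ f ⊆ K, f.card = 3 → IsFaceNormal f (νf f))
    (h : HasDofs νe νf K w d) (h' : HasDofs νe νf K w' d)
    (hw : w ∈ polyFieldDeg p) (hw' : w' ∈ polyFieldDeg p) : w = w' := by
  rw [← sub_eq_zero]
  refine eq_zero_of_traceZero hi hc (Submodule.sub_mem _ hw hw') (fun F hF hFc x hx b hb c hc => ?_)
    fun z hz => ?_
  · have h0 := h.trace_eq hp h' hw hw' (affineIndependent_subset hi hF) hF hF hFc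
      (fun e he => hνe e (he.trans hF)) (hνf F hF hFc) x hx
    exact inner_eq_zero_of_cross_eq_zero (hνf F hF hFc).ne_zero h0 ((hνf F hF hFc).2 b hb c hc)
  · have h1 := h.interior ⟨z, hz⟩
    have h2 := h'.interior ⟨z, hz⟩
    rw [← interiorMoment_apply] at h1 h2
    have := interiorMoment_apply (w - w') ⟨z, hz⟩
    rw [← this, map_sub, LinearMap.sub_apply, h1, h2, sub_self]

end Unique

/-! ### Unisolvence on a tetrahedron -/

section Unisolvence

variable {p : ℕ} {νe : Finset E3 → Fin 2 → E3} {νf : Finset E3 → E3} {K : Finset E3}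

/-- The space of values of the degrees of freedom on the tetrahedron `K`. -/
abbrev DofSpace (p : ℕ) (νf : Finset E3 → E3) (K : Finset E3) : Type :=
  (K → E3) × (K → Fin 3 → E3) ×
    (∀ e : K.powersetCard 2, Module.Dual ℝ (polyFieldOn e.1 ((p : ℤ) - 4))) ×
    (∀ e : K.powersetCard 2, Fin 2 → Module.Dual ℝ (polyOn e.1 ((p : ℤ) - 3))) ×
    (∀ f : K.powersetCard 3, Module.Dual ℝ (curlBubbleOn f.1 (νf f.1) ((p : ℤ) - 5))) ×
    (∀ f : K.powersetCard 3, Module.Dual ℝ (meanZeroOn f.1 ((p : ℤ) - 4))) ×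
    Module.Dual ℝ (raviartThomasOn K ((p : ℤ) - 2))

lemma affineIndependent_powersetCard {n : ℕ} (hi : AffineIndependent ℝ ((↑) : K → E3))
    (s : K.powersetCard n) : AffineIndependent ℝ ((↑) : s.1 → E3) :=
  affineIndependent_subset hi (Finset.mem_powersetCard.1 s.2).1

/-- The degrees of freedom on `K` as a linear map. -/
def dofMap (p : ℕ) (νe : Finset E3 → Fin 2 → E3) (νf : Finset E3 → E3)
    (hi : AffineIndependent ℝ ((↑) : K → E3)) : PolyField →ₗ[ℝ] DofSpace p νf K :=
  (LinearMap.pi fun a : K => LinearMap.proj a.1 ∘ₗ fieldFun).prod <|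
  (LinearMap.pi fun a : K => LinearMap.pi fun i =>
    LinearMap.proj a.1 ∘ₗ fieldFun ∘ₗ partialLin i).prod <|
  (LinearMap.pi fun e : K.powersetCard 2 => edgeMoment (affineIndependent_powersetCard hi e)
    (Finset.mem_powersetCard.1 e.2).2 _).prod <|
  (LinearMap.pi fun e : K.powersetCard 2 => LinearMap.pi fun i =>
    edgeCurlMoment (affineIndependent_powersetCard hi e)
      (Finset.mem_powersetCard.1 e.2).2 (νe e.1 i) _).prod <|
  (LinearMap.pi fun f : K.powersetCard 3 => faceMoment (affineIndependent_powersetCard hi f)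
    (Finset.mem_powersetCard.1 f.2).2 (νf f.1) _).prod <|
  (LinearMap.pi fun f : K.powersetCard 3 => faceCurlMoment (affineIndependent_powersetCard hi f)
    (Finset.mem_powersetCard.1 f.2).2 (νf f.1) _).prod <|
  interiorMoment K _

/-- The values on `K` of a global prescription. -/
def DofValues.toLocal (d : DofValues p νf) (K : Finset E3) : DofSpace p νf K :=
  (fun a => d.value a.1, fun a i => d.deriv a.1 i, fun e => d.edge e.1,
    fun e i => d.edgeCurl e.1 i, fun f => d.face f.1, fun f => d.faceCurl f.1, d.interior K)

lemma hasDofs_of_dofMap_eq (hi : AffineIndependent ℝ ((↑) : K → E3)) {w : PolyField}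
    {d : DofValues p νf} (h : dofMap p νe νf hi w = d.toLocal K) : HasDofs νe νf K w d := by
  obtain ⟨h1, h2⟩ := Prod.mk.inj h
  obtain ⟨h2, h3⟩ := Prod.mk.inj h2
  obtain ⟨h3, h4⟩ := Prod.mk.inj h3
  obtain ⟨h4, h5⟩ := Prod.mk.inj h4
  obtain ⟨h5, h6⟩ := Prod.mk.inj h5
  obtain ⟨h6, h7⟩ := Prod.mk.inj h6
  refine ⟨fun a ha => congrFun h1 ⟨a, ha⟩, fun a ha i => congrFun (congrFun h2 ⟨a, ha⟩) i,
    fun e he hc q => ?_, fun e he hc i q => ?_, fun f hf hc q => ?_, fun f hf hc q => ?_,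
    fun z => ?_⟩
  · exact LinearMap.congr_fun (congrFun h3 ⟨e, Finset.mem_powersetCard.2 ⟨he, hc⟩⟩) q
  · rw [← edgeCurlMoment_apply (affineIndependent_subset hi he) hc]
    exact LinearMap.congr_fun
      (congrFun (congrFun h4 ⟨e, Finset.mem_powersetCard.2 ⟨he, hc⟩⟩) i) q
  · exact LinearMap.congr_fun (congrFun h5 ⟨f, Finset.mem_powersetCard.2 ⟨hf, hc⟩⟩) q
  · rw [← faceCurlMoment_apply (affineIndependent_subset hi hf) hc]
    exact LinearMap.congr_fun (congrFun h6 ⟨f, Finset.mem_powersetCard.2 ⟨hf, hc⟩⟩) q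
  · exact LinearMap.congr_fun h7 z

lemma finite_and_finrank_dual_le {V : Type*} [AddCommGroup V] [Module ℝ V] {n : ℕ}
    (h : Module.Finite ℝ V ∧ Module.finrank ℝ V ≤ n) :
    Module.Finite ℝ (Module.Dual ℝ V) ∧ Module.finrank ℝ (Module.Dual ℝ V) ≤ n := by
  have := h.1
  exact ⟨inferInstance, (Subspace.dual_finrank_eq).trans_le h.2⟩

lemma finite_and_finrank_pi_le {ι : Type*} [Fintype ι] {V : ι → Type*}
    [∀ i, AddCommGroup (V i)] [∀ i, Module ℝ (V i)] {n : ℕ}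
    (h : ∀ i, Module.Finite ℝ (V i) ∧ Module.finrank ℝ (V i) ≤ n) :
    Module.Finite ℝ (∀ i, V i) ∧ Module.finrank ℝ (∀ i, V i) ≤ Fintype.card ι * n := by
  have := fun i => (h i).1
  refine ⟨inferInstance, ?_⟩
  rw [Module.finrank_pi_fintype, Fintype.card, ← smul_eq_mul]
  exact Finset.sum_le_card_nsmul _ _ _ fun i _ => (h i).2

lemma finite_and_finrank_prod_le {V W : Type*} [AddCommGroup V] [Module ℝ V]
    [AddCommGroup W] [Module ℝ W] {m n : ℕ}
    (h : Module.Finite ℝ V ∧ Module.finrank ℝ V ≤ m)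
    (h' : Module.Finite ℝ W ∧ Module.finrank ℝ W ≤ n) :
    Module.Finite ℝ (V × W) ∧ Module.finrank ℝ (V × W) ≤ m + n := by
  have := h.1
  have := h'.1
  refine ⟨inferInstance, ?_⟩
  rw [Module.finrank_prod]
  exact add_le_add h.2 h'.2

/-- With `p = m + 4` the seven families contribute at most `12`, `36`, `18 (m + 1)`, `12 (m + 2)`,
`4 C(m + 1, 2)`, `4 (C(m + 2, 2) - 1)` and `3 C(m + 4, 3) + C(m + 3, 2)`; these add up to `3 C(m +
7, 3)`. -/
lemma finrank_dofSpace_le (hp : 4 ≤ p) (hi : AffineIndependent ℝ ((↑) : K → E3))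
    (hc : K.card = 4) (hνf : ∀ f ⊆ K, f.card = 3 → IsFaceNormal f (νf f)) :
    Module.Finite ℝ (DofSpace p νf K) ∧
      Module.finrank ℝ (DofSpace p νf K) ≤ 3 * (p + 3).choose 3 := by
  obtain ⟨m, rfl⟩ := Nat.exists_eq_add_of_le' hp
  have hE : Module.Finite ℝ E3 ∧ Module.finrank ℝ E3 ≤ 3 :=
    ⟨inferInstance, by simp⟩
  have h1 := finite_and_finrank_pi_le fun _ : K => hE
  have h2 := finite_and_finrank_pi_le fun _ : K => finite_and_finrank_pi_le fun _ : Fin 3 => hE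
  have h3 := finite_and_finrank_pi_le fun e : K.powersetCard 2 =>
    finite_and_finrank_dual_le <| by
      obtain ⟨a, ha⟩ := exists_enumerates (affineIndependent_powersetCard hi e)
        (Finset.mem_powersetCard.1 e.2).2
      exact ha.finrank_polyFieldOn_le (m + 1) (k := ((m + 4 : ℕ) : ℤ) - 4) (by push_cast; ring)
  have h4 := finite_and_finrank_pi_le fun e : K.powersetCard 2 =>
    finite_and_finrank_pi_le fun _ : Fin 2 => finite_and_finrank_dual_le
      (V := polyOn e.1 (((m + 4 : ℕ) : ℤ) - 3)) (n := (m + 2).choose 1) <| by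
      obtain ⟨a, ha⟩ := exists_enumerates (affineIndependent_powersetCard hi e)
        (Finset.mem_powersetCard.1 e.2).2
      exact ha.finrank_polyOn_le (m + 2) (k := ((m + 4 : ℕ) : ℤ) - 3) (by push_cast; ring)
  have h5 := finite_and_finrank_pi_le fun f : K.powersetCard 3 =>
    finite_and_finrank_dual_le <|
      finrank_curlBubbleOn_le (affineIndependent_powersetCard hi f)
        (Finset.mem_powersetCard.1 f.2).2
        (hνf f.1 (Finset.mem_powersetCard.1 f.2).1 (Finset.mem_powersetCard.1 f.2).2)
        (m + 1) (k := ((m + 4 : ℕ) : ℤ) - 5) (by push_cast; ring)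
  have h6 := finite_and_finrank_pi_le fun f : K.powersetCard 3 =>
    finite_and_finrank_dual_le <| by
      have := finrank_meanZeroOn_le (affineIndependent_powersetCard hi f)
        (Finset.mem_powersetCard.1 f.2).2
        (m + 2) (k := ((m + 4 : ℕ) : ℤ) - 4) (by push_cast; ring) (by push_cast; omega)
      exact ⟨this.1, Nat.le_sub_of_add_le this.2⟩
  have h7 := finite_and_finrank_dual_le <|
    finrank_raviartThomasOn_le K (m + 3) (k := ((m + 4 : ℕ) : ℤ) - 2) (by push_cast; ring)
  have h := finite_and_finrank_prod_le h1 <| finite_and_finrank_prod_le h2 <|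
    finite_and_finrank_prod_le h3 <| finite_and_finrank_prod_le h4 <|
    finite_and_finrank_prod_le h5 <| finite_and_finrank_prod_le h6 h7
  refine ⟨h.1, h.2.trans ?_⟩
  have c2 : Nat.choose 4 2 = 6 := rfl
  have c3 : Nat.choose 4 3 = 4 := rfl
  simp only [Fintype.card_coe, Finset.card_powersetCard, hc, Fintype.card_fin, c2, c3]
  -- Pascal's rule reduces everything to the binomial coefficients of `m`, in which the inequality
  -- is linear.
  simp only [Nat.choose_succ_succ', Nat.choose_zero_right,
    Nat.choose_one_right, Nat.reduceAdd]
  omega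

/-- Existence for the degrees of freedom on a tetrahedron. -/
lemma exists_hasDofs (hp : 4 ≤ p) (hi : AffineIndependent ℝ ((↑) : K → E3)) (hc : K.card = 4)
    (hνe : ∀ e ⊆ K, e.card = 2 → IsEdgeNormals e (νe e))
    (hνf : ∀ f ⊆ K, f.card = 3 → IsFaceNormal f (νf f)) (d : DofValues p νf) :
    ∃ w ∈ polyFieldDeg p, HasDofs νe νf K w d := by
  obtain ⟨hfin, hle⟩ := finrank_dofSpace_le (p := p) hp hi hc hνf
  have hfin' := finite_polyFieldDeg (k := (p : ℤ))
  let Φ : polyFieldDeg (p : ℤ) →ₗ[ℝ] DofSpace p νf K :=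
    dofMap p νe νf hi ∘ₗ (polyFieldDeg (p : ℤ)).subtype
  have hinj : Function.Injective Φ := by
    rw [← LinearMap.ker_eq_bot, LinearMap.ker_eq_bot']
    intro w hw
    let z : DofValues p νf := ⟨0, 0, fun _ => 0, fun _ => 0, fun _ => 0, fun _ => 0, fun _ => 0⟩
    refine Subtype.ext (HasDofs.unique (d := z) hp hi hc hνe hνf (hasDofs_of_dofMap_eq hi hw)
      (hasDofs_of_dofMap_eq hi ?_) w.2 (Submodule.zero_mem _))
    exact (map_zero (dofMap p νe νf hi) :)
  -- Injectivity bounds the polynomial dimension by that of the space of values, and the count gives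
  -- the other inequality.
  have hrank : Module.finrank ℝ (polyFieldDeg (p : ℤ)) = Module.finrank ℝ (DofSpace p νf K) := by
    refine le_antisymm (LinearMap.finrank_le_finrank_of_injective hinj) (hle.trans_eq ?_)
    rw [finrank_polyFieldDeg, finrank_polyDeg (p + 3) (by push_cast; ring)]
  obtain ⟨w, hw⟩ := (LinearMap.injective_iff_surjective_of_finrank_eq_finrank hrank).1 hinj
    (d.toLocal K)
  exact ⟨w.1, w.2, hasDofs_of_dofMap_eq hi hw⟩

end Unisolvence

/-! ### Barycentric coordinates of a tetrahedron -/

section Barycentric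

variable {K S : Finset E3} {d b x y : E3}

/-- The barycentric coordinate of the vertex `d` of the tetrahedron `K`. -/
def baryCoord (K : Finset E3) (d x : E3) : ℝ := 1 + inner ℝ (baryGrad K d) (x - d)

@[fun_prop]
lemma continuous_baryCoord (K : Finset E3) (d : E3) : Continuous (baryCoord K d) := by
  unfold baryCoord; fun_prop

lemma baryCoord_add (K : Finset E3) (d x v : E3) :
    baryCoord K d (x + v) = baryCoord K d x + inner ℝ (baryGrad K d) v := by
  rw [baryCoord, baryCoord, add_sub_right_comm, inner_add_right, add_assoc]

lemma baryCoord_lineMap (K : Finset E3) (d x y : E3) (ε : ℝ) :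
    baryCoord K d (x + ε • (y - x)) = (1 - ε) * baryCoord K d x + ε * baryCoord K d y := by
  have : baryCoord K d y = baryCoord K d x + inner ℝ (baryGrad K d) (y - x) := by
    rw [← baryCoord_add, add_sub_cancel]
  rw [baryCoord_add, inner_smul_right, this]; ring

lemma baryCoord_eq_zero_of_mem_hull (h : ∀ b ∈ S, baryCoord K d b = 0) (hx : x ∈ hull S) :
    baryCoord K d x = 0 := by
  refine convexHull_min (t := {x | baryCoord K d x = 0}) (fun b hb => h b hb) ?_ hx
  intro z hz z' hz' α β _ _ hαβ
  obtain rfl : α = 1 - β := by linarith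
  have : (1 - β) • z + β • z' = z + β • (z' - z) := by module
  rw [Set.mem_ofPred_eq] at *
  rw [this, baryCoord_lineMap, hz, hz']; simp

lemma baryCoord_nonneg_of_mem_hull (h : ∀ b ∈ S, 0 ≤ baryCoord K d b) (hx : x ∈ hull S) :
    0 ≤ baryCoord K d x := by
  refine convexHull_min (t := {x | 0 ≤ baryCoord K d x}) (fun b hb => h b hb) ?_ hx
  intro z hz z' hz' α β hα hβ hαβ
  obtain rfl : α = 1 - β := by linarith
  have : (1 - β) • z + β • z' = z + β • (z' - z) := by module
  rw [Set.mem_ofPred_eq] at *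
  rw [this, baryCoord_lineMap]; positivity

/-- The point `x` lies in the relative interior of the face of `K` opposite to `d`. -/
def IsInnerPoint (K : Finset E3) (d x : E3) : Prop :=
  baryCoord K d x = 0 ∧ ∀ b ∈ K, b ≠ d → 0 < baryCoord K b x


lemma baryCoord_vertex (hi : AffineIndependent ℝ ((↑) : K → E3)) (hc : K.card = 4)
    (hd : d ∈ K) (hb : b ∈ K) : baryCoord K d b = kron d b := by
  rw [baryCoord, inner_baryGrad hi hc hd hb hd, kron_self]; ring

lemma baryCoord_eq (hi : AffineIndependent ℝ ((↑) : K → E3)) (hc : K.card = 4)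
    (hd : d ∈ K) (hb : b ∈ K) (x : E3) :
    baryCoord K d x = kron d b + inner ℝ (baryGrad K d) (x - b) := by
  rw [← baryCoord_vertex hi hc hd hb, ← baryCoord_add, add_sub_cancel]

lemma sum_baryCoord (hi : AffineIndependent ℝ ((↑) : K → E3)) (hc : K.card = 4)
    (x : E3) : ∑ d ∈ K, baryCoord K d x = 1 := by
  obtain ⟨b, hb⟩ := Finset.card_pos.1 (by omega : 0 < K.card)
  rw [Finset.sum_congr rfl fun d hd => baryCoord_eq hi hc hd hb x, Finset.sum_add_distrib,
    sum_kron hb, sum_inner_baryGrad hi hc, add_zero]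

lemma sum_baryCoord_smul (hi : AffineIndependent ℝ ((↑) : K → E3)) (hc : K.card = 4)
    (x : E3) : ∑ d ∈ K, baryCoord K d x • d = x := by
  obtain ⟨b, hb⟩ := Finset.card_pos.1 (by omega : 0 < K.card)
  have h : ∑ d ∈ K, baryCoord K d x • (d - b) = x - b := by
    rw [← sum_inner_baryGrad_smul hi hc hb (x - b)]
    refine Finset.sum_congr rfl fun d hd => ?_
    rw [baryCoord_eq hi hc hd hb, add_smul]
    by_cases hbd : b = d
    · rw [hbd, sub_self, smul_zero, smul_zero, add_zero]
    · rw [kron_of_ne hbd, zero_smul, zero_add]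
  simp only [smul_sub, Finset.sum_sub_distrib, ← Finset.sum_smul, sum_baryCoord hi hc,
    one_smul] at h
  exact sub_left_injective h

lemma baryCoord_nonneg (hi : AffineIndependent ℝ ((↑) : K → E3)) (hc : K.card = 4)
    (hd : d ∈ K) (hx : x ∈ hull K) : 0 ≤ baryCoord K d x :=
  baryCoord_nonneg_of_mem_hull (fun b hb => by
    rw [baryCoord_vertex hi hc hd hb]; by_cases h : b = d
    · rw [h, kron_self]; exact zero_le_one
    · rw [kron_of_ne h]) hx

lemma baryCoord_eq_zero (hi : AffineIndependent ℝ ((↑) : K → E3)) (hc : K.card = 4)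
    (hd : d ∈ K) (hS : S ⊆ K) (hdS : d ∉ S) (hx : x ∈ hull S) :
    baryCoord K d x = 0 :=
  baryCoord_eq_zero_of_mem_hull (fun b hb => by
    rw [baryCoord_vertex hi hc hd (hS hb), kron_of_ne (ne_of_mem_of_not_mem hb hdS)]) hx

lemma mem_hull_of_baryCoord (hi : AffineIndependent ℝ ((↑) : K → E3)) (hc : K.card = 4)
    (hS : S ⊆ K) (h0 : ∀ d ∈ S, 0 ≤ baryCoord K d x)
    (h1 : ∀ d ∈ K, d ∉ S → baryCoord K d x = 0) : x ∈ hull S := by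
  have e1 : ∑ d ∈ S, baryCoord K d x = 1 := by
    rw [← sum_baryCoord hi hc x]
    exact Finset.sum_subset hS h1
  have e2 : ∑ d ∈ S, baryCoord K d x • d = x := by
    refine (Finset.sum_subset hS fun d hd hdS => ?_).trans (sum_baryCoord_smul hi hc x)
    rw [h1 d hd hdS, zero_smul]
  rw [← e2]
  exact (convex_convexHull ℝ _).sum_mem h0 e1 fun d hd => subset_convexHull ℝ _ hd

lemma mem_hull_iff (hi : AffineIndependent ℝ ((↑) : K → E3)) (hc : K.card = 4) : x ∈ hull K ↔ ∀ d ∈ K, 0 ≤ baryCoord K d x :=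
  ⟨fun hx _ hd => baryCoord_nonneg hi hc hd hx, fun h =>
    mem_hull_of_baryCoord hi hc subset_rfl h fun _ hd hd' => absurd hd hd'⟩

lemma baryGrad_ne_zero (hi : AffineIndependent ℝ ((↑) : K → E3)) (hc : K.card = 4)
    (hd : d ∈ K) : baryGrad K d ≠ 0 := by
  intro h
  obtain ⟨b, hb, hbd⟩ := Finset.exists_mem_ne (s := K) (by omega) d
  have := inner_baryGrad hi hc hd hd hb
  rw [h, inner_zero_left, kron_self, kron_of_ne hbd] at this
  norm_num at this

/-- Were the coordinate zero, a small step against its gradient would make it negative and leave the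
tetrahedron. -/
lemma baryCoord_pos_of_mem_interior (hi : AffineIndependent ℝ ((↑) : K → E3)) (hc : K.card = 4)
    (hd : d ∈ K) (hx : x ∈ interior (hull K)) :
    0 < baryCoord K d x := by
  refine lt_of_le_of_ne (baryCoord_nonneg hi hc hd (interior_subset hx)) fun h0 => ?_
  have hcont : Continuous fun ε : ℝ => x + ε • baryGrad K d := by fun_prop
  have hev : ∀ᶠ ε in nhds (0 : ℝ), x + ε • baryGrad K d ∈ hull K := by
    have := hcont.tendsto 0
    simp only [zero_smul, add_zero] at this
    exact this.eventually (mem_interior_iff_mem_nhds.1 hx)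
  obtain ⟨ε, hε, hε0⟩ := ((hev.filter_mono nhdsWithin_le_nhds).and
    (self_mem_nhdsWithin (a := (0 : ℝ)) (s := Set.Iio 0))).exists
  have h1 := baryCoord_nonneg hi hc hd hε
  rw [baryCoord_add, ← h0, zero_add, inner_smul_right] at h1
  have h2 : 0 < inner ℝ (baryGrad K d) (baryGrad K d) :=
    real_inner_self_pos.2 (baryGrad_ne_zero hi hc hd)
  exact absurd h1 (not_le.2 (mul_neg_of_neg_of_pos hε0 h2))

variable [DecidableEq E3]

lemma IsInnerPoint.mem_hull (hi : AffineIndependent ℝ ((↑) : K → E3)) (hc : K.card = 4)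
    (hd : d ∈ K) (hx : IsInnerPoint K d x) : x ∈ hull (K.erase d) :=
  mem_hull_of_baryCoord hi hc (Finset.erase_subset _ _)
    (fun b hb => (hx.2 b (Finset.mem_of_mem_erase hb) (Finset.ne_of_mem_erase hb)).le)
    fun b hb hb' => by
      obtain rfl : b = d := by
        by_contra h; exact hb' (Finset.mem_erase.2 ⟨h, hb⟩)
      exact hx.1

/-- The centroid of the face will do. -/
lemma exists_isInnerPoint (hi : AffineIndependent ℝ ((↑) : K → E3)) (hc : K.card = 4)
    (hd : d ∈ K) : ∃ m, IsInnerPoint K d m := by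
  have key : ∀ b ∈ K, baryCoord K b ((1 / 3 : ℝ) • ∑ c ∈ K.erase d, c)
      = (1 / 3) * ∑ c ∈ K.erase d, kron b c := by
    intro b hb
    have hcard : (K.erase d).card = 3 := by rw [Finset.card_erase_of_mem hd, hc]
    have h1 : (1 / 3 : ℝ) • ∑ c ∈ K.erase d, c - b = (1 / 3 : ℝ) • ∑ c ∈ K.erase d, (c - b) := by
      rw [Finset.sum_sub_distrib, Finset.sum_const, hcard, smul_sub]
      congr 1
      module
    rw [baryCoord, h1, inner_smul_right, inner_sum,
      Finset.sum_congr rfl fun c hc' => inner_baryGrad hi hc hb (Finset.mem_of_mem_erase hc') hb,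
      Finset.sum_sub_distrib, Finset.sum_const, hcard, kron_self]
    norm_num
    ring
  refine ⟨(1 / 3 : ℝ) • ∑ c ∈ K.erase d, c, ?_, fun b hb hbd => ?_⟩
  · exact (key d hd).trans (by
      rw [Finset.sum_eq_zero fun c hc' => kron_of_ne (Finset.ne_of_mem_erase hc'), mul_zero])
  · rw [key b hb, Finset.sum_eq_single b (fun c _ hcb => kron_of_ne hcb)
      (fun h => absurd (Finset.mem_erase.2 ⟨hbd, hb⟩) h), kron_self]
    norm_num

/-- The relative interior of a face is dense in it. -/
lemma hull_subset_closure_isInnerPoint (hi : AffineIndependent ℝ ((↑) : K → E3)) (hc : K.card = 4)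
    (hd : d ∈ K) :
    hull (K.erase d) ⊆ closure {x | IsInnerPoint K d x} := by
  intro x hx
  obtain ⟨m, hm⟩ := exists_isInnerPoint hi hc hd
  have hcont : Continuous fun ε : ℝ => x + ε • (m - x) := by fun_prop
  have ht := (hcont.tendsto 0).mono_left (nhdsWithin_le_nhds (s := Set.Ioo 0 1))
  simp only [zero_smul, add_zero] at ht
  have : (nhdsWithin (0 : ℝ) (Set.Ioo 0 1)).NeBot := by
    rw [nhdsWithin_Ioo_eq_nhdsGT zero_lt_one]; infer_instance
  refine mem_closure_of_tendsto ht ?_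
  filter_upwards [self_mem_nhdsWithin] with ε hε
  have hxd : baryCoord K d x = 0 :=
    baryCoord_eq_zero hi hc hd (Finset.erase_subset _ _) (Finset.notMem_erase d K) hx
  refine ⟨by rw [baryCoord_lineMap, hxd, hm.1]; ring, fun b hb hbd => ?_⟩
  have h1 : 0 ≤ baryCoord K b x :=
    baryCoord_nonneg hi hc hb (convexHull_mono (Finset.coe_subset.2 (Finset.erase_subset _ _)) hx)
  rw [baryCoord_lineMap]
  have := mul_pos hε.1 (hm.2 b hb hbd)
  have := mul_nonneg (sub_nonneg.2 hε.2.le) h1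
  linarith

end Barycentric

/-! ### Two tetrahedra with a common face -/

section Neighbours

lemma baryCoord_sum (K S : Finset E3) (d : E3) {w : E3 → ℝ} (hw : ∑ c ∈ S, w c = 1) :
    baryCoord K d (∑ c ∈ S, w c • c) = ∑ c ∈ S, w c * baryCoord K d c := by
  have h : ∑ c ∈ S, w c • c - d = ∑ c ∈ S, w c • (c - d) := by
    simp only [smul_sub, Finset.sum_sub_distrib, ← Finset.sum_smul, hw, one_smul]
  simp only [baryCoord, h, inner_sum, inner_smul_right, mul_add, Finset.sum_add_distrib, mul_one,
    hw]

/-- The ratio of the volumes of `K` and of the reference tetrahedron. -/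
def volFactor (K : Finset E3) : ℝ := volume.real (hull K) / volume.real (refSimplex 3)

lemma volFactor_pos {K : Finset E3} (hi : AffineIndependent ℝ ((↑) : K → E3))
    (hc : K.card = 4) : 0 < volFactor K := by
  obtain ⟨a, ha⟩ := exists_enumerates hi hc
  obtain ⟨c, hc0, hI⟩ := ha.integral_hull (F := ℝ)
  have h1 : 0 < volume.real (hull K) := by
    rw [volume_eq_euclideanHausdorffMeasure]
    exact ENNReal.toReal_pos ha.measure_hull_ne_zero ha.measure_hull_ne_top
  have h2 := hI fun _ => 1
  rw [← volume_eq_euclideanHausdorffMeasure, setIntegral_const, setIntegral_const, smul_eq_mul,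
    smul_eq_mul, smul_eq_mul, mul_one, mul_one] at h2
  rw [h2] at h1
  have h3 : 0 < volume.real (refSimplex 3) := pos_of_mul_pos_right h1 hc0.le
  exact div_pos (h2 ▸ mul_pos hc0 h3) h3

lemma integral_hull_eq_volFactor {K : Finset E3} (hi : AffineIndependent ℝ ((↑) : K → E3))
    (hc : K.card = 4) (g : E3 → ℝ) : ∫ x in hull K, g x = volFactor K * simplexInt 3 K g := by
  have h := volFactor_pos hi hc
  have h1 : volume.real (refSimplex 3) ≠ 0 := fun h0 => by
    rw [volFactor, h0, div_zero] at h; exact lt_irrefl _ h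
  have h2 : volume.real (hull K) ≠ 0 := fun h0 => by
    rw [volFactor, h0, zero_div] at h; exact lt_irrefl _ h
  rw [volFactor, simplexInt, setAverage_eq, ← volume_eq_euclideanHausdorffMeasure, smul_eq_mul]
  field_simp

variable [DecidableEq E3] {K K' : Finset E3} {d d' x : E3}

lemma notMem_of_erase_eq (hd : d ∈ K) (hd' : d' ∈ K')
    (hF : K.erase d = K'.erase d') (hne : K ≠ K') : d' ∉ K := by
  intro h
  have : d' = d := by
    by_contra h0
    have := Finset.mem_erase.2 ⟨h0, h⟩
    rw [hF] at this
    exact Finset.notMem_erase _ _ this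
  subst this
  exact hne (by rw [← Finset.insert_erase hd, hF, Finset.insert_erase hd'])


/-- A point of the common face is an affine combination of its vertices, at which the two
coordinates agree. -/
lemma baryCoord_eq_of_mem_face (hi : AffineIndependent ℝ ((↑) : K → E3)) (hc : K.card = 4)
    (hi' : AffineIndependent ℝ ((↑) : K' → E3)) (hc' : K'.card = 4)
    (hd : d ∈ K) (hF : K.erase d = K'.erase d')
    (hx : x ∈ hull (K.erase d)) {b : E3} (hb : b ∈ K) (hbd : b ≠ d) :
    baryCoord K' b x = baryCoord K b x := by
  have hbF : b ∈ K.erase d := Finset.mem_erase.2 ⟨hbd, hb⟩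
  have hxd : baryCoord K d x = 0 :=
    baryCoord_eq_zero hi hc hd (Finset.erase_subset _ _) (Finset.notMem_erase d K) hx
  have e1 : ∑ c ∈ K.erase d, baryCoord K c x = 1 := by
    rw [← sum_baryCoord hi hc x, ← Finset.add_sum_erase _ _ hd, hxd, zero_add]
  have e2 : ∑ c ∈ K.erase d, baryCoord K c x • c = x := by
    have := sum_baryCoord_smul hi hc x
    rwa [← Finset.add_sum_erase _ _ hd, hxd, zero_smul, zero_add] at this
  have hbF' : b ∈ K'.erase d' := hF ▸ hbF
  conv_lhs => rw [← e2, baryCoord_sum _ _ _ e1]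
  rw [Finset.sum_eq_single b]
  · rw [baryCoord_vertex hi' hc' (Finset.mem_of_mem_erase hbF') (Finset.mem_of_mem_erase hbF'),
      kron_self, mul_one]
  · intro c hcF hcb
    rw [hF] at hcF
    rw [baryCoord_vertex hi' hc' (Finset.mem_of_mem_erase hbF') (Finset.mem_of_mem_erase hcF),
      kron_of_ne hcb, mul_zero]
  · exact fun h => absurd hbF h

lemma IsInnerPoint.of_erase_eq (hi : AffineIndependent ℝ ((↑) : K → E3)) (hc : K.card = 4)
    (hi' : AffineIndependent ℝ ((↑) : K' → E3)) (hc' : K'.card = 4)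
    (hd : d ∈ K) (hd' : d' ∈ K') (hF : K.erase d = K'.erase d')
    (hx : IsInnerPoint K d x) : IsInnerPoint K' d' x := by
  have hxF := hx.mem_hull hi hc hd
  refine ⟨baryCoord_eq_zero hi' hc' hd' (Finset.erase_subset _ _) (Finset.notMem_erase d' K')
    (hF ▸ hxF), fun b hb hbd => ?_⟩
  have hbF : b ∈ K.erase d := hF ▸ Finset.mem_erase.2 ⟨hbd, hb⟩
  rw [baryCoord_eq_of_mem_face hi hc hi' hc' hd hF hxF (Finset.mem_of_mem_erase hbF)
    (Finset.ne_of_mem_erase hbF)]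
  exact hx.2 b (Finset.mem_of_mem_erase hbF) (Finset.ne_of_mem_erase hbF)

/-- Both gradients are normal to the common face; evaluation at `d'` gives the factor. -/
lemma baryGrad_eq_smul (hi : AffineIndependent ℝ ((↑) : K → E3)) (hc : K.card = 4)
    (hi' : AffineIndependent ℝ ((↑) : K' → E3)) (hc' : K'.card = 4)
    (hd : d ∈ K) (hd' : d' ∈ K') (hF : K.erase d = K'.erase d') : baryGrad K d = baryCoord K d d' • baryGrad K' d' := by
  obtain ⟨b, hb, hbd⟩ := Finset.exists_mem_ne (s := K) (by omega) d
  have hbF' : b ∈ K'.erase d' := hF ▸ Finset.mem_erase.2 ⟨hbd, hb⟩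
  refine ext_inner_right ℝ fun v => ?_
  conv_lhs => rw [← sum_inner_baryGrad_smul hi' hc' (Finset.mem_of_mem_erase hbF') v]
  rw [inner_sum, Finset.sum_eq_single d']
  · rw [inner_smul_right, inner_smul_left, baryCoord_eq hi hc hd hb, kron_of_ne hbd]
    simp [mul_comm]
  · intro c hcK hcd
    have hcF : c ∈ K.erase d := hF ▸ Finset.mem_erase.2 ⟨hcd, hcK⟩
    rw [inner_smul_right, inner_baryGrad hi hc hd (Finset.mem_of_mem_erase hcF) hb,
      kron_of_ne (Finset.ne_of_mem_erase hcF), kron_of_ne hbd, sub_self, mul_zero]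
  · exact fun h => absurd hd' h

lemma baryCoord_eq_mul (hi : AffineIndependent ℝ ((↑) : K → E3)) (hc : K.card = 4)
    (hi' : AffineIndependent ℝ ((↑) : K' → E3)) (hc' : K'.card = 4)
    (hd : d ∈ K) (hd' : d' ∈ K') (hF : K.erase d = K'.erase d')
    (x : E3) : baryCoord K d x = baryCoord K d d' * baryCoord K' d' x := by
  obtain ⟨b, hb, hbd⟩ := Finset.exists_mem_ne (s := K) (by omega) d
  have hbF' : b ∈ K'.erase d' := hF ▸ Finset.mem_erase.2 ⟨hbd, hb⟩
  rw [baryCoord_eq hi hc hd hb, baryCoord_eq hi' hc' hd' (Finset.mem_of_mem_erase hbF') x,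
    kron_of_ne hbd, kron_of_ne (Finset.ne_of_mem_erase hbF'),
    baryGrad_eq_smul hi hc hi' hc' hd hd' hF, inner_smul_left]
  simp

/-- The affine map `x ↦ x + λ_d(x) (d' - d)` fixes the common face and carries `d` to `d'`. Its
linear part is a transvection of determinant `1 + ∇λ_d · (d' - d) = λ_d(d')`. -/
lemma volume_hull_of_erase_eq (hi : AffineIndependent ℝ ((↑) : K → E3)) (hc : K.card = 4)
    (hd : d ∈ K) (hd' : d' ∈ K') (hF : K.erase d = K'.erase d') :
    volume.real (hull K') = |baryCoord K d d'| * volume.real (hull K) := by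
  let A : E3 →ₗ[ℝ] E3 :=
    LinearMap.transvection (innerSL ℝ (baryGrad K d)).toLinearMap (d' - d)
  have hA : ∀ x, A x = x + inner ℝ (baryGrad K d) x • (d' - d) := fun x => rfl
  have hdet : LinearMap.det A = baryCoord K d d' := LinearMap.transvection.det _ _
  let c : E3 := (1 - inner ℝ (baryGrad K d) d) • (d' - d)
  let Φ : E3 →ᵃ[ℝ] E3 := A.toAffineMap + AffineMap.const ℝ E3 c
  have hΦ : ∀ x, Φ x = x + baryCoord K d x • (d' - d) := by
    intro x
    show A x + c = _
    rw [hA, baryCoord, inner_sub_right]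
    module
  have himg : Φ '' (K : Set E3) = K' := by
    have h1 : ∀ b ∈ K.erase d, Φ b = b := fun b hb => by
      rw [hΦ, baryCoord_vertex hi hc hd (Finset.mem_of_mem_erase hb),
        kron_of_ne (Finset.ne_of_mem_erase hb), zero_smul, add_zero]
    have h2 : Φ d = d' := by
      rw [hΦ, baryCoord_vertex hi hc hd hd, kron_self, one_smul, add_sub_cancel]
    rw [← Finset.insert_erase hd, ← Finset.insert_erase hd', Finset.coe_insert,
      Set.image_insert_eq, h2, ← hF, Finset.coe_insert]
    congr 1
    rw [Set.image_congr (g := id) fun b hb => h1 b (Finset.mem_coe.1 hb), Set.image_id]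
  have himg' : hull K' = (fun x => x + c) '' (A '' hull K) := by
    rw [Set.image_image, hull, ← himg, ← AffineMap.image_convexHull]
    rfl
  rw [himg', Set.image_add_right, Measure.real, measure_preimage_add_right,
    Measure.addHaar_image_linearMap, hdet, ENNReal.toReal_mul,
    ENNReal.toReal_ofReal (abs_nonneg _), Measure.real]


/-- The tetrahedra lie on different sides of their common face. -/
lemma baryCoord_opposite_neg (hi : AffineIndependent ℝ ((↑) : K → E3)) (hc : K.card = 4)
    (hi' : AffineIndependent ℝ ((↑) : K' → E3)) (hc' : K'.card = 4)
    (hd : d ∈ K) (hd' : d' ∈ K') (hF : K.erase d = K'.erase d')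
    (hne : K ≠ K') (hInt : hull K ∩ hull K' ⊆ hull (K ∩ K')) : baryCoord K d d' < 0 := by
  by_contra! h0
  obtain ⟨m, hm⟩ := exists_isInnerPoint hi hc hd
  have hm' := hm.of_erase_eq hi hc hi' hc' hd hd' hF
  have hcont : Continuous fun ε : ℝ => m + ε • (d' - m) := by fun_prop
  have hev : ∀ᶠ ε in nhdsWithin (0 : ℝ) (Set.Ioo 0 1), ∀ b ∈ K.erase d,
      0 < baryCoord K b (m + ε • (d' - m)) := by
    rw [Filter.eventually_all_finset]
    intro b hb
    have ht := ((continuous_baryCoord K b).comp hcont).tendsto 0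
    simp only [Function.comp_apply, zero_smul, add_zero] at ht
    exact (ht.mono_left nhdsWithin_le_nhds).eventually
      (lt_mem_nhds (hm.2 b (Finset.mem_of_mem_erase hb) (Finset.ne_of_mem_erase hb)))
  have : (nhdsWithin (0 : ℝ) (Set.Ioo 0 1)).NeBot := by
    rw [nhdsWithin_Ioo_eq_nhdsGT zero_lt_one]; infer_instance
  obtain ⟨ε, hε, hε0, hε1⟩ := (hev.and self_mem_nhdsWithin).exists
  have hy : m + ε • (d' - m) ∈ hull K := by
    refine (mem_hull_iff hi hc).2 fun b hb => ?_
    by_cases hbd : b = d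
    · rw [hbd, baryCoord_lineMap, hm.1, mul_zero, zero_add]; positivity
    · exact (hε b (Finset.mem_erase.2 ⟨hbd, hb⟩)).le
  have hy' : m + ε • (d' - m) ∈ hull K' := by
    have hmK : m ∈ hull K' := convexHull_mono (Finset.coe_subset.2 (Finset.erase_subset _ _))
      (hm'.mem_hull hi' hc' hd')
    have hdK : d' ∈ hull K' := subset_convexHull ℝ _ hd'
    have h1 := convex_convexHull ℝ (K' : Set E3) hmK hdK (sub_nonneg.2 hε1.le) hε0.le
      (sub_add_cancel _ _)
    have h2 : m + ε • (d' - m) = (1 - ε) • m + ε • d' := by module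
    rw [h2]; exact h1
  -- If `d'` were not strictly beyond the face, a point slightly displaced from an inner point of
  -- the face towards `d'` would lie in both tetrahedra. It would then lie in the hull of the common
  -- vertices, where the coordinate of `d'` vanishes, whereas here it equals `ε > 0`.
  have h3 : baryCoord K' d' (m + ε • (d' - m)) = 0 :=
    baryCoord_eq_zero hi' hc' hd' Finset.inter_subset_right
      (fun h => notMem_of_erase_eq hd hd' hF hne (Finset.mem_inter.1 h).1) (hInt ⟨hy, hy'⟩)
  rw [baryCoord_lineMap, hm'.1, baryCoord_vertex hi' hc' hd' hd', kron_self] at h3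
  linarith

/-- The area vectors of the common face seen from both sides cancel. -/
lemma volFactor_smul_baryGrad (hi : AffineIndependent ℝ ((↑) : K → E3)) (hc : K.card = 4)
    (hi' : AffineIndependent ℝ ((↑) : K' → E3)) (hc' : K'.card = 4)
    (hd : d ∈ K) (hd' : d' ∈ K') (hF : K.erase d = K'.erase d')
    (hne : K ≠ K') (hInt : hull K ∩ hull K' ⊆ hull (K ∩ K')) :
    volFactor K • baryGrad K d = -(volFactor K' • baryGrad K' d') := by
  have h := baryCoord_opposite_neg hi hc hi' hc' hd hd' hF hne hInt
  rw [baryGrad_eq_smul hi hc hi' hc' hd hd' hF, volFactor, volFactor,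
    volume_hull_of_erase_eq hi hc hd hd' hF, abs_of_neg h, smul_smul, ← neg_smul]
  congr 1
  ring

/-- Near `x` the coordinates of the common vertices stay positive for both tetrahedra, and the sign
of the coordinate of `d` decides to which of them a point belongs. -/
lemma IsInnerPoint.mem_interior_union (hi : AffineIndependent ℝ ((↑) : K → E3)) (hc : K.card = 4)
    (hi' : AffineIndependent ℝ ((↑) : K' → E3)) (hc' : K'.card = 4)
    (hd : d ∈ K) (hd' : d' ∈ K') (hF : K.erase d = K'.erase d')
    (hne : K ≠ K') (hInt : hull K ∩ hull K' ⊆ hull (K ∩ K'))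
    (hx : IsInnerPoint K d x) :
    x ∈ interior (hull K ∪ hull K') := by
  have h := baryCoord_opposite_neg hi hc hi' hc' hd hd' hF hne hInt
  have hx' := hx.of_erase_eq hi hc hi' hc' hd hd' hF
  rw [mem_interior_iff_mem_nhds]
  have e1 : ∀ᶠ y in nhds x, ∀ b ∈ K.erase d, 0 < baryCoord K b y := by
    rw [Filter.eventually_all_finset]
    exact fun b hb => (continuous_baryCoord K b).continuousAt.eventually (lt_mem_nhds
      (hx.2 b (Finset.mem_of_mem_erase hb) (Finset.ne_of_mem_erase hb)))
  have e2 : ∀ᶠ y in nhds x, ∀ b ∈ K'.erase d', 0 < baryCoord K' b y := by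
    rw [Filter.eventually_all_finset]
    exact fun b hb => (continuous_baryCoord K' b).continuousAt.eventually (lt_mem_nhds
      (hx'.2 b (Finset.mem_of_mem_erase hb) (Finset.ne_of_mem_erase hb)))
  filter_upwards [e1, e2] with y h1 h2
  rcases le_or_gt 0 (baryCoord K d y) with h0 | h0
  · refine Or.inl ((mem_hull_iff hi hc).2 fun b hb => ?_)
    by_cases hbd : b = d
    · rwa [hbd]
    · exact (h1 b (Finset.mem_erase.2 ⟨hbd, hb⟩)).le
  · refine Or.inr ((mem_hull_iff hi' hc').2 fun b hb => ?_)
    by_cases hbd : b = d'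
    · rw [baryCoord_eq_mul hi hc hi' hc' hd hd' hF] at h0
      rw [hbd]
      by_contra! h3
      exact absurd (mul_pos_of_neg_of_neg h h3) (not_lt.2 h0.le)
    · exact (h2 b (Finset.mem_erase.2 ⟨hbd, hb⟩)).le

end Neighbours

/-! ### Meshes -/

section Mesh

variable {T : Geometry.SimplicialComplex ℝ E3}

lemma Cell.indep (K : Cell T) : AffineIndependent ℝ ((↑) : K.1 → E3) := T.indep K.2.1

lemma IsTetMesh.finite_cell (hT : IsTetMesh T) : Finite (Cell T) :=
  (hT.1.subset fun _ hK => hK.1 : {K | K ∈ T.faces ∧ K.card = 4}.Finite).to_subtype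

lemma hull_inter_hull_subset [DecidableEq E3] {s t : Finset E3} (hs : s ∈ T.faces)
    (ht : t ∈ T.faces) : hull s ∩ hull t ⊆ hull (s ∩ t) := by
  rw [hull, hull, hull, Finset.coe_inter]
  exact T.inter_subset_convexHull hs ht

/-- Simplices of the mesh meet in the hull of their common vertices. There the coordinate of a
vertex of `K` outside `s` is zero, while all coordinates are positive in the interior. -/
lemma Cell.notMem_of_mem_interior {K : Cell T} {s : Finset E3} (hs : s ∈ T.faces)
    (hKs : ¬ K.1 ⊆ s) {x : E3} (hx : x ∈ interior (hull K.1)) : x ∉ hull s := by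
  classical
  intro hxs
  obtain ⟨d, hd, hd'⟩ := Finset.not_subset.1 hKs
  have h0 := baryCoord_eq_zero K.indep K.2.2 hd Finset.inter_subset_left
    (fun h => hd' (Finset.mem_inter.1 h).2) (hull_inter_hull_subset K.2.1 hs
      ⟨interior_subset hx, hxs⟩)
  exact (baryCoord_pos_of_mem_interior K.indep K.2.2 hd hx).ne' h0

lemma Cell.eq_of_subset {K K' : Cell T} (h : K.1 ⊆ K'.1) : K = K' :=
  Subtype.ext (Finset.eq_of_subset_of_card_le h (by rw [K.2.2, K'.2.2]))

lemma IsTetMesh.mem_space_iff (hT : IsTetMesh T) {x : E3} :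
    x ∈ T.space ↔ ∃ K : Cell T, x ∈ hull K.1 := by
  rw [Geometry.SimplicialComplex.mem_space_iff]
  refine ⟨fun ⟨s, hs, hx⟩ => ?_, fun ⟨K, hK⟩ => ⟨K.1, K.2.1, hK⟩⟩
  obtain ⟨K, hK, hc, hsK⟩ := hT.2 s hs
  exact ⟨⟨K, hK, hc⟩, convexHull_mono (Finset.coe_subset.2 hsK) hx⟩

lemma Cell.hull_subset_space (K : Cell T) : hull K.1 ⊆ T.space :=
  Geometry.SimplicialComplex.convexHull_subset_space K.2.1

/-- A tetrahedron of the mesh together with one of its vertices; this also describes a face of the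
mesh seen from one of its sides. -/
abbrev Flag (T : Geometry.SimplicialComplex ℝ E3) : Type := Σ K : Cell T, K.1

variable [DecidableEq E3]

/-- The face opposite to the vertex of the flag. -/
def Flag.face (a : Flag T) : Finset E3 := a.1.1.erase a.2.1

lemma Flag.face_subset (a : Flag T) : a.face ⊆ a.1.1 := Finset.erase_subset _ _

lemma Flag.card_face (a : Flag T) : a.face.card = 3 := by
  rw [Flag.face, Finset.card_erase_of_mem a.2.2, a.1.2.2]

lemma Flag.face_mem (a : Flag T) : a.face ∈ T.faces :=
  T.down_closed a.1.2.1 a.face_subset (Finset.card_pos.1 (by rw [a.card_face]; norm_num))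

lemma Flag.indep_face (a : Flag T) : AffineIndependent ℝ ((↑) : a.face → E3) := T.indep a.face_mem

lemma Flag.cell_ne {a b : Flag T} (hF : a.face = b.face) (hne : a ≠ b) : a.1.1 ≠ b.1.1 := by
  obtain ⟨K, d⟩ := a
  obtain ⟨K', d'⟩ := b
  intro h
  obtain rfl : K = K' := Subtype.ext h
  refine hne ?_
  congr 1
  refine Subtype.ext ?_
  by_contra hdd
  have : d.1 ∈ Flag.face (⟨K, d'⟩ : Flag T) := Finset.mem_erase.2 ⟨hdd, d.2⟩
  rw [← hF] at this
  exact Finset.notMem_erase _ _ this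

lemma Flag.exists_of_subset {K : Cell T} {F : Finset E3} (hF : F ⊆ K.1) (hc : F.card = 3) :
    ∃ a : Flag T, a.1 = K ∧ a.face = F := by
  have h : (K.1 \ F).card = 1 := by rw [Finset.card_sdiff_of_subset hF, hc, K.2.2]
  obtain ⟨d, hd⟩ := Finset.card_eq_one.1 h
  have hd' : d ∈ K.1 \ F := hd ▸ Finset.mem_singleton_self d
  refine ⟨⟨K, ⟨d, (Finset.mem_sdiff.1 hd').1⟩⟩, rfl, ?_⟩
  show K.1.erase d = F
  rw [Finset.erase_eq, ← hd, Finset.sdiff_sdiff_eq_self hF]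

lemma Flag.baryCoord_neg {a b : Flag T} (hF : a.face = b.face) (hne : a ≠ b) :
    baryCoord a.1.1 a.2.1 b.2.1 < 0 :=
  baryCoord_opposite_neg a.1.indep a.1.2.2 b.1.indep b.1.2.2 a.2.2 b.2.2 hF (cell_ne hF hne)
    (hull_inter_hull_subset a.1.2.1 b.1.2.1)

lemma Flag.volFactor_smul_baryGrad {a b : Flag T} (hF : a.face = b.face) (hne : a ≠ b) :
    volFactor a.1.1 • baryGrad a.1.1 a.2.1 = -(volFactor b.1.1 • baryGrad b.1.1 b.2.1) :=
  NodalCurl.volFactor_smul_baryGrad a.1.indep a.1.2.2 b.1.indep b.1.2.2 a.2.2 b.2.2 hF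
    (cell_ne hF hne) (hull_inter_hull_subset a.1.2.1 b.1.2.1)

/-- A face belongs to at most two tetrahedra. -/
lemma Flag.eq_of_face_eq {a b c : Flag T} (hb : a.face = b.face) (hab : a ≠ b)
    (hc : a.face = c.face) (hac : a ≠ c) : b = c := by
  by_contra hbc
  have h1 := baryCoord_neg hb hab
  have h2 := baryCoord_neg hc hac
  have h3 := baryCoord_neg (hb.symm.trans hc) hbc
  -- Three tetrahedra at one face would be pairwise on opposite sides, but the coordinate at `c` is
  -- the product of two negative numbers.
  rw [baryCoord_eq_mul a.1.indep a.1.2.2 b.1.indep b.1.2.2 a.2.2 b.2.2 hb] at h2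
  exact absurd (mul_pos_of_neg_of_neg h1 h3) (not_lt.2 h2.le)

/-- A face that meets the domain in an inner point belongs to a second tetrahedron. -/
lemma Flag.exists_neighbour_of_isInnerPoint (hT : IsTetMesh T) (a : Flag T) {x : E3}
    (hx : IsInnerPoint a.1.1 a.2.1 x) (hxd : x ∈ domain T) : ∃ b, a.face = b.face ∧ a ≠ b := by
  have := hT.finite_cell
  let C : Set E3 := ⋃ K ∈ {K : Cell T | K ≠ a.1}, hull K.1
  have hC : IsClosed C :=
    (Set.toFinite _).isClosed_biUnion fun K _ => (isCompact_hull K.1).isClosed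
  have hcont : Continuous fun ε : ℝ => x + ε • baryGrad a.1.1 a.2.1 := by fun_prop
  have ht := (hcont.tendsto 0).mono_left (nhdsWithin_le_nhds (s := Set.Iio 0))
  simp only [zero_smul, add_zero] at ht
  -- Points slightly beyond the face are still in the domain but not in the tetrahedron of `a`. They
  -- lie in the closed union `C` of the other tetrahedra, hence so does their limit `x`.
  have hxC : x ∈ C := by
    refine hC.mem_of_tendsto ht ?_
    filter_upwards [ht.eventually (mem_interior_iff_mem_nhds.1 hxd), self_mem_nhdsWithin]
      with ε hε hε0
    obtain ⟨K, hK⟩ := hT.mem_space_iff.1 hε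
    refine Set.mem_biUnion (x := K) ?_ hK
    rintro rfl
    have h1 := baryCoord_nonneg a.1.indep a.1.2.2 a.2.2 hK
    rw [baryCoord_add, hx.1, zero_add, inner_smul_right] at h1
    have h2 : 0 < inner ℝ (baryGrad a.1.1 a.2.1) (baryGrad a.1.1 a.2.1) :=
      real_inner_self_pos.2 (baryGrad_ne_zero a.1.indep a.1.2.2 a.2.2)
    exact absurd h1 (not_le.2 (mul_neg_of_neg_of_pos hε0 h2))
  obtain ⟨K, hKa, hxK⟩ := Set.mem_iUnion₂.1 hxC
  have hxF := hx.mem_hull a.1.indep a.1.2.2 a.2.2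
  -- All coordinates of the face vertices are positive at `x`, so a tetrahedron through `x` must
  -- contain every one of these vertices.
  have hFK : a.face ⊆ K.1 := by
    intro b hb
    by_contra hbK
    have h0 := baryCoord_eq_zero a.1.indep a.1.2.2 (a.face_subset hb) Finset.inter_subset_left
      (fun h => hbK (Finset.mem_inter.1 h).2) (hull_inter_hull_subset a.1.2.1 K.2.1
        ⟨convexHull_mono (Finset.coe_subset.2 a.face_subset) hxF, hxK⟩)
    exact (hx.2 b (a.face_subset hb) (Finset.ne_of_mem_erase hb)).ne' h0
  obtain ⟨b, rfl, hb⟩ := Flag.exists_of_subset hFK a.card_face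
  exact ⟨b, hb.symm, fun h => hKa (h ▸ rfl)⟩

/-- The domain is open and inner points are dense in the face, so `x` may be replaced by an inner
point. -/
lemma Flag.exists_neighbour (hT : IsTetMesh T) (a : Flag T) {x : E3} (hx : x ∈ hull a.face)
    (hxd : x ∈ domain T) : ∃ b, a.face = b.face ∧ a ≠ b := by
  obtain ⟨y, hy, hy'⟩ := mem_closure_iff.1
    (hull_subset_closure_isInnerPoint a.1.indep a.1.2.2 a.2.2 hx) _ isOpen_interior hxd
  exact a.exists_neighbour_of_isInnerPoint hT hy' hy

lemma Flag.notMem_hull_of_face_ne {a b : Flag T} (h : a.face ≠ b.face) {x : E3}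
    (hx : IsInnerPoint a.1.1 a.2.1 x) : x ∉ hull b.face := by
  intro hxb
  have hsub : ¬ a.face ⊆ b.face := fun hs =>
    h (Finset.eq_of_subset_of_card_le hs (by rw [a.card_face, b.card_face]))
  obtain ⟨c, hc, hc'⟩ := Finset.not_subset.1 hsub
  have h0 := baryCoord_eq_zero a.1.indep a.1.2.2 (a.face_subset hc)
    (Finset.inter_subset_left.trans a.face_subset)
    (fun h => hc' (Finset.mem_inter.1 h).2) (hull_inter_hull_subset a.face_mem b.face_mem
      ⟨hx.mem_hull a.1.indep a.1.2.2 a.2.2, hxb⟩)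
  exact (hx.2 c (a.face_subset hc) (Finset.ne_of_mem_erase hc)).ne' h0

end Mesh

/-! ### Integration of piecewise polynomial fields -/

section Glue

variable {T : Geometry.SimplicialComplex ℝ E3}

lemma interior_hull_ae_eq (K : Finset E3) :
    (interior (hull K) : Set E3) =ᵐ[volume] hull K :=
  interior_ae_eq_of_null_frontier ((convex_convexHull ℝ _).addHaar_frontier volume)

lemma glue_eq_sum [Fintype (Cell T)] (u : PiecewiseField T) (x : E3) :
    glue u x = ∑ K : Cell T, (interior (hull K.1)).indicator (fieldFun (u K)) x :=
  finsum_eq_sum_of_fintype _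

lemma memLp_glue (hT : IsTetMesh T) (u : PiecewiseField T) (s : Set E3) :
    MemLp (glue u) 2 (volume.restrict s) := by
  have := hT.finite_cell
  have := Fintype.ofFinite (Cell T)
  refine MemLp.restrict s ?_
  have h : glue u = fun x => ∑ K : Cell T, (interior (hull K.1)).indicator (fieldFun (u K)) x :=
    funext (glue_eq_sum u)
  rw [h]
  refine memLp_finsetSum _ fun K _ => ?_
  rw [memLp_indicator_iff_restrict isOpen_interior.measurableSet]
  obtain ⟨C, hC⟩ := (isCompact_hull K.1).exists_bound_of_continuousOn
    (continuous_fieldFun (u K)).continuousOn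
  have : IsFiniteMeasure (volume.restrict (interior (hull K.1))) :=
    ⟨by rw [Measure.restrict_apply_univ]
        exact (measure_mono interior_subset).trans_lt (isCompact_hull K.1).measure_lt_top⟩
  refine MemLp.of_bound (continuous_fieldFun (u K)).aestronglyMeasurable C ?_
  filter_upwards [ae_restrict_mem isOpen_interior.measurableSet] with x hx
  exact hC x (interior_subset hx)

lemma integral_inner_glue [Fintype (Cell T)] (u : PiecewiseField T) {Ω : Set E3} {ψ : E3 → E3}
    (hψ : Continuous ψ) (h0 : ∀ x ∉ Ω, ψ x = 0) :
    ∫ x in Ω, inner ℝ (glue u x) (ψ x)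
      = ∑ K : Cell T, ∫ x in hull K.1, inner ℝ (fieldFun (u K) x) (ψ x) := by
  rw [setIntegral_eq_integral_of_forall_compl_eq_zero fun x hx => by
    rw [h0 x hx, inner_zero_right]]
  have h : ∀ x, inner ℝ (glue u x) (ψ x) = ∑ K : Cell T, (interior (hull K.1)).indicator
      (fun x => inner ℝ (fieldFun (u K) x) (ψ x)) x := by
    intro x
    rw [glue_eq_sum, sum_inner]
    refine Finset.sum_congr rfl fun K _ => ?_
    by_cases hx : x ∈ interior (hull K.1)
    · rw [Set.indicator_of_mem hx, Set.indicator_of_mem hx]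
    · rw [Set.indicator_of_notMem hx, Set.indicator_of_notMem hx, inner_zero_left]
  simp only [h]
  rw [integral_finsetSum]
  · refine Finset.sum_congr rfl fun K _ => ?_
    rw [integral_indicator isOpen_interior.measurableSet]
    exact setIntegral_congr_set (interior_hull_ae_eq K.1)
  · intro K _
    rw [integrable_indicator_iff isOpen_interior.measurableSet]
    exact (integrableOn_hull_of_measure_ne_top (isCompact_hull K.1).measure_lt_top.ne
      ((continuous_fieldFun (u K)).inner hψ)).mono_set interior_subset

lemma continuous_vcurl {φ : E3 → E3} (hφ : ContDiff ℝ 1 φ) : Continuous (vcurl φ) := by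
  have h : Continuous (fderiv ℝ φ) := hφ.continuous_fderiv one_ne_zero
  have hD : ∀ j i : Fin 3, Continuous fun x => fderiv ℝ φ x (EuclideanSpace.single j 1) i :=
    fun j i => (EuclideanSpace.proj i : E3 →L[ℝ] ℝ).continuous.comp (h.clm_apply continuous_const)
  refine (PiLp.continuous_toLp 2 _).comp (continuous_pi fun i => ?_)
  fin_cases i
  · exact (hD 1 2).sub (hD 2 1)
  · exact (hD 2 0).sub (hD 0 2)
  · exact (hD 0 1).sub (hD 1 0)

lemma vcurl_eq_zero {φ : E3 → E3} {x : E3} (hx : x ∉ tsupport φ) : vcurl φ x = 0 := by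
  have h : fderiv ℝ φ x = 0 := by
    by_contra h0; exact hx (support_fderiv_subset ℝ h0)
  refine ext3 ?_ ?_ ?_ <;> simp [vcurl, h]

variable [DecidableEq E3]

/-- The contribution of one side of a face to the integration by parts formula. -/
def faceTerm (u : PiecewiseField T) (φ : E3 → E3) (a : Flag T) : ℝ :=
  volFactor a.1.1 * simplexInt 2 a.face fun x =>
    inner ℝ (baryGrad a.1.1 a.2.1) (cross (fieldFun (u a.1) x) (φ x))

/-- Integration by parts for piecewise polynomial fields. -/
lemma integral_glue_curl [Fintype (Cell T)] (u : PiecewiseField T) {Ω : Set E3} {φ : E3 → E3}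
    (hφ : ContDiff ℝ 1 φ) (hΩ : tsupport φ ⊆ Ω) :
    ∫ x in Ω, inner ℝ (glue (fun K => curlField (u K)) x) (φ x)
      = (∫ x in Ω, inner ℝ (glue u x) (vcurl φ x)) - ∑ a : Flag T, faceTerm u φ a := by
  rw [integral_inner_glue _ hφ.continuous fun x hx => image_eq_zero_of_notMem_tsupport
      fun h => hx (hΩ h),
    integral_inner_glue _ (continuous_vcurl hφ) fun x hx => vcurl_eq_zero fun h => hx (hΩ h),
    Fintype.sum_sigma, ← Finset.sum_sub_distrib]
  refine Finset.sum_congr rfl fun K _ => ?_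
  have hio : ∀ {w : PolyField} {ψ : E3 → E3}, Continuous ψ →
      IntegrableOn (fun x => inner ℝ (fieldFun w x) (ψ x)) (hull K.1) := fun hψ =>
    integrableOn_hull_of_measure_ne_top (isCompact_hull K.1).measure_lt_top.ne
      ((continuous_fieldFun _).inner hψ)
  have h1 := integral_sub (hio (w := curlField (u K)) hφ.continuous)
    (hio (w := u K) (continuous_vcurl hφ))
  have h2 : ∑ d : K.1, faceTerm u φ ⟨K, d⟩ = volFactor K.1 * ∑ d ∈ K.1,
      simplexInt 2 (K.1.erase d) fun x =>
        inner ℝ (baryGrad K.1 d) (cross (fieldFun (u K) x) (φ x)) := by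
    rw [Finset.mul_sum]
    exact Finset.sum_coe_sort K.1 fun d => volFactor K.1 * simplexInt 2 (K.1.erase d) fun x =>
      inner ℝ (baryGrad K.1 d) (cross (fieldFun (u K) x) (φ x))
  have h3 := integral_hull_eq_volFactor K.indep K.2.2 fun x =>
    inner ℝ (fieldFun (curlField (u K)) x) (φ x) - inner ℝ (fieldFun (u K) x) (vcurl φ x)
  rw [simplexInt_curl K.indep K.2.2 (u K) hφ, mul_neg, ← h2] at h3
  linarith

end Glue

/-! ### Tangential continuity and `H(curl)` -/

section HCurl

variable {T : Geometry.SimplicialComplex ℝ E3} {u : PiecewiseField T}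

/-- The tangential components of `u` coincide on the faces. -/
def TangentialC0Faces (u : PiecewiseField T) : Prop :=
  ∀ K K' : Cell T, ∀ f ⊆ K.1, f ⊆ K'.1 → f.card = 3 → ∀ x ∈ hull f, ∀ b ∈ f, ∀ c ∈ f,
    inner ℝ (fieldFun (u K - u K') x) (b - c) = 0

lemma simplexInt_congr {d : ℕ} {s : Finset E3} {g g' : E3 → ℝ} (h : ∀ x ∈ hull s, g x = g' x) :
    simplexInt d s g = simplexInt d s g' := by
  rw [simplexInt, simplexInt, setAverage_eq, setAverage_eq, setIntegral_hull_congr h]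

/-- The two area vectors are opposite, so only the jump of `u` across the face survives. -/
lemma faceTerm_add_of_neighbour [DecidableEq E3] (u : PiecewiseField T) {φ : E3 → E3}
    (hφ : Continuous φ) {a b : Flag T} (hF : a.face = b.face) (hne : a ≠ b) :
    faceTerm u φ a + faceTerm u φ b = volFactor a.1.1 * simplexInt 2 a.face fun x =>
      inner ℝ (baryGrad a.1.1 a.2.1) (cross (fieldFun (u a.1 - u b.1) x) (φ x)) := by
  have hb : faceTerm u φ b = -(volFactor a.1.1 * simplexInt 2 a.face fun x =>
      inner ℝ (baryGrad a.1.1 a.2.1) (cross (fieldFun (u b.1) x) (φ x))) := by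
    rw [faceTerm, ← hF, ← simplexInt_const_mul, ← simplexInt_const_mul, ← neg_one_mul,
      ← simplexInt_const_mul]
    refine simplexInt_congr fun x _ => ?_
    have h := congrArg (fun v => inner ℝ v (cross (fieldFun (u b.1) x) (φ x)))
      (Flag.volFactor_smul_baryGrad hF hne)
    simp only [inner_neg_left, inner_smul_left, conj_trivial] at h
    rw [h]; ring
  rw [hb, faceTerm, ← sub_eq_add_neg, ← mul_sub, ← simplexInt_sub a.indep_face a.card_face
    (by fun_prop) (by fun_prop)]
  simp only [map_sub, Pi.sub_apply, cross_sub_left, inner_sub_right]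

/-- Tangentially continuous fields have a weak curl. -/
lemma memHCurl_of_tangentialC0Faces (hT : IsTetMesh T) (hu : TangentialC0Faces u) :
    MemHCurl (domain T) (glue u) := by
  classical
  have := hT.finite_cell
  have := Fintype.ofFinite (Cell T)
  refine ⟨memLp_glue hT u _, glue fun K => curlField (u K), memLp_glue hT _ _,
    fun φ hφ _ hsupp => ?_⟩
  rw [integral_glue_curl u (hφ.of_le (by exact_mod_cast le_top)) hsupp, eq_comm, sub_eq_self]
  -- `N` exchanges the two sides of an interior face and fixes the flags without a neighbour; the
  -- face terms cancel along this involution.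
  let N : Flag T → Flag T := fun a =>
    if h : ∃ b, a.face = b.face ∧ a ≠ b then h.choose else a
  have hN : ∀ a : Flag T, (∃ b, a.face = b.face ∧ a ≠ b) → a.face = (N a).face ∧ a ≠ N a := by
    intro a h
    simp only [N, dif_pos h]
    exact h.choose_spec
  have hN' : ∀ a : Flag T, (¬ ∃ b, a.face = b.face ∧ a ≠ b) → N a = a := fun a h => by
    simp only [N, dif_neg h]
  have hzero : ∀ a : Flag T, (¬ ∃ b, a.face = b.face ∧ a ≠ b) → faceTerm u φ a = 0 := by
    intro a h
    rw [faceTerm, simplexInt_eq_zero, mul_zero]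
    intro x hx
    -- A face with only one tetrahedron does not meet the domain, so the test field vanishes on it.
    have hφx : φ x = 0 := image_eq_zero_of_notMem_tsupport fun hxs =>
      h (a.exists_neighbour hT hx (hsupp hxs))
    rw [hφx]
    have : cross (fieldFun (u a.1) x) 0 = 0 := by simp [cross]
    rw [this, inner_zero_right]
  refine Finset.sum_involution (fun a _ => N a) (fun a _ => ?_) (fun a _ hne h => ?_)
    (fun a _ => Finset.mem_univ _) fun a _ => ?_
  · by_cases h : ∃ b, a.face = b.face ∧ a ≠ b
    · obtain ⟨hF, hne⟩ := hN a h
      rw [faceTerm_add_of_neighbour u hφ.continuous hF hne, simplexInt_eq_zero, mul_zero]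
      intro x hx
      exact inner_cross_eq_zero a.indep_face a.card_face
        (inner_baryGrad_face a.1.indep a.1.2.2 a.2.2)
        (hu a.1 (N a).1 a.face a.face_subset (hF ▸ (N a).face_subset) a.card_face x hx) _
    · rw [hN' a h, hzero a h, add_zero]
  · by_cases h' : ∃ b, a.face = b.face ∧ a ≠ b
    · exact (hN a h').2 h.symm
    · exact hne (hzero a h')
  · by_cases h : ∃ b, a.face = b.face ∧ a ≠ b
    · obtain ⟨hF, hne⟩ := hN a h
      have h2 := hN (N a) ⟨a, hF.symm, hne.symm⟩
      exact Flag.eq_of_face_eq h2.1 h2.2 hF.symm hne.symm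
    · simp only [hN' a h]

lemma ae_mem_iUnion_interior (hT : IsTetMesh T) :
    ∀ᵐ x ∂(volume.restrict (domain T)), x ∈ ⋃ K : Cell T, interior (hull K.1) := by
  have := hT.finite_cell
  have h : ∀ᵐ x : E3, ∀ K : Cell T, x ∈ hull K.1 → x ∈ interior (hull K.1) := by
    rw [ae_all_iff]
    exact fun K => (interior_hull_ae_eq K.1).mem_iff.mono fun x hx => hx.2
  filter_upwards [ae_restrict_of_ae h, ae_restrict_mem isOpen_interior.measurableSet] with x hx hxd
  obtain ⟨K, hK⟩ := hT.mem_space_iff.1 (interior_subset hxd)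
  exact Set.mem_iUnion.2 ⟨K, hx K hK⟩

lemma faceTerm_eq_zero [DecidableEq E3] {φ : E3 → E3} {a : Flag T}
    (h : ∀ x ∈ hull a.face, φ x = 0) : faceTerm u φ a = 0 := by
  rw [faceTerm, simplexInt_eq_zero, mul_zero]
  intro x hx
  have : cross (fieldFun (u a.1) x) 0 = 0 := by simp [cross]
  rw [h x hx, this, inner_zero_right]

/-- The face contributions of a field in `H(curl)` cancel. -/
lemma sum_faceTerm_eq_zero [DecidableEq E3] [Fintype (Cell T)] (hT : IsTetMesh T)
    (hu : MemHCurl (domain T) (glue u)) {φ : E3 → E3} (hφ : ContDiff ℝ ∞ φ)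
    (hφc : HasCompactSupport φ) (hsupp : tsupport φ ⊆ domain T) :
    ∑ a : Flag T, faceTerm u φ a = 0 := by
  obtain ⟨-, g, hg, hw⟩ := hu
  set G : E3 → E3 := glue fun K => curlField (u K) with hG
  have hGL : MemLp G 2 (volume.restrict (domain T)) := memLp_glue hT _ _
  set U : Set E3 := ⋃ K : Cell T, interior (hull K.1) with hU
  have hUo : IsOpen U := isOpen_iUnion fun K => isOpen_interior
  have hUd : U ⊆ domain T := Set.iUnion_subset fun K => interior_mono K.hull_subset_space
  have hone : (1 : ENNReal) ≤ 2 := by norm_num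
  have hgl := hg.locallyIntegrable hone
  have hGl := hGL.locallyIntegrable hone
  -- For test fields supported in the open tetrahedra the face terms are zero, so there the weak
  -- curl `g` equals the piecewise curl `G` almost everywhere. The open tetrahedra fill the domain
  -- up to a null set, so `G` is the weak curl and the face terms cancel for every admissible test
  -- field.
  have hae : ∀ᵐ x ∂(volume.restrict (domain T)), x ∈ U → (g - G) x = 0 := by
    refine hUo.ae_eq_zero_of_integral_contDiff_smul_eq_zero
      ((hgl.sub hGl).locallyIntegrableOn U) fun ψ hψ hψc hψU => ?_
    have hi1 := hgl.integrable_smul_left_of_hasCompactSupport hψ.continuous hψc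
    have hi2 := hGl.integrable_smul_left_of_hasCompactSupport hψ.continuous hψc
    have hi3 : Integrable (fun x => ψ x • (g - G) x) (volume.restrict (domain T)) := by
      refine (hi1.sub hi2).congr (Filter.Eventually.of_forall fun x => ?_)
      simp only [Pi.sub_apply, smul_sub]
    refine ext_inner_right ℝ fun c => ?_
    rw [inner_zero_left, real_inner_comm, ← integral_inner hi3 c]
    have hc1 : ContDiff ℝ ∞ fun x => ψ x • c := hψ.smul contDiff_const
    have hc2 : HasCompactSupport fun x => ψ x • c := hψc.smul_right
    have hc3 : tsupport (fun x => ψ x • c) ⊆ U :=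
      (closure_mono (Function.support_smul_subset_left _ _)).trans hψU
    have e1 := hw _ hc1 hc2 (hc3.trans hUd)
    have e2 := integral_glue_curl u (hc1.of_le (by exact_mod_cast le_top)) (hc3.trans hUd)
    rw [Finset.sum_eq_zero, sub_zero, e1] at e2
    · have e3 := integral_sub (hi1.inner_const (𝕜 := ℝ) c) (hi2.inner_const (𝕜 := ℝ) c)
      have e4 : ∀ (v : E3) (t : ℝ), inner ℝ v (t • c) = inner ℝ (t • v) c := fun v t => by
        rw [inner_smul_left, inner_smul_right]; rfl
      simp only [e4] at e2
      rw [← e2, sub_self] at e3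
      rw [← e3]
      refine integral_congr_ae (Filter.Eventually.of_forall fun x => ?_)
      simp only [Pi.sub_apply, smul_sub, inner_sub_right]
      rw [real_inner_comm, real_inner_comm _ c]
    · intro a _
      refine faceTerm_eq_zero fun x hx =>
        image_eq_zero_of_notMem_tsupport (f := fun x => ψ x • c) fun hxs => ?_
      obtain ⟨K, hK⟩ := Set.mem_iUnion.1 (hc3 hxs)
      refine K.notMem_of_mem_interior a.face_mem (fun hs => ?_) hK hx
      have := Finset.card_le_card hs
      rw [K.2.2, a.card_face] at this
      omega
  have hgG : ∀ᵐ x ∂(volume.restrict (domain T)), g x = G x := by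
    filter_upwards [hae, ae_mem_iUnion_interior hT] with x h1 h2
    exact sub_eq_zero.1 (h1 h2)
  have e1 := hw φ hφ hφc hsupp
  have e2 := integral_glue_curl u (hφ.of_le (by exact_mod_cast le_top)) hsupp
  have e3 : ∫ x in domain T, inner ℝ (g x) (φ x) = ∫ x in domain T, inner ℝ (G x) (φ x) :=
    integral_congr_ae (hgG.mono fun x hx => by simp only [hx])
  rw [e1, e3] at e2
  linarith

/-- It makes the face integrand equal to minus a square when the test field is the tangential jump.
-/
lemma inner_cross_cross (g v : E3) :
    inner ℝ g (cross v (cross v g)) = -inner ℝ (cross v g) (cross v g) := by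
  simp only [inner_eq, cross_zero_apply, cross_one_apply, cross_two_apply]; ring

/-- Fields in `H(curl)` are tangentially continuous. -/
lemma MemHCurl.tangentialC0Faces (hT : IsTetMesh T) (hu : MemHCurl (domain T) (glue u)) :
    TangentialC0Faces u := by
  classical
  have := hT.finite_cell
  have := Fintype.ofFinite (Cell T)
  intro K K' f hf hf' hfc
  by_cases hKK : K = K'
  · subst hKK; intros; simp
  obtain ⟨a, rfl, rfl⟩ := Flag.exists_of_subset hf hfc
  obtain ⟨b, rfl, hF⟩ := Flag.exists_of_subset hf' hfc
  have hF := hF.symm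
  have hab : a ≠ b := fun h => hKK (h ▸ rfl)
  set g := baryGrad a.1.1 a.2.1 with hg
  have hg0 : g ≠ 0 := baryGrad_ne_zero a.1.indep a.1.2.2 a.2.2
  intro x hx c₁ hc₁ c₂ hc₂
  -- The condition is closed, so it is enough to treat inner points of the face.
  have hcl : IsClosed {x : E3 | inner ℝ (fieldFun (u a.1 - u b.1) x) (c₁ - c₂) = 0} :=
    isClosed_eq (by fun_prop) continuous_const
  refine hcl.closure_subset_iff.2 ?_
    (hull_subset_closure_isInnerPoint a.1.indep a.1.2.2 a.2.2 hx)
  intro y hy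
  have hyF : y ∈ hull a.face := hy.mem_hull a.1.indep a.1.2.2 a.2.2
  let C : Set E3 := ⋃ c ∈ {c : Flag T | a.face ≠ c.face}, hull c.face
  have hC : IsClosed C :=
    (Set.toFinite _).isClosed_biUnion fun c _ => (isCompact_hull c.face).isClosed
  have hyC : y ∉ C := fun h => by
    obtain ⟨c, hc, hyc⟩ := Set.mem_iUnion₂.1 h
    exact Flag.notMem_hull_of_face_ne hc hy hyc
  have hyD : y ∈ domain T :=
    interior_mono (Set.union_subset a.1.hull_subset_space b.1.hull_subset_space)
      (hy.mem_interior_union a.1.indep a.1.2.2 b.1.indep b.1.2.2 a.2.2 b.2.2 hF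
        (Flag.cell_ne hF hab) (hull_inter_hull_subset a.1.2.1 b.1.2.1))
  -- The cut-off lives in the domain and avoids all other faces, so only the two sides of this face
  -- contribute.
  obtain ⟨η, hηs, hηc, hη, hηr, hηy⟩ := exists_contDiff_tsupport_subset (n := ⊤)
    (Filter.inter_mem (isOpen_interior.mem_nhds hyD) (hC.isOpen_compl.mem_nhds hyC))
  -- `J` is the rotated tangential jump. Testing with `η J` turns the face identity into the
  -- vanishing of the integral of `η |J|²`.
  set J : E3 → E3 := fun z => cross (fieldFun (u a.1 - u b.1) z) g with hJ
  have hJc : ContDiff ℝ ∞ J := contDiff_cross (contDiff_fieldFun _) contDiff_const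
  set φ : E3 → E3 := fun z => η z • J z with hφ
  have hφc : ContDiff ℝ ∞ φ := hη.smul hJc
  have hφs : tsupport φ ⊆ tsupport η := closure_mono (Function.support_smul_subset_left η J)
  have hsum := sum_faceTerm_eq_zero hT hu hφc hηc.smul_right
    (hφs.trans (hηs.trans Set.inter_subset_left))
  rw [Fintype.sum_eq_add a b hab, faceTerm_add_of_neighbour u hφc.continuous hF hab] at hsum
  · have hpos := volFactor_pos a.1.indep a.1.2.2
    have h0 := (mul_eq_zero.1 hsum).resolve_left hpos.ne'
    obtain ⟨e, he⟩ := exists_enumerates a.indep_face a.card_face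
    obtain ⟨C', -, hI⟩ := integral_hull_eq_simplexInt (d := 2) a.indep_face a.card_face
    have h1 : ∫ z in hull a.face, η z * inner ℝ (J z) (J z) ∂μHE[2] = 0 := by
      rw [hI]
      have : (simplexInt 2 a.face fun z => η z * inner ℝ (J z) (J z)) = -1 * simplexInt 2 a.face
          fun z => inner ℝ g (cross (fieldFun (u a.1 - u b.1) z) (φ z)) := by
        rw [← simplexInt_const_mul]
        refine simplexInt_congr fun z _ => ?_
        simp only [hφ, cross_smul_right, inner_smul_right, hJ, inner_cross_cross]
        ring
      rw [this, h0, mul_zero, mul_zero]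
    have hηcont := hη.continuous
    have hJcont := hJc.continuous
    have h2 := he.eq_zero_of_integral_eq_zero (hηcont.mul (hJcont.inner hJcont))
      (fun z _ => mul_nonneg (hηr ⟨z, rfl⟩).1 real_inner_self_nonneg) h1 y hyF
    rw [Pi.mul_apply, hηy, one_mul, inner_self_eq_zero] at h2
    refine inner_eq_zero_of_cross_eq_zero hg0 h2 ?_
    rw [real_inner_comm]
    exact inner_baryGrad_face a.1.indep a.1.2.2 a.2.2 _ hc₁ _ hc₂
  · rintro c ⟨hca, hcb⟩
    refine faceTerm_eq_zero fun z hz => ?_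
    by_cases hcf : a.face = c.face
    · exact absurd (Flag.eq_of_face_eq hF hab hcf (Ne.symm hca)) (Ne.symm hcb)
    · refine image_eq_zero_of_notMem_tsupport fun hzs => (hηs (hφs hzs)).2 ?_
      exact Set.mem_biUnion (x := c) hcf hz

end HCurl

/-! ### The global space -/

section Global

variable {T : Geometry.SimplicialComplex ℝ E3} {u : PiecewiseField T} {p : ℕ}
  {νe : Finset E3 → Fin 2 → E3} {νf : Finset E3 → E3}

lemma Cell.mem_faces_of_subset (K : Cell T) {s : Finset E3} (hs : s ⊆ K.1) (hc : s.card ≠ 0) :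
    s ∈ T.faces :=
  T.down_closed K.2.1 hs (Finset.card_ne_zero.1 hc)

/-- The degrees of freedom on a face and on its edges and vertices determine the tangential trace
there. Hence common values give tangential continuity, which is membership in `H(curl)`. -/
lemma mem_W1_of_mem_assembledSpace (hp : 4 ≤ p) (hT : IsTetMesh T)
    (hνe : ∀ e ∈ T.faces, e.card = 2 → IsEdgeNormals e (νe e))
    (hνf : ∀ f ∈ T.faces, f.card = 3 → IsFaceNormal f (νf f))
    (hu : u ∈ assembledSpace p T νe νf) : u ∈ W1 p T := by
  obtain ⟨hdeg, d, hd⟩ := hu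
  refine ⟨hdeg, memHCurl_of_tangentialC0Faces hT ?_, ?_, ?_, ?_⟩
  · intro K K' f hf hf' hfc x hx b hb c hc
    have hfT := K.mem_faces_of_subset hf (by omega)
    have h0 := (hd K).trace_eq hp (hd K') (hdeg K) (hdeg K') (T.indep hfT) hf hf' hfc
      (fun e he hec => hνe e (K.mem_faces_of_subset (he.trans hf) (by omega)) hec)
      (hνf f hfT hfc) x hx
    exact inner_eq_zero_of_cross_eq_zero (hνf f hfT hfc).ne_zero h0
      ((hνf f hfT hfc).2 b hb c hc)
  · intro K K' a ha ha'
    exact ⟨((hd K).value a ha).trans ((hd K').value a ha').symm,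
      fun i => ((hd K).deriv a ha i).trans ((hd K').deriv a ha' i).symm⟩
  · intro K K' e he he' hec x hx
    have heT := K.mem_faces_of_subset he (by omega)
    have h0 := (hd K).edge_eq (hd K') (hdeg K) (hdeg K') (T.indep heT) he he' hec x hx
    rwa [map_sub, Pi.sub_apply, sub_eq_zero] at h0
  · intro K K' e he he' hec x hx ν hν
    have heT := K.mem_faces_of_subset he (by omega)
    have h0 := (hd K).edge_curl_eq (hd K') (hdeg K) (hdeg K') (T.indep heT) he he' hec
      (hνe e heT hec) x hx ν hν
    have h1 : curlField (u K - u K') = curlField (u K) - curlField (u K') :=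
      map_sub curlLin (u K) (u K')
    rwa [h1, map_sub, Pi.sub_apply, inner_sub_left, sub_eq_zero] at h0

open Classical in
/-- The piece of `u` on some tetrahedron with the face `s`. -/
def somePiece (u : PiecewiseField T) (s : Finset E3) : PolyField :=
  if h : ∃ K : Cell T, s ⊆ K.1 then u h.choose else 0

lemma exists_somePiece_eq (u : PiecewiseField T) {K : Cell T} {s : Finset E3} (hs : s ⊆ K.1) :
    ∃ K' : Cell T, s ⊆ K'.1 ∧ somePiece u s = u K' := by
  have h : ∃ K : Cell T, s ⊆ K.1 := ⟨K, hs⟩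
  exact ⟨h.choose, h.choose_spec, dif_pos h⟩

open Classical in
/-- The degrees of freedom of a piecewise polynomial field, where each is computed from some
tetrahedron. -/
def someDofs (p : ℕ) (νe : Finset E3 → Fin 2 → E3) (νf : Finset E3 → E3)
    (u : PiecewiseField T) : DofValues p νf where
  value a := fieldFun (somePiece u {a}) a
  deriv a i := fieldFun (partialField i (somePiece u {a})) a
  edge e := if h : AffineIndependent ℝ ((↑) : e → E3) ∧ e.card = 2 then
    edgeMoment h.1 h.2 _ (somePiece u e) else 0
  edgeCurl e i := if h : AffineIndependent ℝ ((↑) : e → E3) ∧ e.card = 2 then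
    edgeCurlMoment h.1 h.2 (νe e i) _ (somePiece u e) else 0
  face f := if h : AffineIndependent ℝ ((↑) : f → E3) ∧ f.card = 3 then
    faceMoment h.1 h.2 (νf f) _ (somePiece u f) else 0
  faceCurl f := if h : AffineIndependent ℝ ((↑) : f → E3) ∧ f.card = 3 then
    faceCurlMoment h.1 h.2 (νf f) _ (somePiece u f) else 0
  interior K := interiorMoment K _ (somePiece u K)

/-- Continuity makes the choice of the tetrahedron from which a value is computed irrelevant. -/
lemma hasDofs_someDofs (hT : IsTetMesh T)
    (hνe : ∀ e ∈ T.faces, e.card = 2 → IsEdgeNormals e (νe e))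
    (hνf : ∀ f ∈ T.faces, f.card = 3 → IsFaceNormal f (νf f))
    (hu : u ∈ W1 p T) (K : Cell T) : HasDofs νe νf K.1 (u K) (someDofs p νe νf u) := by
  obtain ⟨hdeg, hcurl, hV, hE, hEc⟩ := hu
  have htrace : ∀ K K' : Cell T, ∀ f ⊆ K.1, f ⊆ K'.1 → f.card = 3 → ∀ x ∈ hull f,
      cross (fieldFun (u K - u K') x) (νf f) = 0 := by
    intro K K' f hf hf' hfc x hx
    have hfT := K.mem_faces_of_subset hf (by omega)
    obtain ⟨a, ha⟩ := exists_enumerates (T.indep hfT) hfc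
    exact cross_eq_zero_of_inner_eq_zero (hνf f hfT hfc) ha fun j =>
      hcurl.tangentialC0Faces hT K K' f hf hf' hfc x hx _ (ha.mem _) _ (ha.mem _)
  refine ⟨fun a ha => ?_, fun a ha i => ?_, fun e he hec q => ?_, fun e he hec i q => ?_,
    fun f hf hfc q => ?_, fun f hf hfc q => ?_, fun z => ?_⟩
  · obtain ⟨K', hK', h⟩ := exists_somePiece_eq u (Finset.singleton_subset_iff.2 ha)
    simp only [someDofs, h]
    exact (hV K K' a ha (Finset.singleton_subset_iff.1 hK')).1
  · obtain ⟨K', hK', h⟩ := exists_somePiece_eq u (Finset.singleton_subset_iff.2 ha)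
    simp only [someDofs, h]
    exact (hV K K' a ha (Finset.singleton_subset_iff.1 hK')).2 i
  · obtain ⟨K', hK', h⟩ := exists_somePiece_eq u he
    simp only [someDofs, h]
    rw [dif_pos ⟨T.indep (K.mem_faces_of_subset he (by omega)), hec⟩, edgeMoment_apply]
    exact setIntegral_hull_congr fun x hx => by rw [hE K K' e he hK' hec x hx]
  · obtain ⟨K', hK', h⟩ := exists_somePiece_eq u he
    have heT := K.mem_faces_of_subset he (by omega)
    simp only [someDofs, h]
    rw [dif_pos ⟨T.indep heT, hec⟩, edgeCurlMoment_apply]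
    exact setIntegral_hull_congr fun x hx => by
      rw [hEc K K' e he hK' hec x hx (νe e i) ((hνe e heT hec).2.1 i)]
  · obtain ⟨K', hK', h⟩ := exists_somePiece_eq u hf
    have hfT := K.mem_faces_of_subset hf (by omega)
    simp only [someDofs, h]
    rw [dif_pos ⟨T.indep hfT, hfc⟩, faceMoment_apply]
    refine setIntegral_hull_congr fun x hx => ?_
    have h0 := htrace K K' f hf hK' hfc x hx
    rw [map_sub, Pi.sub_apply, cross_sub_left, sub_eq_zero] at h0
    rw [h0]
  · obtain ⟨K', hK', h⟩ := exists_somePiece_eq u hf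
    have hfT := K.mem_faces_of_subset hf (by omega)
    simp only [someDofs, h]
    rw [dif_pos ⟨T.indep hfT, hfc⟩, faceCurlMoment_apply]
    refine setIntegral_hull_congr fun x hx => ?_
    -- Continuity of the normal curl across faces is not among the defining conditions; it follows
    -- from tangential continuity.
    have h0 := curl_normal_eq_zero_of_trace_eq_zero (T.indep hfT) hfc (hνf f hfT hfc)
      (htrace K K' f hf hK' hfc) x hx
    have h1 : curlField (u K - u K') = curlField (u K) - curlField (u K') :=
      map_sub curlLin (u K) (u K')
    rw [h1, map_sub, Pi.sub_apply, inner_sub_left, sub_eq_zero] at h0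
    rw [h0]
  · obtain ⟨K', hK', h⟩ := exists_somePiece_eq u (subset_refl K.1)
    obtain rfl := Cell.eq_of_subset hK'
    simp only [someDofs, h]
    rw [interiorMoment_apply]

lemma assembledSpace_eq_W1 (hp : 4 ≤ p) (hT : IsTetMesh T)
    (hνe : ∀ e ∈ T.faces, e.card = 2 → IsEdgeNormals e (νe e))
    (hνf : ∀ f ∈ T.faces, f.card = 3 → IsFaceNormal f (νf f)) :
    assembledSpace p T νe νf = W1 p T :=
  Set.Subset.antisymm (fun _ hu => mem_W1_of_mem_assembledSpace hp hT hνe hνf hu)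
    fun _ hu => ⟨hu.1, someDofs p νe νf _, hasDofs_someDofs hT hνe hνf hu⟩

/-- The prescription is indexed by the simplices of the mesh, so the local solutions automatically
share their values and fit together. -/
lemma existsUnique_hasDofs_global (hp : 4 ≤ p) (hT : IsTetMesh T)
    (hνe : ∀ e ∈ T.faces, e.card = 2 → IsEdgeNormals e (νe e))
    (hνf : ∀ f ∈ T.faces, f.card = 3 → IsFaceNormal f (νf f)) (d : DofValues p νf) :
    ∃! u : PiecewiseField T, u ∈ W1 p T ∧ ∀ K, HasDofs νe νf K.1 (u K) d := by
  have hνe' : ∀ K : Cell T, ∀ e ⊆ K.1, e.card = 2 → IsEdgeNormals e (νe e) := fun K e he hec =>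
    hνe e (K.mem_faces_of_subset he (by omega)) hec
  have hνf' : ∀ K : Cell T, ∀ f ⊆ K.1, f.card = 3 → IsFaceNormal f (νf f) := fun K f hf hfc =>
    hνf f (K.mem_faces_of_subset hf (by omega)) hfc
  choose u hu using fun K : Cell T =>
    exists_hasDofs hp K.indep K.2.2 (hνe' K) (hνf' K) d
  refine ⟨u, ⟨mem_W1_of_mem_assembledSpace hp hT hνe hνf ⟨fun K => (hu K).1, d, fun K => (hu K).2⟩,
    fun K => (hu K).2⟩, fun u' hu' => funext fun K => ?_⟩
  exact (hu'.2 K).unique hp K.indep K.2.2 (hνe' K) (hνf' K) (hu K).2 (hu'.1.1 K) (hu K).1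

end Global

end NodalCurl

end

open NodalCurl in
theorem mainTheorem3 (p : ℕ) (hp : 4 ≤ p) :
    -- unisolvence on a tetrahedron
    (∀ (K : Finset E3) (νe : Finset E3 → Fin 2 → E3) (νf : Finset E3 → E3),
      K.card = 4 → AffineIndependent ℝ ((↑) : K → E3) →
      (∀ e ⊆ K, e.card = 2 → IsEdgeNormals e (νe e)) →
      (∀ f ⊆ K, f.card = 3 → IsFaceNormal f (νf f)) →
      ∀ d : DofValues p νf, ∃! w : PolyField, w ∈ polyFieldDeg p ∧ HasDofs νe νf K w d) ∧
    -- the global space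
    (∀ (T : Geometry.SimplicialComplex ℝ E3)
      (νe : Finset E3 → Fin 2 → E3) (νf : Finset E3 → E3),
      IsTetMesh T →
      (∀ e ∈ T.faces, e.card = 2 → IsEdgeNormals e (νe e)) →
      (∀ f ∈ T.faces, f.card = 3 → IsFaceNormal f (νf f)) →
      (∀ u ∈ assembledSpace p T νe νf, MemHCurl (domain T) (glue u)) ∧
      assembledSpace p T νe νf = W1 p T ∧
      ∀ d : DofValues p νf,
        ∃! u : PiecewiseField T, u ∈ W1 p T ∧ ∀ K, HasDofs νe νf K.1 (u K) d) := by
  refine ⟨fun K νe νf hc hi hνe hνf d => ?_, fun T νe νf hT hνe hνf => ?_⟩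
  · obtain ⟨w, hw, h⟩ := exists_hasDofs hp hi hc hνe hνf d
    exact ⟨w, ⟨hw, h⟩, fun w' h' => h'.2.unique hp hi hc hνe hνf h h'.1 hw⟩
  · exact ⟨fun u hu => (mem_W1_of_mem_assembledSpace hp hT hνe hνf hu).2.1,
      assembledSpace_eq_W1 hp hT hνe hνf, existsUnique_hasDofs_global hp hT hνe hνf⟩
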